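/- Let $T>0$, $\nu\in\mathbb{R}$, $\zeta,P\in C^2([0,T])$ and $f,p\in C^0([0,T];H^2(\mathbb{R}))$. Let $u_0\in H^2(\mathbb{R})$ and $u_1\in L^2(\mathbb{R})\cap L^\infty(\mathbb{R})$. Let $\theta\in C_c^\infty(\mathbb{R})$ be an even probability density, put $\theta^\epsilon(x)=\frac1\epsilon\theta(\frac{x}{\epsilon})$ for $\epsilon>0$, and let $\star$ denote convolution in $x$. For every $\epsilon>0$ let $$u^\epsilon\in C^0([0,T];H^4(\mathbb{R}))\cap C^1([0,T];H^2(\mathbb{R}))\cap C^2([0,T];L^2(\mathbb{R}))$$ be a solution of the mollified Gao beam problem $$u^\epsilon_{tt}+\partial_t\bigl(\theta^\epsilon(\cdot-\zeta(t))\,u^\epsilon_t\bigr)+u^\epsilon_{xxxx}-\bigl[\bigl((u^\epsilon\star(\theta^\epsilon)')^2-\nu p\bigr)\,(u^\epsilon\star(\theta^\epsilon)'')\bigr]\star\theta^\epsilon+h^\epsilon=0\quad\text{on }[0,T]\times\mathbb{R},$$ $$h^\epsilon=-\bigl(f+\theta^\epsilon(\cdot-\zeta(t))P(t)\bigr),\qquad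 u^\epsilon(0,\cdot)=u_0\star\theta^\epsilon,\qquad u^\epsilon_t(0,\cdot)=u_1\star\theta^\epsilon.$$ Then every sequence of positive numbers tending to $0$ has a subsequence $(\epsilon_k)_{k\in\mathbb{N}}$ for which there is a function $u\in L^2(0,T;H^2(\mathbb{R}))$, with weak time derivative $u_t\in L^2(0,T;L^2(\mathbb{R}))$, such that, as $k\to+\infty$: (i) $u^{\epsilon_k}\rightharpoonup u$, $u^{\epsilon_k}_t\rightharpoonup u_t$ and $u^{\epsilon_k}_{xx}\rightharpoonup u_{xx}$ weakly in $L^2(0,T;L^2(\mathbb{R}))$; (ii) for every compact set $K\subset\mathbb{R}$ and every $\alpha\in\,]0,2]$, $u^{\epsilon_k}\to u$ strongly in $C^0([0,T];H^{2-\alpha}(K))$, and $u^{\epsilon_k}_x\to u_x$ strongly in $L^\infty([0,T]\times K)$, where $H^s(K)$ is the space of restrictions to $K$ of functions in $H^s(\mathbb{R})$ with the quotient norm; (iii) for all real $a<b$, $u^{\epsilon_k}_x\star\theta^{\epsilon_k}\to u_x$ and $(u^{\epsilon_k}_x\star\theta^{\epsilon_k})^3\to u_x^3$ strongly in $L^2([0,T]\times[a,b])$.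 -/

import Mathlib

open MeasureTheory Set Filter Topology
open scoped ENNReal ContDiff

noncomputable section

/-- The real Hilbert space `L²(ℝ)`. -/
abbrev LTwo : Type := Lp ℝ 2 (volume : Measure ℝ)

/-- `g` is the weak (distributional) derivative of order `j` of `f` on `ℝ`. -/
def IsWeakDeriv (j : ℕ) (f g : LTwo) : Prop :=
  ∀ φ : ℝ → ℝ, ContDiff ℝ ∞ φ → HasCompactSupport φ →
    ∫ x, f x * iteratedDeriv j φ x = (-1) ^ j * ∫ x, g x * φ x

theorem integrable_mul_of_test (f : LTwo) {ψ : ℝ → ℝ} (hψ : Continuous ψ)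
    (hc : HasCompactSupport ψ) : Integrable (fun x => f x * ψ x) :=
  MemLp.integrable_mul (p := 2) (q := 2) (Lp.memLp f) (hψ.memLp_of_hasCompactSupport hc)

theorem hasCompactSupport_iterated_deriv {φ : ℝ → ℝ} (hc : HasCompactSupport φ) (j : ℕ) :
    HasCompactSupport (iteratedDeriv j φ) := by
  induction j with
  | zero => simpa using hc
  | succ j ih => rw [iteratedDeriv_succ]; exact ih.deriv

theorem IsWeakDeriv.add {j : ℕ} {f g f' g' : LTwo} (h : IsWeakDeriv j f g)
    (h' : IsWeakDeriv j f' g') : IsWeakDeriv j (f + f') (g + g') := by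
  intro φ hφ hc
  have hj : Continuous (iteratedDeriv j φ) := hφ.continuous_iteratedDeriv j (by exact_mod_cast le_top)
  have hcj := hasCompactSupport_iterated_deriv hc j
  have e1 : ∫ x, (f + f') x * iteratedDeriv j φ x
      = ∫ x, (f x * iteratedDeriv j φ x + f' x * iteratedDeriv j φ x) := by
    refine integral_congr_ae ?_
    filter_upwards [Lp.coeFn_add f f'] with x hx
    rw [hx, Pi.add_apply, add_mul]
  have e2 : ∫ x, (g + g') x * φ x = ∫ x, (g x * φ x + g' x * φ x) := by
    refine integral_congr_ae ?_
    filter_upwards [Lp.coeFn_add g g'] with x hx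
    rw [hx, Pi.add_apply, add_mul]
  rw [e1, e2, integral_add (integrable_mul_of_test f hj hcj) (integrable_mul_of_test f' hj hcj),
    integral_add (integrable_mul_of_test g hφ.continuous hc)
      (integrable_mul_of_test g' hφ.continuous hc), h φ hφ hc, h' φ hφ hc, mul_add]

theorem IsWeakDeriv.smul {j : ℕ} {f g : LTwo} (c : ℝ) (h : IsWeakDeriv j f g) :
    IsWeakDeriv j (c • f) (c • g) := by
  intro φ hφ hc
  have e1 : ∫ x, (c • f) x * iteratedDeriv j φ x = ∫ x, c * (f x * iteratedDeriv j φ x) := by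
    refine integral_congr_ae ?_
    filter_upwards [Lp.coeFn_smul c f] with x hx
    rw [hx, Pi.smul_apply, smul_eq_mul, mul_assoc]
  have e2 : ∫ x, (c • g) x * φ x = ∫ x, c * (g x * φ x) := by
    refine integral_congr_ae ?_
    filter_upwards [Lp.coeFn_smul c g] with x hx
    rw [hx, Pi.smul_apply, smul_eq_mul, mul_assoc]
  rw [e1, e2, integral_const_mul, integral_const_mul, h φ hφ hc]
  ring

theorem IsWeakDeriv.zero (j : ℕ) : IsWeakDeriv j 0 0 := by
  intro φ _ _
  have e : ∀ ψ : ℝ → ℝ, ∫ x, (0 : LTwo) x * ψ x = 0 := by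
    intro ψ
    refine integral_eq_zero_of_ae ?_
    filter_upwards [Lp.coeFn_zero ℝ 2 (volume : Measure ℝ)] with x hx
    rw [hx]; simp
  rw [e, e, mul_zero]

/-- The Sobolev space `H^m(ℝ)`, `m ∈ ℕ`: an element is an `L²` function together with its (unique)
weak derivatives of orders `1, …, m`, all in `L²`. The norm inherited from the product is
`(∑_{j ≤ m} ‖∂ₓʲ u‖²_{L²})^{1/2}`. -/
def SobolevH (m : ℕ) : Submodule ℝ (PiLp 2 (fun _ : Fin (m + 1) => LTwo)) where
  carrier := {F | ∀ j : Fin (m + 1), IsWeakDeriv j (F 0) (F j)}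
  add_mem' := fun ha hb j => (ha j).add (hb j)
  zero_mem' := fun j => IsWeakDeriv.zero j
  smul_mem' := fun c _ ha j => (ha j).smul c

/-- `dx j u` is the weak derivative `∂ₓʲ u ∈ L²(ℝ)` of `u ∈ H^m(ℝ)`, `j ≤ m`; `dx 0 u` is `u`. -/
def dx {m : ℕ} (j : Fin (m + 1)) (u : SobolevH m) : LTwo := (u : PiLp 2 (fun _ => LTwo)) j

/-- An `L²` function, seen as complex valued. -/
def toComplexLTwo (f : LTwo) : Lp ℂ 2 (volume : Measure ℝ) := Complex.ofRealCLM.compLp f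

/-- The norm of `H^s(ℝ)`, `s ≥ 0`, through the Fourier transform: the `L²` norm of
`(1 + ξ²)^{s/2} f̂(ξ)`. It is `⊤` exactly when `f ∈ L²(ℝ)` is not in `H^s(ℝ)`. -/
def hsENorm (s : ℝ) (f : LTwo) : ℝ≥0∞ :=
  eLpNorm (fun ξ : ℝ => (1 + ξ ^ 2) ^ (s / 2) •
    (FourierTransform.fourier (toComplexLTwo f) : Lp ℂ 2 (volume : Measure ℝ)) ξ) 2 volume

/-- The (quotient) norm of `H^s(K)`, the space of restrictions to `K` of elements of `H^s(ℝ)`,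
`s ≥ 0`: the infimum of the norms in `H^s(ℝ)` of the functions that agree with `f` on `K`. -/
def hsENormOn (s : ℝ) (K : Set ℝ) (f : LTwo) : ℝ≥0∞ :=
  ⨅ (g : LTwo) (_ : g =ᵐ[volume.restrict K] f), hsENorm s g

/-- `w ∈ C⁰([0,T]; H^s(K))`. -/
def ContinuousInHs (T s : ℝ) (K : Set ℝ) (w : ℝ → LTwo) : Prop :=
  ∀ t ∈ Icc 0 T, hsENormOn s K (w t) < ⊤ ∧
    Tendsto (fun r => hsENormOn s K (w r - w t)) (𝓝[Icc 0 T] t) (𝓝 0)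

/-- Strong convergence `w k → w'` in `C⁰([0,T]; H^s(K))`. -/
def TendstoInCHs (T s : ℝ) (K : Set ℝ) (w : ℕ → ℝ → LTwo) (w' : ℝ → LTwo) : Prop :=
  (∀ k, ContinuousInHs T s K (w k)) ∧ ContinuousInHs T s K w' ∧
    Tendsto (fun k => ⨆ t ∈ Icc 0 T, hsENormOn s K (w k t - w' t)) atTop (𝓝 0)

/-- The norm of `L^∞([0,T] × K)`, as the supremum over all `t ∈ [0,T]` of the norm of `w(t, ·)` in
`L^∞(K)` (by Fubini's theorem, at least the essential supremum over `[0,T] × K`). -/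
def linftyENorm (T : ℝ) (K : Set ℝ) (w : ℝ → LTwo) : ℝ≥0∞ :=
  ⨆ t ∈ Icc 0 T, eLpNorm (w t) ⊤ (volume.restrict K)

/-- Strong convergence `w k → w'` in `L^∞([0,T] × K)`. -/
def TendstoInLinfty (T : ℝ) (K : Set ℝ) (w : ℕ → ℝ → LTwo) (w' : ℝ → LTwo) : Prop :=
  (∀ k, linftyENorm T K (w k) < ⊤) ∧ linftyENorm T K w' < ⊤ ∧
    Tendsto (fun k => linftyENorm T K (fun t => w k t - w' t)) atTop (𝓝 0)

/-- The square of the norm of `L²([0,T] × [a,b])`, as an iterated integral. -/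
def sqNormOn (T a b : ℝ) (w : ℝ → ℝ → ℝ) : ℝ≥0∞ :=
  ∫⁻ t in Icc 0 T, ∫⁻ x in Icc a b, ‖w t x‖ₑ ^ 2

/-- Strong convergence `w k → w'` in `L²([0,T] × [a,b])`. -/
def TendstoInLTwoOn (T a b : ℝ) (w : ℕ → ℝ → ℝ → ℝ) (w' : ℝ → ℝ → ℝ) : Prop :=
  (∀ k, sqNormOn T a b (w k) < ⊤) ∧ sqNormOn T a b w' < ⊤ ∧
    Tendsto (fun k => sqNormOn T a b (fun t x => w k t x - w' t x)) atTop (𝓝 0)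

/-- Weak convergence `w k ⇀ w'` in the Hilbert space `L²(0,T; L²(ℝ))`. -/
def TendstoWeakly (T : ℝ) (w : ℕ → ℝ → LTwo) (w' : ℝ → LTwo) : Prop :=
  (∀ k, MemLp (w k) 2 (volume.restrict (Icc 0 T))) ∧ MemLp w' 2 (volume.restrict (Icc 0 T)) ∧
    ∀ g : ℝ → LTwo, MemLp g 2 (volume.restrict (Icc 0 T)) →
      Tendsto (fun k => ∫ t in Icc 0 T, inner ℝ (w k t) (g t)) atTop
        (𝓝 (∫ t in Icc 0 T, inner ℝ (w' t) (g t)))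

/-- `w'` is the weak time derivative on `(0,T)` of the `L²(ℝ)`-valued function `w`. -/
def IsWeakTimeDeriv (T : ℝ) (w w' : ℝ → LTwo) : Prop :=
  ∀ φ : ℝ → ℝ, ContDiff ℝ ∞ φ → HasCompactSupport φ → tsupport φ ⊆ Ioo 0 T →
    ∫ t in Icc 0 T, deriv φ t • w t = -∫ t in Icc 0 T, φ t • w' t

/-- The space `E₀(T) = C⁰([0,T]; H⁴(ℝ)) ∩ C¹([0,T]; H²(ℝ)) ∩ C²([0,T]; L²(ℝ))`. -/
def MemEZero (T : ℝ) (U : ℝ → SobolevH 4) : Prop :=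
  ContinuousOn U (Icc 0 T) ∧
  (∃ V : ℝ → SobolevH 2, ContDiffOn ℝ 1 V (Icc 0 T) ∧ ∀ t ∈ Icc 0 T, dx 0 (V t) = dx 0 (U t)) ∧
  ContDiffOn ℝ 2 (fun t => dx 0 (U t)) (Icc 0 T)

/-- The time derivative `∂ₜʲ u ∈ L²(ℝ)` at time `t ∈ [0,T]` of a curve `u` (one-sided at `0`
and `T`). -/
def dt (T : ℝ) (j : ℕ) {m : ℕ} (U : ℝ → SobolevH m) (t : ℝ) : LTwo :=
  iteratedDerivWithin j (fun s => dx 0 (U s)) (Icc 0 T) t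

/-- `θ` is an even probability density in `C_c^∞(ℝ)`. -/
structure IsEvenBump (θ : ℝ → ℝ) : Prop where
  smooth : ContDiff ℝ ∞ θ
  compact : HasCompactSupport θ
  nonneg : ∀ x, 0 ≤ θ x
  even : ∀ x, θ (-x) = θ x
  integral_eq_one : ∫ x, θ x = 1

/-- `θ^ε(x) = ε⁻¹ θ(x / ε)`. -/
def mollifier (θ : ℝ → ℝ) (ε x : ℝ) : ℝ := 1 / ε * θ (x / ε)

/-- The convolution `(f ⋆ g)(x) = ∫ f(y) g(x - y) dy` of real functions on `ℝ`. -/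
def conv (f g : ℝ → ℝ) : ℝ → ℝ :=
  convolution f g (ContinuousLinearMap.mul ℝ ℝ) volume

/-- The mollified nonlinear term `[((u ⋆ θ^ε′)² - ν p) (u ⋆ θ^ε″)] ⋆ θ^ε`. -/
def nonlinearTerm (θ : ℝ → ℝ) (ε ν : ℝ) (p u : ℝ → ℝ) : ℝ → ℝ :=
  conv (fun y => (conv u (deriv (mollifier θ ε)) y ^ 2 - ν * p y) *
    conv u (iteratedDeriv 2 (mollifier θ ε)) y) (mollifier θ ε)

/-- `U ∈ E₀(T)` solves the mollified Gao beam problem with parameter `ε`: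
`u_tt + ∂ₜ(θ^ε(x - ζ(t)) u_t) + u_xxxx - [((u ⋆ θ^ε′)² - ν p)(u ⋆ θ^ε″)] ⋆ θ^ε + h^ε = 0`,
where `h^ε = -(f + θ^ε(x - ζ(t)) P(t))`, with `u(0) = u₀ ⋆ θ^ε` and `u_t(0) = u₁ ⋆ θ^ε`.
The equation holds in `L²(ℝ)` for each `t ∈ [0,T]`, and
`∂ₜ(θ^ε(x - ζ(t)) u_t) = θ^ε(x - ζ(t)) u_tt - ζ'(t) θ^ε′(x - ζ(t)) u_t`. -/
structure IsMollifiedSolution (T ν : ℝ) (ζ P θ : ℝ → ℝ) (f p : ℝ → SobolevH 2)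
    (u₀ : SobolevH 2) (u₁ : LTwo) (ε : ℝ) (U : ℝ → SobolevH 4) : Prop where
  regular : MemEZero T U
  equation : ∀ t ∈ Icc 0 T, ∀ᵐ x : ℝ,
    dt T 2 U t x
      + (mollifier θ ε (x - ζ t) * dt T 2 U t x
        - derivWithin ζ (Icc 0 T) t * deriv (mollifier θ ε) (x - ζ t) * dt T 1 U t x)
      + dx 4 (U t) x
      - nonlinearTerm θ ε ν (dx 0 (p t)) (dx 0 (U t)) x
      + -(dx 0 (f t) x + mollifier θ ε (x - ζ t) * P t) = 0
  init_pos : ∀ᵐ x : ℝ, dx 0 (U 0) x = conv (dx 0 u₀) (mollifier θ ε) x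
  init_vel : ∀ᵐ x : ℝ, dt T 1 U 0 x = conv u₁ (mollifier θ ε) x

end

/-!
Testing the equation against `u_t + ζ' u_x`, the velocity seen by the moving point mass, makes the
transport terms cancel. Since the mollifier is even, convolution with it is self-adjoint, and the
nonlinear term becomes the time derivative of a quartic energy up to terms controlled by the energy.
Gronwall's inequality then bounds `u^ε` in `L^∞(0, T; H²)` and `u^ε_t` in `L^∞(0, T; L²)`
independently of `ε`; the initial energy of the point mass stays bounded because `u₁ ∈ L^∞`.

The curves `u^ε` are therefore uniformly Lipschitz in `L²`, and weak compactness gives a subsequence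
that converges weakly in `L²` at every time. After cutting off in space the convergence is strong in
`L²`, uniformly in time, and interpolation against the bound in `H²` upgrades it to `H^s` for
`s < 2` and to uniform convergence of the slopes on compact sets, hence to that of their cubes.
-/

open scoped BoundedContinuousFunction

instance fact_two_ne_top : Fact ((2 : ℝ≥0∞) ≠ ⊤) := ⟨ENNReal.ofNat_ne_top⟩

theorem inner_eq_integral (f g : LTwo) : inner ℝ f g = ∫ x, f x * g x := by
  simp only [L2.inner_def, RCLike.inner_apply, conj_trivial, mul_comm]

theorem LTwo.integrable_mul (f g : LTwo) : Integrable (fun x => f x * g x) :=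
  MemLp.integrable_mul (p := 2) (q := 2) (Lp.memLp f) (Lp.memLp g)

theorem LTwo.locallyIntegrable (f : LTwo) : LocallyIntegrable f volume :=
  (Lp.memLp f).locallyIntegrable one_le_two

section Multiplication

theorem memLp_bcf_mul (φ : ℝ →ᵇ ℝ) (f : LTwo) : MemLp (fun x => φ x * f x) 2 volume :=
  (Lp.memLp f).mul' φ.memLp_top

theorem norm_toLp_bcf_mul_le (φ : ℝ →ᵇ ℝ) (f : LTwo) :
    ‖(memLp_bcf_mul φ f).toLp‖ ≤ ‖φ‖ * ‖f‖ := by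
  refine Lp.norm_le_mul_norm_of_ae_le_mul ?_
  filter_upwards [(memLp_bcf_mul φ f).coeFn_toLp] with x hx
  rw [hx, norm_mul]
  gcongr
  exact φ.norm_coe_le_norm x

/-- Multiplication of `L²` functions by bounded continuous functions, as a continuous bilinear
map. -/
noncomputable def mulL : (ℝ →ᵇ ℝ) →L[ℝ] LTwo →L[ℝ] LTwo :=
  LinearMap.mkContinuous₂
    (LinearMap.mk₂ ℝ (fun φ f => (memLp_bcf_mul φ f).toLp)
      (fun φ ψ f => by
        rw [← MemLp.toLp_add]
        exact MemLp.toLp_congr _ _ (.of_forall fun x => add_mul (φ x) (ψ x) (f x)))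
      (fun c φ f => by
        rw [← MemLp.toLp_const_smul]
        exact MemLp.toLp_congr _ _ (.of_forall fun x => mul_assoc c (φ x) (f x)))
      (fun φ f g => by
        rw [← MemLp.toLp_add]
        refine MemLp.toLp_congr _ _ ?_
        filter_upwards [Lp.coeFn_add f g] with x hx
        simp only [hx, Pi.add_apply, mul_add])
      (fun c φ f => by
        rw [← MemLp.toLp_const_smul]
        refine MemLp.toLp_congr _ _ ?_
        filter_upwards [Lp.coeFn_smul c f] with x hx
        simp only [hx, Pi.smul_apply, mul_smul_comm]))
    1 (fun φ f => (norm_toLp_bcf_mul_le φ f).trans_eq (by rw [one_mul]))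

theorem coeFn_mulL (φ : ℝ →ᵇ ℝ) (f : LTwo) : mulL φ f =ᵐ[volume] fun x => φ x * f x :=
  (memLp_bcf_mul φ f).coeFn_toLp

theorem norm_mulL_le (φ : ℝ →ᵇ ℝ) (f : LTwo) : ‖mulL φ f‖ ≤ ‖φ‖ * ‖f‖ :=
  norm_toLp_bcf_mul_le φ f

theorem inner_mulL_left (φ : ℝ →ᵇ ℝ) (f g : LTwo) :
    inner ℝ (mulL φ f) g = ∫ x, φ x * f x * g x := by
  rw [inner_eq_integral]
  exact integral_congr_ae ((coeFn_mulL φ f).mul .rfl)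

theorem inner_mulL_comm (φ : ℝ →ᵇ ℝ) (f g : LTwo) :
    inner ℝ (mulL φ f) g = inner ℝ (mulL φ g) f := by
  simp only [inner_mulL_left, mul_right_comm]

theorem mulL_mulL (φ ψ : ℝ →ᵇ ℝ) (f : LTwo) : mulL φ (mulL ψ f) = mulL (φ * ψ) f := by
  apply Lp.ext
  filter_upwards [coeFn_mulL φ (mulL ψ f), coeFn_mulL ψ f, coeFn_mulL (φ * ψ) f] with x h1 h2 h3
  rw [h1, h2, h3, BoundedContinuousFunction.mul_apply, mul_assoc]

end Multiplication

section Convolution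

theorem conv_apply (f k : ℝ → ℝ) (x : ℝ) : conv f k x = ∫ y, f y * k (x - y) := rfl

theorem conv_congr_ae {f f' : ℝ → ℝ} (h : f =ᵐ[volume] f') (k : ℝ → ℝ) :
    conv f k = conv f' k := by
  funext x
  exact integral_congr_ae (h.mul .rfl)

theorem eLpNorm_two_sq (f : ℝ → ℝ) : eLpNorm f 2 volume ^ 2 = ∫⁻ x, ‖f x‖ₑ ^ 2 := by
  simpa using eLpNorm_nnreal_pow_eq_lintegral (p := 2) (f := f) two_ne_zero

/-- Cauchy–Schwarz for the measure `|k (x - y)| dy`. -/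
theorem enorm_conv_sq_le {k : ℝ → ℝ} (hk : Continuous k) {f : ℝ → ℝ}
    (hf : AEStronglyMeasurable f volume) (x : ℝ) :
    ‖conv f k x‖ₑ ^ 2 ≤ (∫⁻ y, ‖f y‖ₑ ^ 2 * ‖k (x - y)‖ₑ) * ∫⁻ y, ‖k y‖ₑ := by
  have hkm : AEMeasurable (fun y => ‖k (x - y)‖ₑ) volume := by fun_prop
  have hsqrt_sq (a : ℝ≥0∞) : (a ^ (1 / 2 : ℝ)) ^ 2 = a := by
    rw [← ENNReal.rpow_natCast, ← ENNReal.rpow_mul]; norm_num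
  have hsplit (a b : ℝ≥0∞) : a * b = (a ^ 2 * b) ^ (1 / 2 : ℝ) * b ^ (1 / 2 : ℝ) := by
    rw [← ENNReal.mul_rpow_of_nonneg _ _ (by norm_num), mul_assoc, ← sq, ← mul_pow,
      ← ENNReal.rpow_natCast, ← ENNReal.rpow_mul]
    norm_num
  calc ‖conv f k x‖ₑ ^ 2
      ≤ (∫⁻ y, ‖f y‖ₑ * ‖k (x - y)‖ₑ) ^ 2 := by
        gcongr
        simp only [conv_apply, ← enorm_mul]
        exact enorm_integral_le_lintegral_enorm _
    _ = (∫⁻ y, (‖f y‖ₑ ^ 2 * ‖k (x - y)‖ₑ) ^ (1 / 2 : ℝ) * ‖k (x - y)‖ₑ ^ (1 / 2 : ℝ)) ^ 2 := by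
        simp only [← hsplit]
    _ ≤ ((∫⁻ y, ‖f y‖ₑ ^ 2 * ‖k (x - y)‖ₑ) ^ (1 / 2 : ℝ) *
          (∫⁻ y, ‖k (x - y)‖ₑ) ^ (1 / 2 : ℝ)) ^ 2 := by
        gcongr
        exact ENNReal.lintegral_mul_norm_pow_le ((hf.enorm.pow_const 2).mul hkm) hkm
          (by norm_num) (by norm_num) (by norm_num)
    _ = (∫⁻ y, ‖f y‖ₑ ^ 2 * ‖k (x - y)‖ₑ) * ∫⁻ y, ‖k y‖ₑ := by
        rw [mul_pow, hsqrt_sq, hsqrt_sq, lintegral_sub_left_eq_self (fun y => ‖k y‖ₑ) x]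

theorem eLpNorm_conv_le {k : ℝ → ℝ} (hk : Continuous k) {f : ℝ → ℝ}
    (hf : AEStronglyMeasurable f volume) :
    eLpNorm (conv f k) 2 volume ≤ (∫⁻ y, ‖k y‖ₑ) * eLpNorm f 2 volume := by
  have hm : AEMeasurable (Function.uncurry fun x y => ‖f y‖ₑ ^ 2 * ‖k (x - y)‖ₑ)
      ((volume : Measure ℝ).prod volume) := by
    refine AEMeasurable.mul (hf.enorm.pow_const 2).comp_snd ?_
    exact (hk.comp (continuous_fst.sub continuous_snd)).measurable.enorm.aemeasurable
  refine (ENNReal.pow_le_pow_left_iff two_ne_zero).1 ?_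
  rw [eLpNorm_two_sq, mul_pow, eLpNorm_two_sq]
  calc ∫⁻ x, ‖conv f k x‖ₑ ^ 2
      ≤ ∫⁻ x, (∫⁻ y, ‖f y‖ₑ ^ 2 * ‖k (x - y)‖ₑ) * ∫⁻ y, ‖k y‖ₑ :=
        lintegral_mono fun x => enorm_conv_sq_le hk hf x
    _ = (∫⁻ x, ∫⁻ y, ‖f y‖ₑ ^ 2 * ‖k (x - y)‖ₑ) * ∫⁻ y, ‖k y‖ₑ :=
        lintegral_mul_const'' _ hm.lintegral_prod_right'
    _ = (∫⁻ y, ∫⁻ x, ‖f y‖ₑ ^ 2 * ‖k (x - y)‖ₑ) * ∫⁻ y, ‖k y‖ₑ := by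
        rw [lintegral_lintegral_swap hm]
    _ = (∫⁻ y, ‖f y‖ₑ ^ 2 * ∫⁻ x, ‖k x‖ₑ) * ∫⁻ y, ‖k y‖ₑ := by
        congr 1
        refine lintegral_congr fun y => ?_
        have hmeas : Measurable fun x => ‖k (x - y)‖ₑ :=
          (hk.comp (continuous_sub_right y)).measurable.enorm
        rw [lintegral_const_mul _ hmeas, lintegral_sub_right_eq_self (fun y => ‖k y‖ₑ) y]
    _ = (∫⁻ y, ‖k y‖ₑ) ^ 2 * ∫⁻ y, ‖f y‖ₑ ^ 2 := by
        rw [lintegral_mul_const'' _ (hf.enorm.pow_const 2)]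
        ring

variable {k : ℝ → ℝ} (hk : Continuous k) (hc : HasCompactSupport k)

include hk hc

theorem memLp_kernel (x : ℝ) : MemLp (fun y => k (x - y)) 2 volume :=
  (hk.comp (continuous_const.sub continuous_id)).memLp_of_hasCompactSupport
    (hc.comp_homeomorph (Homeomorph.subLeft x))

theorem conv_eq_inner (f : LTwo) (x : ℝ) :
    conv f k x = inner ℝ f (memLp_kernel hk hc x).toLp := by
  rw [conv_apply, inner_eq_integral]
  exact integral_congr_ae (EventuallyEq.rfl.mul (memLp_kernel hk hc x).coeFn_toLp.symm)

theorem norm_toLp_kernel (x : ℝ) :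
    ‖(memLp_kernel hk hc x).toLp‖ = (eLpNorm k 2 volume).toReal := by
  rw [Lp.norm_toLp]
  exact congrArg _ (eLpNorm_comp_measurePreserving hk.aestronglyMeasurable
    (Measure.measurePreserving_sub_left volume x))

theorem abs_conv_le (f : LTwo) (x : ℝ) : ‖conv f k x‖ ≤ (eLpNorm k 2 volume).toReal * ‖f‖ := by
  rw [conv_eq_inner hk hc, ← norm_toLp_kernel hk hc x, mul_comm]
  exact norm_inner_le_norm _ _

theorem conv_add (f g : LTwo) : conv (f + g : LTwo) k = conv f k + conv g k := by
  funext x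
  simp only [conv_eq_inner hk hc, inner_add_left, Pi.add_apply]

theorem conv_const_smul (c : ℝ) (f : LTwo) : conv (c • f : LTwo) k = c • conv f k := by
  funext x
  simp only [conv_eq_inner hk hc, real_inner_smul_left, Pi.smul_apply, smul_eq_mul]

theorem continuous_conv (f : LTwo) : Continuous (conv f k) :=
  hc.continuous_convolution_right _ f.locallyIntegrable hk

theorem memLp_conv (f : LTwo) : MemLp (conv f k) 2 volume :=
  ⟨(continuous_conv hk hc f).aestronglyMeasurable,
    (eLpNorm_conv_le hk (Lp.aestronglyMeasurable f)).trans_lt (ENNReal.mul_lt_top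
      (hk.integrable_of_hasCompactSupport hc).hasFiniteIntegral (Lp.eLpNorm_lt_top f))⟩

theorem norm_toLp_conv_le (f : LTwo) :
    ‖(memLp_conv hk hc f).toLp‖ ≤ (∫ y, ‖k y‖) * ‖f‖ := by
  rw [Lp.norm_toLp, Lp.norm_def, integral_norm_eq_lintegral_enorm hk.aestronglyMeasurable,
    ← ENNReal.toReal_mul]
  exact ENNReal.toReal_mono (ENNReal.mul_lt_top
    (hk.integrable_of_hasCompactSupport hc).hasFiniteIntegral (Lp.eLpNorm_lt_top f)).ne
    (eLpNorm_conv_le hk (Lp.aestronglyMeasurable f))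

/-- Convolution with a kernel, from `L²` to the bounded continuous functions. -/
noncomputable def convB : LTwo →L[ℝ] (ℝ →ᵇ ℝ) :=
  LinearMap.mkContinuous
    { toFun := fun f => BoundedContinuousFunction.ofNormedAddCommGroup (conv f k)
        (continuous_conv hk hc f) _ (abs_conv_le hk hc f)
      map_add' := fun f g => DFunLike.coe_injective (conv_add hk hc f g)
      map_smul' := fun c f => DFunLike.coe_injective (conv_const_smul hk hc c f) }
    (eLpNorm k 2 volume).toReal fun f =>
      (BoundedContinuousFunction.norm_le (by positivity)).2 (abs_conv_le hk hc f)

/-- Convolution with a kernel, as an operator on `L²`. -/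
noncomputable def convL : LTwo →L[ℝ] LTwo :=
  LinearMap.mkContinuous
    { toFun := fun f => (memLp_conv hk hc f).toLp
      map_add' := fun f g => by
        rw [← MemLp.toLp_add]
        exact MemLp.toLp_congr _ _ (.of_eq (conv_add hk hc f g))
      map_smul' := fun c f => by
        rw [RingHom.id_apply, ← MemLp.toLp_const_smul]
        exact MemLp.toLp_congr _ _ (.of_eq (conv_const_smul hk hc c f)) }
    (∫ y, ‖k y‖) (norm_toLp_conv_le hk hc)

theorem coeFn_convL (f : LTwo) : convL hk hc f =ᵐ[volume] conv f k :=
  (memLp_conv hk hc f).coeFn_toLp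

theorem norm_convL_le (f : LTwo) : ‖convL hk hc f‖ ≤ (∫ y, ‖k y‖) * ‖f‖ :=
  norm_toLp_conv_le hk hc f

theorem norm_convL_le_of_density (h0 : ∀ x, 0 ≤ k x) (h1 : ∫ x, k x = 1) (f : LTwo) :
    ‖convL hk hc f‖ ≤ ‖f‖ := by
  simpa only [Real.norm_of_nonneg (h0 _), h1, one_mul] using norm_convL_le hk hc f

theorem integrable_conv_kernel (f g : LTwo) :
    Integrable (Function.uncurry fun x y => f y * k (x - y) * g x) (volume.prod volume) := by
  have hm : AEStronglyMeasurable (Function.uncurry fun x y => f y * k (x - y) * g x)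
      ((volume : Measure ℝ).prod volume) :=
    ((Lp.aestronglyMeasurable f).comp_snd.mul
      (hk.comp (continuous_fst.sub continuous_snd)).aestronglyMeasurable).mul
      (Lp.aestronglyMeasurable g).comp_fst
  refine (integrable_prod_iff hm).2 ⟨.of_forall fun x => ?_, ?_⟩
  · exact (integrable_mul_of_test f (hk.comp (continuous_const.sub continuous_id))
      (hc.comp_homeomorph (Homeomorph.subLeft x))).mul_const (g x)
  · have habs : MemLp (conv (fun y => |f y|) (fun z => |k z|)) 2 volume := by
      have := memLp_conv hk.abs hc.abs (Lp.memLp f).abs.toLp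
      rwa [conv_congr_ae (Lp.memLp f).abs.coeFn_toLp] at this
    refine (MemLp.integrable_mul (p := 2) (q := 2) habs (Lp.memLp g).abs).congr
      (.of_forall fun x => ?_)
    simp only [Pi.mul_apply, Function.uncurry_apply_pair, norm_mul, Real.norm_eq_abs, conv_apply,
      Pi.abs_apply, integral_mul_const]

theorem inner_convL_comm (heven : ∀ x, k (-x) = k x) (f g : LTwo) :
    inner ℝ (convL hk hc f) g = inner ℝ f (convL hk hc g) := by
  calc inner ℝ (convL hk hc f) g = ∫ x, ∫ y, f y * k (x - y) * g x := by
        rw [inner_eq_integral]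
        refine integral_congr_ae ?_
        filter_upwards [coeFn_convL hk hc f] with x hx
        rw [hx, conv_apply, integral_mul_const]
    _ = ∫ y, ∫ x, f y * k (x - y) * g x :=
        integral_integral_swap (integrable_conv_kernel hk hc f g)
    _ = inner ℝ f (convL hk hc g) := by
        rw [inner_eq_integral]
        refine integral_congr_ae ?_
        filter_upwards [coeFn_convL hk hc g] with y hy
        rw [hy, conv_apply, ← integral_const_mul]
        refine integral_congr_ae (.of_forall fun x => ?_)
        simp only [← heven (y - x), neg_sub, mul_assoc, mul_comm (g x)]

end Convolution

section WeakDerivatives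

theorem LTwo.ext_of_test {f g : LTwo}
    (h : ∀ φ : ℝ → ℝ, ContDiff ℝ ∞ φ → HasCompactSupport φ →
      ∫ x, f x * φ x = ∫ x, g x * φ x) : f = g := by
  refine Lp.ext (ae_eq_of_integral_contDiff_smul_eq f.locallyIntegrable g.locallyIntegrable
    fun φ hφ hc => ?_)
  simpa only [smul_eq_mul, mul_comm] using h φ hφ hc

theorem contDiff_deriv_top {φ : ℝ → ℝ} (hφ : ContDiff ℝ ∞ φ) : ContDiff ℝ ∞ (deriv φ) :=
  (contDiff_infty_iff_deriv.1 hφ).2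

theorem isWeakDeriv_zero (f : LTwo) : IsWeakDeriv 0 f f := by
  intro φ _ _
  simp only [iteratedDeriv_zero, pow_zero, one_mul]

theorem isWeakDeriv_one_iff {f g : LTwo} : IsWeakDeriv 1 f g ↔
    ∀ φ : ℝ → ℝ, ContDiff ℝ ∞ φ → HasCompactSupport φ →
      ∫ x, f x * deriv φ x = -∫ x, g x * φ x := by
  simp only [IsWeakDeriv, iteratedDeriv_one, pow_one, neg_one_mul]

namespace IsWeakDeriv

theorem unique {j : ℕ} {f g g' : LTwo} (h : IsWeakDeriv j f g) (h' : IsWeakDeriv j f g') :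
    g = g' :=
  LTwo.ext_of_test fun φ hφ hc =>
    mul_left_cancel₀ (pow_ne_zero _ (by norm_num)) ((h φ hφ hc).symm.trans (h' φ hφ hc))

theorem of_succ {j : ℕ} {f g h : LTwo} (hg : IsWeakDeriv j f g)
    (hh : IsWeakDeriv (j + 1) f h) : IsWeakDeriv 1 g h := by
  refine isWeakDeriv_one_iff.2 fun φ hφ hc => ?_
  have h_succ := hh φ hφ hc
  rw [iteratedDeriv_succ', hg _ (contDiff_deriv_top hφ) hc.deriv, pow_succ, mul_assoc,
    neg_one_mul] at h_succ
  exact mul_left_cancel₀ (pow_ne_zero _ (by norm_num)) h_succ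

theorem succ {j : ℕ} {f g h : LTwo} (hg : IsWeakDeriv j f g) (hh : IsWeakDeriv 1 g h) :
    IsWeakDeriv (j + 1) f h := by
  intro φ hφ hc
  rw [iteratedDeriv_succ', hg _ (contDiff_deriv_top hφ) hc.deriv,
    isWeakDeriv_one_iff.1 hh φ hφ hc, pow_succ, mul_assoc, neg_one_mul]

theorem mul_smooth {f g : LTwo} (h : IsWeakDeriv 1 f g) {χ χ' : ℝ →ᵇ ℝ}
    (hχ : ContDiff ℝ ∞ χ) (hχ' : ∀ x, HasDerivAt χ (χ' x) x) :
    IsWeakDeriv 1 (mulL χ f) (mulL χ' f + mulL χ g) := by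
  refine isWeakDeriv_one_iff.2 fun φ hφ hc => ?_
  have hχφ := isWeakDeriv_one_iff.1 h (fun x => χ x * φ x) (hχ.mul hφ) hc.mul_left
  have hd : ∀ x, deriv (fun x => χ x * φ x) x = χ' x * φ x + χ x * deriv φ x := fun x =>
    ((hχ' x).mul (hφ.differentiable (by simp)).differentiableAt.hasDerivAt).deriv
  have i1 : Integrable (fun x => f x * (χ' x * φ x)) :=
    integrable_mul_of_test f (χ'.continuous.mul hφ.continuous) hc.mul_left
  have i2 : Integrable (fun x => f x * (χ x * deriv φ x)) :=
    integrable_mul_of_test f (χ.continuous.mul (contDiff_deriv_top hφ).continuous)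
      hc.deriv.mul_left
  have i3 : Integrable (fun x => g x * (χ x * φ x)) :=
    integrable_mul_of_test g (χ.continuous.mul hφ.continuous) hc.mul_left
  simp only [hd, mul_add] at hχφ
  rw [integral_add i1 i2] at hχφ
  have e1 : ∫ x, mulL χ f x * deriv φ x = ∫ x, f x * (χ x * deriv φ x) := by
    refine integral_congr_ae ?_
    filter_upwards [coeFn_mulL χ f] with x hx
    rw [hx, mul_left_comm, mul_assoc]
  have e2 : ∫ x, (mulL χ' f + mulL χ g : LTwo) x * φ x
      = ∫ x, (f x * (χ' x * φ x) + g x * (χ x * φ x)) := by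
    refine integral_congr_ae ?_
    filter_upwards [coeFn_mulL χ' f, coeFn_mulL χ g,
      Lp.coeFn_add (mulL χ' f) (mulL χ g)] with x hx hy hz
    rw [hz, Pi.add_apply, hx, hy]
    ring
  rw [e1, e2, integral_add i1 i3]
  linarith

end IsWeakDeriv

theorem integral_convL_mul {k : ℝ → ℝ} (hk : Continuous k) (hc : HasCompactSupport k)
    (heven : ∀ x, k (-x) = k x) (f : LTwo) {φ : ℝ → ℝ} (hφ : Continuous φ)
    (hφc : HasCompactSupport φ) :
    ∫ x, convL hk hc f x * φ x = ∫ x, f x * conv φ k x := by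
  have hm : MemLp φ 2 volume := hφ.memLp_of_hasCompactSupport hφc
  calc ∫ x, convL hk hc f x * φ x = inner ℝ (convL hk hc f) (hm.toLp φ) := by
        rw [inner_eq_integral]
        exact integral_congr_ae (EventuallyEq.rfl.mul hm.coeFn_toLp.symm)
    _ = inner ℝ f (convL hk hc (hm.toLp φ)) := inner_convL_comm hk hc heven _ _
    _ = ∫ x, f x * conv φ k x := by
        rw [inner_eq_integral, ← conv_congr_ae hm.coeFn_toLp]
        exact integral_congr_ae (EventuallyEq.rfl.mul (coeFn_convL hk hc _))

theorem hasDerivAt_conv (f : LTwo) {k : ℝ → ℝ} (hk : ContDiff ℝ ∞ k) (hc : HasCompactSupport k)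
    (x : ℝ) : HasDerivAt (conv f k) (conv f (deriv k) x) x :=
  hc.hasDerivAt_convolution_right _ f.locallyIntegrable (hk.of_le (by exact_mod_cast le_top)) x

namespace IsWeakDeriv

variable {f g : LTwo} (h : IsWeakDeriv 1 f g) {k : ℝ → ℝ}

include h

theorem convolve (hk : Continuous k) (hc : HasCompactSupport k) (heven : ∀ x, k (-x) = k x) :
    IsWeakDeriv 1 (convL hk hc f) (convL hk hc g) := by
  refine isWeakDeriv_one_iff.2 fun φ hφ hφc => ?_
  have hd : deriv (conv φ k) = conv (deriv φ) k := funext fun x =>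
    (hφc.hasDerivAt_convolution_left _ (hφ.of_le (by exact_mod_cast le_top))
      hk.locallyIntegrable x).deriv
  rw [integral_convL_mul hk hc heven f (contDiff_deriv_top hφ).continuous hφc.deriv,
    integral_convL_mul hk hc heven g hφ.continuous hφc, ← hd]
  exact isWeakDeriv_one_iff.1 h (conv φ k)
    (hφc.contDiff_convolution_left _ hφ hk.locallyIntegrable) (hφc.convolution _ hc)

theorem conv_eq (hk : ContDiff ℝ ∞ k) (hc : HasCompactSupport k) :
    conv g k = conv f (deriv k) := by
  funext x
  have hx := isWeakDeriv_one_iff.1 h (fun y => k (x - y))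
    (hk.comp (contDiff_const.sub contDiff_id)) (hc.comp_homeomorph (Homeomorph.subLeft x))
  simp only [deriv_comp_const_sub, mul_neg, integral_neg, neg_inj] at hx
  exact hx.symm

theorem hasDerivAt_convolve (hk : ContDiff ℝ ∞ k) (hc : HasCompactSupport k) (x : ℝ) :
    HasDerivAt (conv f k) (conv g k x) x := by
  rw [h.conv_eq hk hc]
  exact hasDerivAt_conv f hk hc x

end IsWeakDeriv

end WeakDerivatives

section PointwiseEstimates

theorem isEvenBump_normed (b : ContDiffBump (0 : ℝ)) : IsEvenBump (b.normed volume) :=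
  ⟨b.contDiff_normed, b.hasCompactSupport_normed, b.nonneg_normed, fun x => b.normed_neg x,
    b.integral_normed⟩

theorem exists_evenBump_supported {R : ℝ} (hR : 0 < R) :
    ∃ κ, IsEvenBump κ ∧ ∀ x, R < |x| → κ x = 0 := by
  let b : ContDiffBump (0 : ℝ) := ⟨R / 2, R, half_pos hR, half_lt_self hR⟩
  refine ⟨b.normed volume, isEvenBump_normed b, fun x hx => ?_⟩
  rw [← Function.notMem_support, b.support_normed_eq]
  simpa [b] using hx.le

theorem exists_approximate_identity : ∃ κ : ℕ → ℝ → ℝ, (∀ n, IsEvenBump (κ n)) ∧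
    ∀ f : LTwo, ∀ᵐ x : ℝ, Tendsto (fun n => conv f (κ n) x) atTop (𝓝 (f x)) := by
  let φ : ℕ → ContDiffBump (0 : ℝ) := fun n =>
    ⟨1 / ((n : ℝ) + 1), 2 / ((n : ℝ) + 1), by positivity, by gcongr; norm_num⟩
  refine ⟨fun n => (φ n).normed volume, fun n => isEvenBump_normed (φ n), fun f => ?_⟩
  have h0 : Tendsto (fun n => (φ n).rOut) atTop (𝓝 0) := by
    simpa [φ, div_eq_mul_inv] using
      (tendsto_one_div_add_atTop_nhds_zero_nat (𝕜 := ℝ)).const_mul 2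
  have h1 : ∀ᶠ n in atTop, (φ n).rOut ≤ 2 * (φ n).rIn :=
    .of_forall fun n => by simp [φ, div_eq_mul_inv]
  filter_upwards [ContDiffBump.ae_convolution_tendsto_right_of_locallyIntegrable
    (μ := volume) h0 h1 f.locallyIntegrable] with x hx
  refine hx.congr fun n => ?_
  rw [conv, ← convolution_flip]
  congr 1
  ext
  simp

theorem IsEvenBump.norm_convL_le {κ : ℝ → ℝ} (h : IsEvenBump κ) (f : LTwo) :
    ‖convL h.smooth.continuous h.compact f‖ ≤ ‖f‖ :=
  norm_convL_le_of_density _ _ h.nonneg h.integral_eq_one f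

theorem integral_abs_mul_le (f g : LTwo) : ∫ x, |f x * g x| ≤ ‖f‖ * ‖g‖ := by
  have h := real_inner_le_norm |f| |g|
  rw [norm_abs_eq_norm, norm_abs_eq_norm, inner_eq_integral] at h
  refine le_trans (le_of_eq (integral_congr_ae ?_)) h
  filter_upwards [Lp.coeFn_abs f, Lp.coeFn_abs g] with x hx hy
  rw [hx, hy, abs_mul]

theorem sq_le_two_mul_integral_abs {u u' : ℝ → ℝ} (hd : ∀ y, HasDerivAt u (u' y) y)
    (hu : Integrable (fun y => u y ^ 2)) (huu' : Integrable (fun y => u y * u' y)) (x : ℝ) :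
    u x ^ 2 ≤ 2 * ∫ y, |u y * u' y| := by
  have hsq (y : ℝ) : HasDerivAt (fun y => u y ^ 2) (2 * (u y * u' y)) y :=
    ((hd y).pow 2).congr_deriv (by push_cast; ring)
  have hlim := tendsto_zero_of_hasDerivAt_of_integrableOn_Iic (a := x) (fun y _ => hsq y)
    (huu'.const_mul 2).integrableOn hu.integrableOn
  have hintegral := integral_Iic_of_hasDerivAt_of_tendsto (a := x)
    (hsq x).continuousAt.continuousWithinAt (fun y _ => hsq y)
    (huu'.const_mul 2).integrableOn hlim
  rw [sub_zero, integral_const_mul] at hintegral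
  rw [← hintegral]
  gcongr
  exact (integral_mono huu'.integrableOn huu'.abs.integrableOn fun y => le_abs_self _).trans
    (setIntegral_le_integral huu'.abs (.of_forall fun y => abs_nonneg _))

theorem sq_intervalIntegral_le (g : LTwo) {x y : ℝ} (hxy : x ≤ y) :
    (∫ z in x..y, g z) ^ 2 ≤ (y - x) * ‖g‖ ^ 2 := by
  have hv : volume (Ioc x y) ≠ ⊤ := measure_Ioc_lt_top.ne
  have hnorm : ‖indicatorConstLp 2 measurableSet_Ioc hv (1 : ℝ)‖ = √(y - x) := by
    rw [norm_indicatorConstLp two_ne_zero ENNReal.ofNat_ne_top, Real.volume_real_Ioc_of_le hxy,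
      norm_one, one_mul, ENNReal.toReal_ofNat, Real.sqrt_eq_rpow]
  rw [intervalIntegral.integral_of_le hxy, ← L2.inner_indicatorConstLp_one measurableSet_Ioc hv,
    ← sq_abs, ← Real.sq_sqrt (sub_nonneg.2 hxy), ← mul_pow, ← hnorm]
  gcongr
  exact abs_real_inner_le_norm _ _

namespace IsWeakDeriv

variable {f g : LTwo} (h : IsWeakDeriv 1 f g)

include h

theorem sq_conv_le {κ : ℝ → ℝ} (hκ : IsEvenBump κ) (x : ℝ) :
    conv f κ x ^ 2 ≤ 2 * (‖f‖ * ‖g‖) := by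
  have hk := hκ.smooth.continuous
  have hc := hκ.compact
  have hi : ∀ f g : LTwo, Integrable (fun y => conv f κ y * conv g κ y) := fun f g =>
    MemLp.integrable_mul (p := 2) (q := 2) (memLp_conv hk hc f) (memLp_conv hk hc g)
  calc conv f κ x ^ 2 ≤ 2 * ∫ y, |conv f κ y * conv g κ y| :=
        sq_le_two_mul_integral_abs (h.hasDerivAt_convolve hκ.smooth hc)
          (by simpa only [sq] using hi f f) (hi f g) x
    _ = 2 * ∫ y, |convL hk hc f y * convL hk hc g y| := by
        congr 1
        refine integral_congr_ae ?_
        filter_upwards [coeFn_convL hk hc f, coeFn_convL hk hc g] with y h1 h2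
        rw [h1, h2]
    _ ≤ 2 * (‖convL hk hc f‖ * ‖convL hk hc g‖) := by gcongr; exact integral_abs_mul_le _ _
    _ ≤ 2 * (‖f‖ * ‖g‖) := by gcongr <;> exact hκ.norm_convL_le _

theorem ae_sq_le : ∀ᵐ x : ℝ, f x ^ 2 ≤ 2 * (‖f‖ * ‖g‖) := by
  obtain ⟨κ, hκ, hlim⟩ := exists_approximate_identity
  filter_upwards [hlim f] with x hx
  exact le_of_tendsto (hx.pow 2) (.of_forall fun n => h.sq_conv_le (hκ n) x)

theorem sq_conv_sub_le {κ : ℝ → ℝ} (hκ : IsEvenBump κ) (x y : ℝ) :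
    (conv f κ y - conv f κ x) ^ 2 ≤ |y - x| * ‖g‖ ^ 2 := by
  wlog hxy : x ≤ y generalizing x y
  · have := this y x (le_of_not_ge hxy)
    rwa [abs_sub_comm, ← neg_sub, neg_sq] at this
  have hk := hκ.smooth.continuous
  have hc := hκ.compact
  have hftc : ∫ z in x..y, convL hk hc g z = conv f κ y - conv f κ x := by
    rw [← intervalIntegral.integral_eq_sub_of_hasDerivAt
      (fun z _ => h.hasDerivAt_convolve hκ.smooth hc z)
      ((continuous_conv hk hc g).intervalIntegrable _ _)]
    exact intervalIntegral.integral_congr_ae ((coeFn_convL hk hc g).mono fun z hz _ => hz)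
  rw [← hftc, abs_of_nonneg (sub_nonneg.2 hxy)]
  refine (sq_intervalIntegral_le _ hxy).trans ?_
  have := sub_nonneg.2 hxy
  gcongr
  exact hκ.norm_convL_le g

theorem ae_sq_sub_le : ∀ᵐ x : ℝ, ∀ᵐ y : ℝ, (f y - f x) ^ 2 ≤ |y - x| * ‖g‖ ^ 2 := by
  obtain ⟨κ, hκ, hlim⟩ := exists_approximate_identity
  filter_upwards [hlim f] with x hx
  filter_upwards [hlim f] with y hy
  exact le_of_tendsto ((hy.sub hx).pow 2) (.of_forall fun n => h.sq_conv_sub_le (hκ n) x y)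

theorem ae_abs_conv_sub_le {κ : ℝ → ℝ} (hκ : IsEvenBump κ) {R : ℝ}
    (hR : ∀ x, R < |x| → κ x = 0) : ∀ᵐ x : ℝ, |conv f κ x - f x| ≤ √R * ‖g‖ := by
  filter_upwards [h.ae_sq_sub_le] with x hx
  have hcont : Continuous fun y => κ (x - y) := hκ.smooth.continuous.comp (continuous_sub_left x)
  have hcomp : HasCompactSupport fun y => κ (x - y) :=
    hκ.compact.comp_homeomorph (Homeomorph.subLeft x)
  have hi : Integrable (fun y => κ (x - y)) := hcont.integrable_of_hasCompactSupport hcomp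
  have hmass : ∫ y, κ (x - y) = 1 := by
    rw [integral_sub_left_eq_self κ volume x, hκ.integral_eq_one]
  have hdiff : conv f κ x - f x = ∫ y, (f y - f x) * κ (x - y) := by
    simp only [sub_mul]
    rw [integral_sub (integrable_mul_of_test f hcont hcomp) (hi.const_mul _), integral_const_mul,
      hmass, mul_one, conv_apply]
  calc |conv f κ x - f x| ≤ ∫ y, (√R * ‖g‖) * κ (x - y) := by
        rw [hdiff, ← Real.norm_eq_abs]
        refine norm_integral_le_of_norm_le (hi.const_mul _) ?_
        filter_upwards [hx] with y hy
        rw [norm_mul, Real.norm_of_nonneg (hκ.nonneg _)]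
        rcases lt_or_ge R |x - y| with hxy | hxy
        · rw [hR _ hxy, mul_zero, mul_zero]
        · refine mul_le_mul_of_nonneg_right ?_ (hκ.nonneg _)
          rw [abs_sub_comm] at hxy
          refine abs_le_of_sq_le_sq (hy.trans ?_) (by positivity)
          rw [mul_pow, Real.sq_sqrt ((abs_nonneg _).trans hxy)]
          gcongr
    _ = √R * ‖g‖ := by rw [integral_const_mul, hmass, mul_one]

end IsWeakDeriv

end PointwiseEstimates

section Fourier

theorem exists_cutoff : ∃ χ : ℝ → ℝ, ContDiff ℝ ∞ χ ∧ HasCompactSupport χ ∧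
    (∀ x, |x| ≤ 1 → χ x = 1) ∧ ∀ x, |χ x| ≤ 1 := by
  let b : ContDiffBump (0 : ℝ) := ⟨1, 2, by norm_num, by norm_num⟩
  refine ⟨b, b.contDiff, b.hasCompactSupport, fun x hx => b.one_of_mem_closedBall ?_, fun x => ?_⟩
  · simpa [Metric.mem_closedBall, b] using hx
  · rw [abs_of_nonneg b.nonneg]
    exact b.le_one

theorem exists_cutoff_seq : ∃ (χ : ℕ → ℝ → ℝ) (C : ℝ), (∀ n, ContDiff ℝ ∞ (χ n)) ∧
    (∀ n, HasCompactSupport (χ n)) ∧ (∀ n x, |χ n x| ≤ 1) ∧ (∀ n x, |deriv (χ n) x| ≤ C) ∧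
    ∀ x, ∀ᶠ n in atTop, χ n =ᶠ[𝓝 x] fun _ => 1 := by
  obtain ⟨χ, hχ, hχc, hχ1, hχb⟩ := exists_cutoff
  obtain ⟨C, hC⟩ := (contDiff_deriv_top hχ).continuous.bounded_above_of_compact_support hχc.deriv
  let s : ℕ → ℝ := fun n => 1 / ((n : ℝ) + 1)
  have hs0 : ∀ n, 0 < s n := fun n => by positivity
  have hs1 : ∀ n, s n ≤ 1 := fun n => div_le_one_of_le₀ (by simp) (by positivity)
  have hs : Tendsto s atTop (𝓝 0) := tendsto_one_div_add_atTop_nhds_zero_nat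
  refine ⟨fun n x => χ (s n * x), C, fun n => hχ.comp (contDiff_const.mul contDiff_id),
    fun n => hχc.comp_homeomorph (Homeomorph.mulLeft₀ (s n) (hs0 n).ne'), fun n x => hχb _,
    fun n x => ?_, fun x => ?_⟩
  · rw [deriv_comp_mul_left, smul_eq_mul, abs_mul, abs_of_pos (hs0 n), ← one_mul C]
    exact mul_le_mul (hs1 n) (hC _) (abs_nonneg _) zero_le_one
  · have hlim : Tendsto (fun n => |s n * x|) atTop (𝓝 0) := by
      simpa only [zero_mul, abs_zero] using (hs.mul_const x).abs
    filter_upwards [hlim.eventually_lt_const one_pos] with n hn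
    have hcont : ContinuousAt (fun y => |s n * y|) x := by fun_prop
    filter_upwards [hcont.eventually_lt_const hn] with y hy
    exact hχ1 _ hy.le

theorem tendsto_integral_mul_of_bounded {α : Type*} [MeasurableSpace α] {μ : Measure α}
    {F : α → ℝ} (hF : Integrable F μ) {a : ℕ → α → ℝ} {b : α → ℝ} {C : ℝ}
    (ha : ∀ n, AEStronglyMeasurable (a n) μ) (hC : ∀ n x, |a n x| ≤ C)
    (hlim : ∀ x, Tendsto (fun n => a n x) atTop (𝓝 (b x))) :
    Tendsto (fun n => ∫ x, a n x * F x ∂μ) atTop (𝓝 (∫ x, b x * F x ∂μ)) := by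
  refine tendsto_integral_of_dominated_convergence (fun x => C * |F x|)
    (fun n => (ha n).mul hF.aestronglyMeasurable) (hF.abs.const_mul C)
    (fun n => .of_forall fun x => ?_) (.of_forall fun x => (hlim x).mul_const _)
  rw [norm_mul, Real.norm_eq_abs, Real.norm_eq_abs]
  gcongr
  exact hC n x

-- Cut the test function off and let the cut-off tend to `1`.
theorem IsWeakDeriv.integral_mul_deriv {f g : LTwo} (h : IsWeakDeriv 1 f g) {φ : ℝ → ℝ}
    (hφ : ContDiff ℝ ∞ φ) (h0 : MemLp φ 2 volume) (h1 : MemLp (deriv φ) 2 volume) :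
    ∫ x, f x * deriv φ x = -∫ x, g x * φ x := by
  obtain ⟨χ, C, hχ, hχc, hχb, hχC, hχ1⟩ := exists_cutoff_seq
  have hfφ : Integrable fun x => f x * φ x := (Lp.memLp f).integrable_mul h0
  have hfφ' : Integrable fun x => f x * deriv φ x := (Lp.memLp f).integrable_mul h1
  have hgφ : Integrable fun x => g x * φ x := (Lp.memLp g).integrable_mul h0
  have hm (n : ℕ) : AEStronglyMeasurable (χ n) volume := (hχ n).continuous.aestronglyMeasurable
  have hm' (n : ℕ) : AEStronglyMeasurable (deriv (χ n)) volume :=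
    (contDiff_deriv_top (hχ n)).continuous.aestronglyMeasurable
  have hlim (x : ℝ) : Tendsto (fun n => χ n x) atTop (𝓝 1) :=
    tendsto_const_nhds.congr' ((hχ1 x).mono fun n hn => hn.self_of_nhds.symm)
  have hlim' (x : ℝ) : Tendsto (fun n => deriv (χ n) x) atTop (𝓝 0) :=
    tendsto_const_nhds.congr' ((hχ1 x).mono fun n hn =>
      (hn.deriv_eq.trans (deriv_const x 1)).symm)
  have hcut (n : ℕ) : (∫ x, deriv (χ n) x * (f x * φ x)) + ∫ x, χ n x * (f x * deriv φ x)
      = -∫ x, χ n x * (g x * φ x) := by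
    have hd : deriv (fun x => χ n x * φ x) = fun x => deriv (χ n) x * φ x + χ n x * deriv φ x :=
      funext fun x => deriv_fun_mul ((hχ n).differentiable (by simp)).differentiableAt
        (hφ.differentiable (by simp)).differentiableAt
    have hn := isWeakDeriv_one_iff.1 h _ ((hχ n).mul hφ) (hχc n).mul_right
    rw [hd] at hn
    simp only [mul_left_comm _ (g _), ← hn]
    rw [← integral_add (hfφ.bdd_mul (hm' n) (.of_forall (hχC n)))
      (hfφ'.bdd_mul (hm n) (.of_forall (hχb n)))]
    simp only [mul_add, mul_left_comm]
  have hleft := (tendsto_integral_mul_of_bounded hfφ hm' hχC hlim').add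
    (tendsto_integral_mul_of_bounded hfφ' hm hχb hlim)
  have hright := (tendsto_integral_mul_of_bounded hgφ hm hχb hlim).neg
  simp only [zero_mul, one_mul, integral_zero, zero_add] at hleft hright
  exact tendsto_nhds_unique hleft (hright.congr fun n => (hcut n).symm)

theorem coeFn_toComplexLTwo (f : LTwo) :
    toComplexLTwo f =ᵐ[volume] fun x => (f x : ℂ) :=
  ContinuousLinearMap.coeFn_compLp _ f

theorem norm_toComplexLTwo (f : LTwo) : ‖toComplexLTwo f‖ = ‖f‖ := by
  rw [Lp.norm_def, Lp.norm_def]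
  refine congrArg _ (eLpNorm_congr_norm_ae ?_)
  filter_upwards [coeFn_toComplexLTwo f] with x hx
  rw [hx, Complex.norm_real]

theorem inner_toComplexLTwo (f g : LTwo) :
    inner ℂ (toComplexLTwo f) (toComplexLTwo g) = (inner ℝ f g : ℝ) := by
  rw [L2.inner_def, inner_eq_integral, ← integral_complex_ofReal]
  refine integral_congr_ae ?_
  filter_upwards [coeFn_toComplexLTwo f, coeFn_toComplexLTwo g] with x hx hy
  rw [hx, hy, RCLike.inner_apply, Complex.conj_ofReal, Complex.ofReal_mul, mul_comm]

theorem integral_mul_toComplexLTwo (f : LTwo) {q : ℝ → ℂ} (hq : MemLp q 2 volume) :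
    ∫ x, q x * toComplexLTwo f x
      = ((∫ x, f x * (q x).re : ℝ) : ℂ) + ((∫ x, f x * (q x).im : ℝ) : ℂ) * Complex.I := by
  have hi : Integrable fun x => q x * toComplexLTwo f x :=
    hq.integrable_mul (Lp.memLp (toComplexLTwo f))
  have hre : ∫ x, RCLike.re (q x * toComplexLTwo f x) = ∫ x, f x * (q x).re := by
    refine integral_congr_ae ?_
    filter_upwards [coeFn_toComplexLTwo f] with x hx
    rw [hx, mul_comm]
    exact Complex.re_ofReal_mul _ _
  have him : ∫ x, RCLike.im (q x * toComplexLTwo f x) = ∫ x, f x * (q x).im := by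
    refine integral_congr_ae ?_
    filter_upwards [coeFn_toComplexLTwo f] with x hx
    rw [hx, mul_comm]
    exact Complex.im_ofReal_mul _ _
  rw [← integral_re_add_im hi, hre, him]
  rfl

open SchwartzMap in
theorem IsWeakDeriv.integral_schwartz {f g : LTwo} (h : IsWeakDeriv 1 f g) (ψ : 𝓢(ℝ, ℂ)) :
    ∫ x, deriv ψ x * toComplexLTwo f x = -∫ x, ψ x * toComplexLTwo g x := by
  have hψ : ContDiff ℝ ∞ ψ := ψ.smooth'
  have hdiff (x : ℝ) : HasDerivAt ψ (deriv ψ x) x :=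
    (hψ.differentiable (by simp)).differentiableAt.hasDerivAt
  have h0 : MemLp ψ 2 volume := ψ.memLp 2 volume
  have h1 : MemLp (deriv ψ) 2 volume := (SchwartzMap.derivCLM ℂ ℂ ψ).memLp 2 volume
  have hre : deriv (fun x => (ψ x).re) = fun x => (deriv ψ x).re :=
    funext fun x => (Complex.reCLM.hasFDerivAt.comp_hasDerivAt x (hdiff x)).deriv
  have him : deriv (fun x => (ψ x).im) = fun x => (deriv ψ x).im :=
    funext fun x => (Complex.imCLM.hasFDerivAt.comp_hasDerivAt x (hdiff x)).deriv
  have hre_int := h.integral_mul_deriv (φ := fun x => (ψ x).re) (Complex.reCLM.contDiff.comp hψ)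
    h0.re (hre ▸ h1.re)
  have him_int := h.integral_mul_deriv (φ := fun x => (ψ x).im) (Complex.imCLM.contDiff.comp hψ)
    h0.im (him ▸ h1.im)
  rw [hre] at hre_int
  rw [him] at him_int
  rw [integral_mul_toComplexLTwo f h1, integral_mul_toComplexLTwo g h0, hre_int, him_int]
  push_cast
  ring

open FourierTransform SchwartzMap LineDeriv in
theorem IsWeakDeriv.lineDeriv_toTemperedDistribution {f g : LTwo} (h : IsWeakDeriv 1 f g) :
    ∂_{(1 : ℝ)} (Lp.toTemperedDistribution (toComplexLTwo f) : 𝓢'(ℝ, ℂ))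
      = Lp.toTemperedDistribution (toComplexLTwo g) := by
  ext ψ
  rw [TemperedDistribution.lineDerivOp_apply_apply]
  simp only [Lp.toTemperedDistribution_apply, smul_eq_mul, map_neg]
  exact neg_eq_iff_eq_neg.2 (h.integral_schwartz ψ)

open FourierTransform SchwartzMap in
theorem IsWeakDeriv.fourier_eq {f g : LTwo} (h : IsWeakDeriv 1 f g) :
    (𝓕 (toComplexLTwo g) : Lp ℂ 2 (volume : Measure ℝ)) =ᵐ[volume] fun ξ =>
      (2 * Real.pi * Complex.I * ξ) * (𝓕 (toComplexLTwo f) : Lp ℂ 2 (volume : Measure ℝ)) ξ := by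
  set F : Lp ℂ 2 (volume : Measure ℝ) := 𝓕 (toComplexLTwo f) with hF
  set G : Lp ℂ 2 (volume : Measure ℝ) := 𝓕 (toComplexLTwo g) with hG
  have hdist : (Lp.toTemperedDistribution G : 𝓢'(ℝ, ℂ)) = (2 * Real.pi * Complex.I) •
      TemperedDistribution.smulLeftCLM ℂ (inner ℝ · (1 : ℝ)) (Lp.toTemperedDistribution F) := by
    rw [hG, hF, ← Lp.fourier_toTemperedDistribution_eq, ← Lp.fourier_toTemperedDistribution_eq,
      ← h.lineDeriv_toTemperedDistribution, TemperedDistribution.fourier_lineDerivOp_eq]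
  have hFl : LocallyIntegrable F volume := (Lp.memLp F).locallyIntegrable one_le_two
  have hGl : LocallyIntegrable G volume := (Lp.memLp G).locallyIntegrable one_le_two
  have hc : Continuous fun ξ : ℝ => (2 * Real.pi * Complex.I * (ξ : ℂ)) := by fun_prop
  have hFl' : LocallyIntegrable (fun ξ : ℝ => (2 * Real.pi * Complex.I * (ξ : ℂ)) * F ξ)
      volume := by
    rw [locallyIntegrable_iff] at hFl ⊢
    intro k hk
    exact (hFl k hk).continuousOn_mul hc.continuousOn hk
  refine ae_eq_of_integral_contDiff_smul_eq hGl hFl' fun φ hφ hφc => ?_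
  have hφc' : HasCompactSupport (Complex.ofRealCLM ∘ φ) := hφc.comp_left rfl
  have hφ' : ContDiff ℝ ∞ (Complex.ofRealCLM ∘ φ) := by fun_prop
  have htest := congrArg (fun D => D (hφc'.toSchwartzMap hφ')) hdist
  have htemp : (fun x : ℝ => (x : ℂ)).HasTemperateGrowth := by
    have : (fun x : ℝ => ((inner ℝ x (1 : ℝ) : ℝ) : ℂ)).HasTemperateGrowth := by fun_prop
    simpa using this
  simp only [Lp.toTemperedDistribution_apply, HasCompactSupport.toSchwartzMap_toFun,
    Function.comp_apply, Complex.ofRealCLM_apply, smul_eq_mul, RCLike.inner_apply,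
    Real.ringHom_apply, one_mul, smul_apply,
    TemperedDistribution.smulLeftCLM_apply_apply] at htest
  simp only [SchwartzMap.smulLeftCLM_apply_apply htemp] at htest
  simp only [Complex.real_smul]
  rw [htest, ← integral_const_mul]
  refine integral_congr_ae (.of_forall fun x => ?_)
  simp
  ring

theorem inner_eq_inner_fourier (f g : LTwo) : ((inner ℝ f g : ℝ) : ℂ) =
    ∫ ξ, inner ℂ
      ((FourierTransform.fourier (toComplexLTwo f) : Lp ℂ 2 (volume : Measure ℝ)) ξ)
      ((FourierTransform.fourier (toComplexLTwo g) : Lp ℂ 2 (volume : Measure ℝ)) ξ) := by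
  rw [← inner_toComplexLTwo, ← Lp.inner_fourier_eq, L2.inner_def]

theorem IsWeakDeriv.inner_eq_neg {f f' g g' : LTwo} (hf : IsWeakDeriv 1 f f')
    (hg : IsWeakDeriv 1 g g') : inner ℝ f g' = -inner ℝ f' g := by
  have h : ((inner ℝ f g' : ℝ) : ℂ) = -((inner ℝ f' g : ℝ) : ℂ) := by
    rw [inner_eq_inner_fourier, inner_eq_inner_fourier, ← integral_neg]
    refine integral_congr_ae ?_
    filter_upwards [hf.fourier_eq, hg.fourier_eq] with ξ h1 h2
    rw [h1, h2]
    simp only [RCLike.inner_apply, map_mul, map_ofNat, Complex.conj_ofReal, Complex.conj_I]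
    ring
  exact_mod_cast h

theorem IsWeakDeriv.inner_self {f f' : LTwo} (hf : IsWeakDeriv 1 f f') :
    inner ℝ f f' = (0 : ℝ) := by
  have h := hf.inner_eq_neg hf
  rw [real_inner_comm f f'] at h
  linarith

theorem IsWeakDeriv.norm_sq_le {f g h : LTwo} (hf : IsWeakDeriv 1 f g)
    (hg : IsWeakDeriv 1 g h) : ‖g‖ ^ 2 ≤ ‖f‖ * ‖h‖ := by
  rw [← real_inner_self_eq_norm_sq, ← neg_neg (inner ℝ g g), ← hf.inner_eq_neg hg]
  exact (neg_le_abs _).trans (abs_real_inner_le_norm f h)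

theorem exists_rpow_le {r δ : ℝ} (h0 : 0 ≤ r) (h1 : r < 1) (hδ : 0 < δ) :
    ∃ C, 0 ≤ C ∧ ∀ y : ℝ, 1 ≤ y → y ^ r ≤ δ * y + C := by
  obtain ⟨R, hR⟩ := eventually_atTop.1
    ((tendsto_rpow_neg_atTop (sub_pos.2 h1)).eventually_le_const hδ)
  have hC : 0 ≤ max R 1 ^ r := by positivity
  refine ⟨max R 1 ^ r, hC, fun y hy => ?_⟩
  have hδy : 0 ≤ δ * y := by positivity
  rcases le_total R y with hRy | hRy
  · calc y ^ r = y ^ (-(1 - r)) * y := by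
          rw [← Real.rpow_add_one (by positivity), neg_sub, sub_add_cancel]
      _ ≤ δ * y := by
          gcongr
          exact hR y hRy
      _ ≤ δ * y + max R 1 ^ r := le_add_of_nonneg_right hC
  · exact (Real.rpow_le_rpow (by positivity) (hRy.trans (le_max_left _ _)) h0).trans
      (le_add_of_nonneg_left hδy)

theorem eLpNorm_norm_fourier (f : LTwo) : eLpNorm (fun ξ : ℝ =>
    ‖(FourierTransform.fourier (toComplexLTwo f) : Lp ℂ 2 (volume : Measure ℝ)) ξ‖) 2 volume
      = ENNReal.ofReal ‖f‖ := by
  rw [eLpNorm_norm, ← norm_toComplexLTwo, ← Lp.norm_fourier_eq, Lp.norm_def,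
    ENNReal.ofReal_toReal (Lp.eLpNorm_ne_top _)]

open FourierTransform in
theorem IsWeakDeriv.ae_sq_mul_norm_fourier_le {f g h : LTwo} (hf : IsWeakDeriv 1 f g)
    (hg : IsWeakDeriv 1 g h) : ∀ᵐ ξ : ℝ,
      ξ ^ 2 * ‖(𝓕 (toComplexLTwo f) : Lp ℂ 2 (volume : Measure ℝ)) ξ‖
        ≤ ‖(𝓕 (toComplexLTwo h) : Lp ℂ 2 (volume : Measure ℝ)) ξ‖ := by
  filter_upwards [hf.fourier_eq, hg.fourier_eq] with ξ hgξ hhξ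
  have hpi : 1 ≤ (2 * Real.pi) ^ 2 := one_le_pow₀ (by linarith [Real.pi_gt_three])
  set F := ‖(𝓕 (toComplexLTwo f) : Lp ℂ 2 (volume : Measure ℝ)) ξ‖
  calc ξ ^ 2 * F ≤ (2 * Real.pi) ^ 2 * (ξ ^ 2 * F) := le_mul_of_one_le_left (by positivity) hpi
    _ = ‖(𝓕 (toComplexLTwo h) : Lp ℂ 2 (volume : Measure ℝ)) ξ‖ := by
        rw [hhξ, hgξ]
        simp only [norm_mul, Complex.norm_I, Complex.norm_real, Complex.norm_ofNat, mul_one,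
          Real.norm_eq_abs, abs_of_pos Real.pi_pos]
        rw [← sq_abs ξ]
        ring

theorem exists_hsENorm_le {s δ : ℝ} (h0 : 0 ≤ s) (h2 : s < 2) (hδ : 0 < δ) :
    ∃ C, 0 ≤ C ∧ ∀ f g h : LTwo, IsWeakDeriv 1 f g → IsWeakDeriv 1 g h →
      hsENorm s f ≤ ENNReal.ofReal (δ * ‖h‖ + C * ‖f‖) := by
  obtain ⟨C, hC0, hC⟩ := exists_rpow_le (r := s / 2) (δ := δ) (by linarith) (by linarith) hδ
  have hδC : 0 ≤ δ + C := by positivity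
  refine ⟨δ + C, hδC, fun f g h hf hg => ?_⟩
  set F : Lp ℂ 2 (volume : Measure ℝ) := FourierTransform.fourier (toComplexLTwo f)
  set H : Lp ℂ 2 (volume : Measure ℝ) := FourierTransform.fourier (toComplexLTwo h)
  have hsymbol : ∀ᵐ ξ : ℝ,
      ‖(1 + ξ ^ 2) ^ (s / 2) • F ξ‖ ≤ ‖δ * ‖H ξ‖ + (δ + C) * ‖F ξ‖‖ := by
    filter_upwards [hf.ae_sq_mul_norm_fourier_le hg] with ξ hξ
    rw [Real.norm_of_nonneg (by positivity), norm_smul, Real.norm_of_nonneg (by positivity)]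
    calc (1 + ξ ^ 2) ^ (s / 2) * ‖F ξ‖ ≤ (δ * (1 + ξ ^ 2) + C) * ‖F ξ‖ := by
          gcongr
          exact hC _ (le_add_of_nonneg_right (sq_nonneg ξ))
      _ = δ * (ξ ^ 2 * ‖F ξ‖) + (δ + C) * ‖F ξ‖ := by ring
      _ ≤ δ * ‖H ξ‖ + (δ + C) * ‖F ξ‖ := by gcongr
  calc hsENorm s f ≤ eLpNorm ((δ • fun ξ => ‖H ξ‖) + (δ + C) • fun ξ => ‖F ξ‖) 2 volume :=
        eLpNorm_mono_ae hsymbol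
    _ ≤ eLpNorm (δ • fun ξ => ‖H ξ‖) 2 volume + eLpNorm ((δ + C) • fun ξ => ‖F ξ‖) 2 volume :=
        eLpNorm_add_le ((Lp.aestronglyMeasurable H).norm.const_smul _)
          ((Lp.aestronglyMeasurable F).norm.const_smul _) one_le_two
    _ = ENNReal.ofReal (δ * ‖h‖ + (δ + C) * ‖f‖) := by
        rw [eLpNorm_const_smul, eLpNorm_const_smul, eLpNorm_norm_fourier, eLpNorm_norm_fourier,
          ENNReal.ofReal_add (by positivity) (by positivity), ENNReal.ofReal_mul hδ.le,
          ENNReal.ofReal_mul hδC, Real.enorm_of_nonneg hδ.le, Real.enorm_of_nonneg hδC]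

end Fourier

/-- The translate `x ↦ k (x - s)` of a continuous kernel with compact support, as a bounded
continuous function, so that it can act on `L²` by multiplication. -/
noncomputable def shiftB {k : ℝ → ℝ} (hk : Continuous k) (hc : HasCompactSupport k) (s : ℝ) :
    ℝ →ᵇ ℝ :=
  BoundedContinuousFunction.ofNormedAddCommGroup (fun x => k (x - s)) (by fun_prop)
    (hc.exists_bound_of_continuous hk).choose
    (fun x => (hc.exists_bound_of_continuous hk).choose_spec (x - s))

theorem shiftB_apply {k : ℝ → ℝ} (hk : Continuous k) (hc : HasCompactSupport k) (s x : ℝ) :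
    shiftB hk hc s x = k (x - s) := rfl

theorem abs_taylor_le {k : ℝ → ℝ} (hk : ContDiff ℝ 2 k) {C : ℝ}
    (hC : ∀ x, ‖deriv (deriv k) x‖ ≤ C) (y h : ℝ) :
    |k (y - h) - k y + h * deriv k y| ≤ C * h ^ 2 := by
  have hk' : Differentiable ℝ (deriv k) :=
    ((contDiff_succ_iff_deriv (n := 1)).1 hk).2.2.differentiable one_ne_zero
  have hlip (z w : ℝ) : |deriv k z - deriv k w| ≤ C * |z - w| :=
    Convex.norm_image_sub_le_of_norm_deriv_le (s := univ) (fun x _ => hk' x) (fun x _ => hC x)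
      convex_univ (mem_univ w) (mem_univ z)
  have hC0 : 0 ≤ C := (norm_nonneg _).trans (hC 0)
  have hderiv : ∀ τ ∈ uIcc 0 h, HasDerivWithinAt (fun τ => k (y - τ) + τ * deriv k y)
      (deriv k y - deriv k (y - τ)) (uIcc 0 h) τ := fun τ _ => by
    have hk1 : HasDerivAt k (deriv k (y - τ)) (y - τ) :=
      (hk.differentiable two_ne_zero).differentiableAt.hasDerivAt
    refine (((hk1.comp τ ((hasDerivAt_id τ).const_sub y)).add
      ((hasDerivAt_id τ).mul_const (deriv k y))).congr_deriv ?_).hasDerivWithinAt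
    ring
  have hbound : ∀ τ ∈ uIcc 0 h, ‖deriv k y - deriv k (y - τ)‖ ≤ C * |h| := fun τ hτ =>
    (hlip _ _).trans (mul_le_mul_of_nonneg_left
      (by simpa using abs_sub_left_of_mem_uIcc hτ) hC0)
  have hmean := (convex_uIcc 0 h).norm_image_sub_le_of_norm_hasDerivWithin_le hderiv hbound
    left_mem_uIcc right_mem_uIcc
  simp only [sub_zero, zero_mul, add_zero, Real.norm_eq_abs] at hmean
  calc |k (y - h) - k y + h * deriv k y| = |k (y - h) + h * deriv k y - k y| := by ring_nf
    _ ≤ C * |h| * |h| := hmean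
    _ = C * h ^ 2 := by rw [mul_assoc, abs_mul_abs_self, sq]

theorem hasDerivAt_shiftB {k : ℝ → ℝ} (hk : ContDiff ℝ ∞ k) (hc : HasCompactSupport k) (s : ℝ) :
    HasDerivAt (shiftB hk.continuous hc)
      (-shiftB (contDiff_deriv_top hk).continuous hc.deriv s) s := by
  obtain ⟨C, hC⟩ := hc.deriv.deriv.exists_bound_of_continuous
    (contDiff_deriv_top (contDiff_deriv_top hk)).continuous
  have hC0 : 0 ≤ C := (norm_nonneg _).trans (hC 0)
  rw [hasDerivAt_iff_isLittleO_nhds_zero]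
  have hquad : (fun h : ℝ => shiftB hk.continuous hc (s + h) - shiftB hk.continuous hc s -
      h • -shiftB (contDiff_deriv_top hk).continuous hc.deriv s) =O[𝓝 0] fun h => h ^ 2 := by
    refine Asymptotics.IsBigO.of_bound C (.of_forall fun h => ?_)
    rw [Real.norm_of_nonneg (sq_nonneg h)]
    refine (BoundedContinuousFunction.norm_le (by positivity)).2 fun x => ?_
    have htaylor := abs_taylor_le (hk.of_le (by norm_cast)) hC (x - s) h
    simp only [BoundedContinuousFunction.sub_apply, BoundedContinuousFunction.smul_apply,
      BoundedContinuousFunction.neg_apply, shiftB_apply, smul_eq_mul, mul_neg, sub_neg_eq_add,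
      Real.norm_eq_abs]
    rwa [← sub_sub]
  exact hquad.trans_isLittleO (Asymptotics.isLittleO_pow_id one_lt_two)

theorem isEvenBump_mollifier {θ : ℝ → ℝ} (h : IsEvenBump θ) {ε : ℝ} (hε : 0 < ε) :
    IsEvenBump (mollifier θ ε) where
  smooth := contDiff_const.mul (h.smooth.comp (contDiff_id.div_const ε))
  compact := HasCompactSupport.mul_left
    (h.compact.comp_homeomorph (Homeomorph.mulRight₀ ε⁻¹ (inv_pos.2 hε).ne'))
  nonneg x := mul_nonneg (by positivity) (h.nonneg _)
  even x := by simp [mollifier, neg_div, h.even]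
  integral_eq_one := by
    simp only [mollifier]
    rw [integral_const_mul, Measure.integral_comp_div, h.integral_eq_one, abs_of_pos hε,
      smul_eq_mul, mul_one, one_div, inv_mul_cancel₀ hε.ne']

/-- The weak derivative of order `j` as a continuous linear map on `H^m`. -/
noncomputable def dxL {m : ℕ} (j : Fin (m + 1)) : SobolevH m →L[ℝ] LTwo :=
  (PiLp.proj 2 (fun _ : Fin (m + 1) => LTwo) j).comp (SobolevH m).subtypeL

theorem isWeakDeriv_dx {m : ℕ} (j : Fin (m + 1)) (u : SobolevH m) :
    IsWeakDeriv j (dx 0 u) (dx j u) := u.2 j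

theorem isWeakDeriv_dx_succ {m : ℕ} (i : Fin m) (u : SobolevH m) :
    IsWeakDeriv 1 (dx i.castSucc u) (dx i.succ u) :=
  IsWeakDeriv.of_succ (j := i) (isWeakDeriv_dx i.castSucc u)
    (by simpa using isWeakDeriv_dx i.succ u)

theorem norm_dx_le {m : ℕ} (j : Fin (m + 1)) (u : SobolevH m) : ‖dx j u‖ ≤ ‖u‖ :=
  PiLp.norm_apply_le (u : PiLp 2 (fun _ : Fin (m + 1) => LTwo)) j

namespace MemEZero

variable {T : ℝ} {U : ℝ → SobolevH 4}

theorem hasDerivWithinAt_dx_zero (h : MemEZero T U) {t : ℝ} (ht : t ∈ Icc 0 T) :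
    HasDerivWithinAt (fun t => dx 0 (U t)) (dt T 1 U t) (Icc 0 T) t := by
  rw [dt, iteratedDerivWithin_one]
  exact (h.2.2.differentiableOn two_ne_zero t ht).hasDerivWithinAt

theorem contDiffOn_dt_one (hT : 0 < T) (h : MemEZero T U) :
    ContDiffOn ℝ 1 (dt T 1 U) (Icc 0 T) := by
  have hdt : dt T 1 U = derivWithin (fun s => dx 0 (U s)) (Icc 0 T) :=
    funext fun _ => by rw [dt, iteratedDerivWithin_one]
  rw [hdt]
  exact ((contDiffOn_succ_iff_derivWithin (n := 1) (uniqueDiffOn_Icc hT)).1 h.2.2).2.2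

theorem hasDerivWithinAt_dt_one (hT : 0 < T) (h : MemEZero T U) {t : ℝ} (ht : t ∈ Icc 0 T) :
    HasDerivWithinAt (dt T 1 U) (dt T 2 U t) (Icc 0 T) t := by
  have hdt : dt T 2 U t = derivWithin (dt T 1 U) (Icc 0 T) t := by
    rw [dt, iteratedDerivWithin_succ]
    rfl
  rw [hdt]
  exact ((h.contDiffOn_dt_one hT).differentiableOn one_ne_zero t ht).hasDerivWithinAt

theorem exists_hasDerivWithinAt_dx (hT : 0 < T) (h : MemEZero T U) :
    ∃ V : ℝ → SobolevH 2, ∀ t ∈ Icc 0 T, dx 0 (V t) = dt T 1 U t ∧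
      HasDerivWithinAt (fun t => dx 1 (U t)) (dx 1 (V t)) (Icc 0 T) t ∧
      HasDerivWithinAt (fun t => dx 2 (U t)) (dx 2 (V t)) (Icc 0 T) t := by
  obtain ⟨V, hV, hVU⟩ := h.2.1
  have hVj (j : Fin 3) {t : ℝ} (ht : t ∈ Icc 0 T) : HasDerivWithinAt (fun t => dx j (V t))
      (dx j (derivWithin V (Icc 0 T) t)) (Icc 0 T) t :=
    (dxL j).hasFDerivAt.comp_hasDerivWithinAt t
      (hV.differentiableOn one_ne_zero t ht).hasDerivWithinAt
  have hone : ∀ s ∈ Icc 0 T, dx 1 (U s) = dx 1 (V s) := fun s hs =>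
    (isWeakDeriv_dx 1 (U s)).unique (hVU s hs ▸ isWeakDeriv_dx 1 (V s))
  have htwo : ∀ s ∈ Icc 0 T, dx 2 (U s) = dx 2 (V s) := fun s hs =>
    (isWeakDeriv_dx 2 (U s)).unique (hVU s hs ▸ isWeakDeriv_dx 2 (V s))
  exact ⟨derivWithin V (Icc 0 T), fun t ht =>
    ⟨(uniqueDiffOn_Icc hT t ht).eq_deriv _
      ((hVj 0 ht).congr (fun s hs => (hVU s hs).symm) (hVU t ht).symm)
      (h.hasDerivWithinAt_dx_zero ht),
    (hVj 1 ht).congr hone (hone t ht), (hVj 2 ht).congr htwo (htwo t ht)⟩⟩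

end MemEZero

namespace IsEvenBump

variable {κ : ℝ → ℝ}

/-- Multiplication by `κ (x - s)`: the operator through which the point mass at `s` acts. -/
noncomputable def mass (h : IsEvenBump κ) (s : ℝ) : LTwo →L[ℝ] LTwo :=
  mulL (shiftB h.smooth.continuous h.compact s)

/-- Multiplication by `κ' (x - s)`, which is minus the derivative of `mass` in `s`. -/
noncomputable def massDeriv (h : IsEvenBump κ) (s : ℝ) : LTwo →L[ℝ] LTwo :=
  mulL (shiftB (contDiff_deriv_top h.smooth).continuous h.compact.deriv s)

/-- Convolution with `κ`, as a map from `L²` into the bounded continuous functions. -/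
noncomputable def mollB (h : IsEvenBump κ) : LTwo →L[ℝ] (ℝ →ᵇ ℝ) :=
  convB h.smooth.continuous h.compact

/-- Convolution with `κ`, as an operator on `L²`. -/
noncomputable def mollL (h : IsEvenBump κ) : LTwo →L[ℝ] LTwo :=
  convL h.smooth.continuous h.compact

/-- The function `y ↦ κ (s - y) = κ (y - s)` in `L²`: the load carried by the point mass. -/
noncomputable def bumpAt (h : IsEvenBump κ) (s : ℝ) : LTwo :=
  (memLp_kernel h.smooth.continuous h.compact s).toLp

theorem mollB_apply (h : IsEvenBump κ) (f : LTwo) (x : ℝ) : h.mollB f x = conv f κ x := rfl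

theorem coeFn_mollL (h : IsEvenBump κ) (f : LTwo) : h.mollL f =ᵐ[volume] conv f κ :=
  coeFn_convL _ _ f

theorem norm_mollL_le (h : IsEvenBump κ) (f : LTwo) : ‖h.mollL f‖ ≤ ‖f‖ := h.norm_convL_le f

theorem mollL_symm (h : IsEvenBump κ) (f g : LTwo) :
    inner ℝ (h.mollL f) g = inner ℝ f (h.mollL g) :=
  inner_convL_comm _ _ h.even f g

theorem coeFn_bumpAt (h : IsEvenBump κ) (s : ℝ) :
    h.bumpAt s =ᵐ[volume] fun x => κ (x - s) := by
  filter_upwards [(memLp_kernel h.smooth.continuous h.compact s).coeFn_toLp] with x hx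
  rw [bumpAt, hx, ← h.even, neg_sub]

theorem hasDerivAt_mass (h : IsEvenBump κ) (s : ℝ) : HasDerivAt h.mass (-h.massDeriv s) s :=
  ((mulL : (ℝ →ᵇ ℝ) →L[ℝ] LTwo →L[ℝ] LTwo).hasFDerivAt.comp_hasDerivAt s
    (hasDerivAt_shiftB h.smooth h.compact s)).congr_deriv (map_neg _ _)

theorem coeFn_mass (h : IsEvenBump κ) (s : ℝ) (f : LTwo) :
    h.mass s f =ᵐ[volume] fun x => κ (x - s) * f x :=
  coeFn_mulL _ f

theorem coeFn_massDeriv (h : IsEvenBump κ) (s : ℝ) (f : LTwo) :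
    h.massDeriv s f =ᵐ[volume] fun x => deriv κ (x - s) * f x :=
  coeFn_mulL _ f

theorem inner_mass_self (h : IsEvenBump κ) (s : ℝ) (f : LTwo) :
    inner ℝ (h.mass s f) f = ∫ x, κ (x - s) * f x ^ 2 := by
  rw [mass, inner_mulL_left]
  simp only [shiftB_apply, mul_assoc, sq]

theorem mass_symm (h : IsEvenBump κ) (s : ℝ) (f g : LTwo) :
    inner ℝ (h.mass s f) g = inner ℝ (h.mass s g) f :=
  inner_mulL_comm _ f g

theorem mass_nonneg (h : IsEvenBump κ) (s : ℝ) (f : LTwo) : 0 ≤ inner ℝ (h.mass s f) f := by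
  rw [inner_mass_self]
  exact integral_nonneg fun x => mul_nonneg (h.nonneg _) (sq_nonneg _)

theorem integrable_shift (h : IsEvenBump κ) (s : ℝ) : Integrable fun x => κ (x - s) :=
  (h.smooth.continuous.integrable_of_hasCompactSupport h.compact).comp_sub_right s

theorem integral_shift (h : IsEvenBump κ) (s : ℝ) : ∫ x, κ (x - s) = 1 := by
  rw [integral_sub_right_eq_self κ s, h.integral_eq_one]

theorem mass_self_le (h : IsEvenBump κ) {s C : ℝ} {f : LTwo} (hf : ∀ᵐ x : ℝ, f x ^ 2 ≤ C) :
    inner ℝ (h.mass s f) f ≤ C := by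
  rw [inner_mass_self]
  calc ∫ x, κ (x - s) * f x ^ 2 ≤ ∫ x, κ (x - s) * C :=
        integral_mono_of_nonneg (.of_forall fun x => mul_nonneg (h.nonneg _) (sq_nonneg _))
          ((h.integrable_shift s).mul_const C)
          (hf.mono fun x hx => mul_le_mul_of_nonneg_left hx (h.nonneg _))
    _ = C := by rw [integral_mul_const, h.integral_shift, one_mul]

-- The quadratic form of `mass` is nonnegative at `f ± (2 * c)⁻¹ g`.
theorem abs_mass_le (h : IsEvenBump κ) (s : ℝ) (f g : LTwo) {c : ℝ} (hc : 0 < c) :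
    |inner ℝ (h.mass s f) g| ≤ c * inner ℝ (h.mass s f) f + inner ℝ (h.mass s g) g / (4 * c) := by
  have hform (r : ℝ) : 0 ≤ inner ℝ (h.mass s f) f - 2 * r * inner ℝ (h.mass s f) g
      + r ^ 2 * inner ℝ (h.mass s g) g := by
    have hnonneg := h.mass_nonneg s (f - r • g)
    simp only [map_sub, map_smul, inner_sub_left, inner_sub_right, inner_smul_left,
      inner_smul_right, RCLike.conj_to_real] at hnonneg
    rw [h.mass_symm s g f] at hnonneg
    linarith
  have hscaled (r : ℝ) := mul_nonneg hc.le (hform r)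
  refine abs_le.2 ⟨?_, ?_⟩
  · have hneg := hscaled (-(1 / (2 * c)))
    field_simp at hneg ⊢
    linarith
  · have hpos := hscaled (1 / (2 * c))
    field_simp at hpos ⊢
    linarith

theorem abs_inner_bumpAt_le (h : IsEvenBump κ) (s : ℝ) (f : LTwo) :
    |inner ℝ (h.bumpAt s) f| ≤ (1 + inner ℝ (h.mass s f) f) / 2 := by
  have hquad : Integrable fun x => κ (x - s) * f x ^ 2 := by
    refine (LTwo.integrable_mul (h.mass s f) f).congr ?_
    filter_upwards [h.coeFn_mass s f] with x hx
    rw [hx, sq, mul_assoc]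
  have hbump : inner ℝ (h.bumpAt s) f = ∫ x, κ (x - s) * f x := by
    rw [inner_eq_integral]
    exact integral_congr_ae ((h.coeFn_bumpAt s).mono fun x hx => congrArg (· * f x) hx)
  calc |inner ℝ (h.bumpAt s) f| ≤ ∫ x, (κ (x - s) + κ (x - s) * f x ^ 2) / 2 := by
        rw [hbump]
        refine norm_integral_le_of_norm_le (f := fun x => κ (x - s) * f x)
          (((h.integrable_shift s).add hquad).div_const 2) (.of_forall fun x => ?_)
        rw [norm_mul, Real.norm_of_nonneg (h.nonneg _), Real.norm_eq_abs]
        have hsq := mul_nonneg (h.nonneg (x - s)) (sq_nonneg (|f x| - 1))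
        rw [sub_sq, sq_abs] at hsq
        linarith
    _ = (1 + inner ℝ (h.mass s f) f) / 2 := by
        rw [integral_div, integral_add (h.integrable_shift s) hquad, h.integral_shift,
          inner_mass_self]

theorem isWeakDeriv_mass (h : IsEvenBump κ) {f f' : LTwo} (hf : IsWeakDeriv 1 f f') (s : ℝ) :
    IsWeakDeriv 1 (h.mass s f) (h.massDeriv s f + h.mass s f') := by
  refine hf.mul_smooth (h.smooth.comp (contDiff_id.sub contDiff_const)) fun x => ?_
  have hκ : HasDerivAt κ (deriv κ (x - s)) (x - s) :=
    (h.smooth.differentiable (by simp)).differentiableAt.hasDerivAt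
  exact (hκ.comp x ((hasDerivAt_id x).sub_const s)).congr_deriv (mul_one _)

theorem two_mul_inner_mass_deriv (h : IsEvenBump κ) {f f' : LTwo} (hf : IsWeakDeriv 1 f f')
    (s : ℝ) : 2 * inner ℝ (h.mass s f) f' = -inner ℝ (h.massDeriv s f) f := by
  have hparts := (h.isWeakDeriv_mass hf s).inner_eq_neg hf
  rw [inner_add_left, h.mass_symm s f' f] at hparts
  linarith

theorem integrable_moll_mul (h : IsEvenBump κ) (φ : ℝ →ᵇ ℝ) (f g : LTwo) :
    Integrable fun x => φ x * conv f κ x * conv g κ x := by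
  refine (LTwo.integrable_mul (mulL φ (h.mollL f)) (h.mollL g)).congr ?_
  filter_upwards [coeFn_mulL φ (h.mollL f), h.coeFn_mollL f, h.coeFn_mollL g] with x hφ hf hg
  rw [hφ, hf, hg]

theorem inner_mulL_moll (h : IsEvenBump κ) (φ : ℝ →ᵇ ℝ) (f g : LTwo) :
    inner ℝ (mulL φ (h.mollL f)) (h.mollL g) = ∫ x, φ x * conv f κ x * conv g κ x := by
  rw [inner_mulL_left]
  refine integral_congr_ae ?_
  filter_upwards [h.coeFn_mollL f, h.coeFn_mollL g] with x hf hg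
  rw [hf, hg]

theorem integral_conv_pow_three_mul (h : IsEvenBump κ) {b c v w : LTwo} (hb : IsWeakDeriv 1 b c)
    (hv : IsWeakDeriv 1 v w) :
    ∫ x, conv b κ x ^ 3 * conv w κ x = -(3 * ∫ x, conv b κ x ^ 2 * conv c κ x * conv v κ x) := by
  have hcube (g : LTwo) : Integrable fun x => conv b κ x ^ 3 * conv g κ x :=
    (h.integrable_moll_mul (h.mollB b * h.mollB b) b g).congr (.of_forall fun x => by
      simp only [BoundedContinuousFunction.mul_apply, mollB_apply]
      ring)
  have hsq : Integrable fun x => 3 * conv b κ x ^ 2 * conv c κ x * conv v κ x :=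
    ((h.integrable_moll_mul (h.mollB b * h.mollB b) c v).const_mul 3).congr
      (.of_forall fun x => by
        simp only [BoundedContinuousFunction.mul_apply, mollB_apply]
        ring)
  rw [integral_mul_deriv_eq_deriv_mul_of_integrable
    (u := fun x => conv b κ x ^ 3) (u' := fun x => 3 * conv b κ x ^ 2 * conv c κ x)
    (fun x _ => (hb.hasDerivAt_convolve h.smooth h.compact x).pow 3)
    (fun x _ => hv.hasDerivAt_convolve h.smooth h.compact x) (hcube w) hsq (hcube v),
    ← integral_const_mul]
  simp only [mul_assoc]

theorem integral_conv_sq_mul_deriv (h : IsEvenBump κ) {b c : LTwo} (hb : IsWeakDeriv 1 b c) :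
    ∫ x, conv b κ x ^ 2 * conv c κ x * conv b κ x = 0 := by
  have hparts := h.integral_conv_pow_three_mul hb hb
  have hcube (x : ℝ) :
      conv b κ x ^ 3 * conv c κ x = conv b κ x ^ 2 * conv c κ x * conv b κ x := by ring
  simp only [hcube] at hparts
  linarith

/-- The nonlinear term `((u ⋆ κ')² - ν p) (u ⋆ κ'')` before the outer mollification, as a function
of `b = uₓ` and `c = uₓₓ`. -/
noncomputable def nonlin (h : IsEvenBump κ) (ν : ℝ) (p b c : LTwo) : LTwo :=
  mulL (h.mollB c) (mulL (h.mollB b) (h.mollL b) - ν • p)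

theorem conv_nonlin (h : IsEvenBump κ) (ν : ℝ) (p : LTwo) {a b c : LTwo} (hb : IsWeakDeriv 1 a b)
    (hc : IsWeakDeriv 1 b c) :
    conv (h.nonlin ν p b c) κ = conv (fun y => (conv a (deriv κ) y ^ 2 - ν * p y) *
      conv a (iteratedDeriv 2 κ) y) κ := by
  refine conv_congr_ae ?_ κ
  have hone : conv a (deriv κ) = conv b κ := (hb.conv_eq h.smooth h.compact).symm
  have htwo : conv a (iteratedDeriv 2 κ) = conv c κ := by
    rw [hc.conv_eq h.smooth h.compact,
      hb.conv_eq (contDiff_deriv_top h.smooth) h.compact.deriv, iteratedDeriv_succ,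
      iteratedDeriv_one]
  filter_upwards [coeFn_mulL (h.mollB c) (mulL (h.mollB b) (h.mollL b) - ν • p),
    coeFn_mulL (h.mollB b) (h.mollL b), h.coeFn_mollL b, Lp.coeFn_smul ν p,
    Lp.coeFn_sub (mulL (h.mollB b) (h.mollL b)) (ν • p)] with x hmul hsq hmoll hsmul hsub
  rw [nonlin, hmul, hsub, Pi.sub_apply, hsq, hmoll, hsmul, Pi.smul_apply, hone, htwo, mollB_apply,
    mollB_apply, smul_eq_mul]
  ring

theorem inner_mollL_nonlin (h : IsEvenBump κ) (ν : ℝ) (p : LTwo) {b c v w : LTwo}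
    (hb : IsWeakDeriv 1 b c) (hv : IsWeakDeriv 1 v w) (z : ℝ) :
    inner ℝ (h.mollL (h.nonlin ν p b c)) (v + z • b)
      = -(∫ x, conv b κ x ^ 3 * conv w κ x) / 3
        - ν * inner ℝ (mulL (h.mollB c) p) (h.mollL (v + z • b)) := by
  have hcubic (f : LTwo) : inner ℝ (mulL (h.mollB c) (mulL (h.mollB b) (h.mollL b))) (h.mollL f)
      = ∫ x, conv b κ x ^ 2 * conv c κ x * conv f κ x := by
    rw [mulL_mulL, h.inner_mulL_moll]
    refine integral_congr_ae (.of_forall fun x => ?_)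
    simp only [BoundedContinuousFunction.mul_apply, mollB_apply]
    ring
  rw [h.mollL_symm, nonlin, map_sub, inner_sub_left, map_add, inner_add_right, hcubic, map_smul,
    inner_smul_right, hcubic, h.integral_conv_sq_mul_deriv hb,
    h.integral_conv_pow_three_mul hb hv, (mulL (h.mollB c)).map_smul, inner_smul_left]
  simp only [RCLike.conj_to_real]
  ring

theorem abs_inner_mulL_moll_le (h : IsEvenBump κ) {p : LTwo} {C : ℝ} (hp : ∀ᵐ x : ℝ, |p x| ≤ C)
    (c w : LTwo) : |inner ℝ (mulL (h.mollB c) p) (h.mollL w)| ≤ C * ‖c‖ * ‖w‖ := by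
  have hC : 0 ≤ C := let ⟨x, hx⟩ := hp.exists; (abs_nonneg _).trans hx
  have hmul : ‖mulL (h.mollB c) p‖ ≤ C * ‖h.mollL c‖ := by
    refine Lp.norm_le_mul_norm_of_ae_le_mul ?_
    filter_upwards [coeFn_mulL (h.mollB c) p, h.coeFn_mollL c, hp] with x hx hc hpx
    rw [hx, hc, norm_mul, mollB_apply, mul_comm]
    exact mul_le_mul_of_nonneg_right hpx (norm_nonneg _)
  calc |inner ℝ (mulL (h.mollB c) p) (h.mollL w)|
      ≤ ‖mulL (h.mollB c) p‖ * ‖h.mollL w‖ := abs_real_inner_le_norm _ _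
    _ ≤ C * ‖c‖ * ‖w‖ := by
        gcongr
        · exact hmul.trans (by gcongr; exact h.norm_mollL_le c)
        · exact h.norm_mollL_le w

/-- The square of `b ⋆ κ`, in `L²`; for `b = uₓ` its norm is the quartic part of the energy. -/
noncomputable def sqMoll (h : IsEvenBump κ) (b : LTwo) : LTwo := mulL (h.mollB b) (h.mollL b)

theorem norm_sqMoll_sq_le (h : IsEvenBump κ) {b c : LTwo} (hb : IsWeakDeriv 1 b c) :
    ‖h.sqMoll b‖ ^ 2 ≤ 2 * (‖b‖ * ‖c‖) * ‖b‖ ^ 2 := by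
  have hsup : ‖h.mollB b‖ ≤ √(2 * (‖b‖ * ‖c‖)) :=
    (BoundedContinuousFunction.norm_le (by positivity)).2 fun x =>
      Real.abs_le_sqrt (hb.sq_conv_le h x)
  calc ‖h.sqMoll b‖ ^ 2 ≤ (√(2 * (‖b‖ * ‖c‖)) * ‖b‖) ^ 2 := by
        gcongr
        exact (norm_mulL_le _ _).trans (by gcongr; exact h.norm_mollL_le b)
    _ = 2 * (‖b‖ * ‖c‖) * ‖b‖ ^ 2 := by rw [mul_pow, Real.sq_sqrt (by positivity)]

theorem inner_sqMoll_deriv (h : IsEvenBump κ) (b w : LTwo) :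
    inner ℝ (h.sqMoll b) (mulL (h.mollB w) (h.mollL b) + mulL (h.mollB b) (h.mollL w))
      = 2 * ∫ x, conv b κ x ^ 3 * conv w κ x := by
  have hsq : h.sqMoll b =ᵐ[volume] fun x => conv b κ x ^ 2 := by
    filter_upwards [coeFn_mulL (h.mollB b) (h.mollL b), h.coeFn_mollL b] with x hmul hb
    rw [sqMoll, hmul, hb, mollB_apply, sq]
  have hleft : inner ℝ (h.sqMoll b) (mulL (h.mollB w) (h.mollL b))
      = ∫ x, conv b κ x ^ 3 * conv w κ x := by
    rw [real_inner_comm, inner_mulL_left]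
    refine integral_congr_ae ?_
    filter_upwards [hsq, h.coeFn_mollL b] with x hx hb
    rw [hx, hb, mollB_apply]
    ring
  have hright : inner ℝ (h.sqMoll b) (mulL (h.mollB b) (h.mollL w))
      = ∫ x, conv b κ x ^ 3 * conv w κ x := by
    rw [real_inner_comm, inner_mulL_left]
    refine integral_congr_ae ?_
    filter_upwards [hsq, h.coeFn_mollL w] with x hx hw
    rw [hx, hw, mollB_apply]
    ring
  rw [inner_add_right, hleft, hright]
  ring

end IsEvenBump

/-- The weight of `‖a‖²` that dominates the indefinite term of the energy when `|z| ≤ L`. -/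
noncomputable def couplingConst (L : ℝ) : ℝ := 2 * (L ^ 2 + 8 * L ^ 4) ^ 2

theorem couplingConst_nonneg (L : ℝ) : 0 ≤ couplingConst L := by
  rw [couplingConst]
  positivity

namespace IsEvenBump

variable {κ : ℝ → ℝ}

/-- The energy of a beam with velocity `v`, slope `b` and curvature `c`, corrected by `z` times the
momentum along the slope, when the moving mass is at `s` with speed `z`. The correction accounts
for the transport of the mass: the natural multiplier is `v + z • b`, not `v`. -/
noncomputable def energy (h : IsEvenBump κ) (v b c : LTwo) (s z : ℝ) : ℝ :=
  ‖v‖ ^ 2 / 2 + inner ℝ (h.mass s v) v / 2 + ‖c‖ ^ 2 / 2 + ‖h.sqMoll b‖ ^ 2 / 12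
    + z * (inner ℝ v b + inner ℝ (h.mass s v) b)

theorem hasDerivWithinAt_sqMoll (h : IsEvenBump κ) {S : Set ℝ} {t : ℝ} {b : ℝ → LTwo} {b' : LTwo}
    (hb : HasDerivWithinAt b b' S t) :
    HasDerivWithinAt (fun t => h.sqMoll (b t))
      (mulL (h.mollB b') (h.mollL (b t)) + mulL (h.mollB (b t)) (h.mollL b')) S t := by
  have hmul : HasDerivWithinAt (fun t => mulL (h.mollB (b t))) (mulL (h.mollB b')) S t :=
    (mulL.comp h.mollB).hasFDerivAt.comp_hasDerivWithinAt t hb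
  exact hmul.clm_apply (h.mollL.hasFDerivAt.comp_hasDerivWithinAt t hb)

theorem hasDerivWithinAt_energy (h : IsEvenBump κ) {S : Set ℝ} {t : ℝ} {v b c : ℝ → LTwo}
    {v' b' c' : LTwo} {s z : ℝ → ℝ} {z' : ℝ}
    (hv : HasDerivWithinAt v v' S t) (hb : HasDerivWithinAt b b' S t)
    (hc : HasDerivWithinAt c c' S t) (hs : HasDerivWithinAt s (z t) S t)
    (hz : HasDerivWithinAt z z' S t) :
    HasDerivWithinAt (fun t => h.energy (v t) (b t) (c t) (s t) (z t))
      (inner ℝ v' (v t)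
        + (inner ℝ (h.mass (s t) v') (v t)
          - z t * inner ℝ (h.massDeriv (s t) (v t)) (v t) / 2)
        + inner ℝ c' (c t) + (∫ x, conv (b t) κ x ^ 3 * conv b' κ x) / 3
        + (z' * (inner ℝ (v t) (b t) + inner ℝ (h.mass (s t) (v t)) (b t))
          + z t * (inner ℝ v' (b t) + inner ℝ (v t) b' + inner ℝ (h.mass (s t) v') (b t)
            - z t * inner ℝ (h.massDeriv (s t) (v t)) (b t)
            + inner ℝ (h.mass (s t) (v t)) b'))) S t := by
  have hmass : HasDerivWithinAt (fun t => h.mass (s t)) (z t • -h.massDeriv (s t)) S t :=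
    (h.hasDerivAt_mass (s t)).scomp_hasDerivWithinAt t hs
  have hmassv := hmass.clm_apply hv
  have hsq := h.hasDerivWithinAt_sqMoll hb
  have hsum := ((((hv.norm_sq.div_const 2).add ((hmassv.inner ℝ hv).div_const 2)).add
    (hc.norm_sq.div_const 2)).add (hsq.norm_sq.div_const 12)).add
    (hz.mul ((hv.inner ℝ hb).add (hmassv.inner ℝ hb)))
  refine hsum.congr_deriv ?_
  rw [h.inner_sqMoll_deriv]
  simp only [inner_add_left, smul_apply, neg_apply, Pi.add_apply,
    inner_smul_left, inner_neg_left, RCLike.conj_to_real]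
  rw [real_inner_comm v' (v t), real_inner_comm c' (c t), h.mass_symm (s t) (v t) v']
  ring

-- The equation is tested against `v + z • b`, for which the transport terms cancel.
theorem energy_deriv_eq (h : IsEvenBump κ) {v v' b c d₃ d₄ b' c' F p : LTwo} {s z z' ν P : ℝ}
    (hbc : IsWeakDeriv 1 b c) (hc₃ : IsWeakDeriv 1 c d₃) (h₃₄ : IsWeakDeriv 1 d₃ d₄)
    (hvb : IsWeakDeriv 1 v b') (hbc' : IsWeakDeriv 1 b' c')
    (heq : v' + (h.mass s v' - z • h.massDeriv s v) + d₄ - h.mollL (h.nonlin ν p b c)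
      - (F + P • h.bumpAt s) = 0) :
    inner ℝ v' v + (inner ℝ (h.mass s v') v - z * inner ℝ (h.massDeriv s v) v / 2)
        + inner ℝ c' c + (∫ x, conv b κ x ^ 3 * conv b' κ x) / 3
        + (z' * (inner ℝ v b + inner ℝ (h.mass s v) b)
          + z * (inner ℝ v' b + inner ℝ v b' + inner ℝ (h.mass s v') b
            - z * inner ℝ (h.massDeriv s v) b + inner ℝ (h.mass s v) b'))
      = -ν * inner ℝ (mulL (h.mollB c) p) (h.mollL (v + z • b)) + inner ℝ F (v + z • b)
        + P * inner ℝ (h.bumpAt s) (v + z • b)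
        + z' * (inner ℝ v b + inner ℝ (h.mass s v) b) := by
  have hbending : inner ℝ c' c = inner ℝ d₄ v := by
    have hc' := hbc'.inner_eq_neg hc₃
    have hv := hvb.inner_eq_neg h₃₄
    rw [real_inner_comm d₄ v] at hv
    linarith
  have hbending_slope : inner ℝ d₄ b = (0 : ℝ) := by
    rw [real_inner_comm, hbc.inner_eq_neg h₃₄, hc₃.inner_self, neg_zero]
  have hvelocity : inner ℝ v b' = (0 : ℝ) := hvb.inner_self
  have hmass := h.two_mul_inner_mass_deriv hvb s
  have htested : inner ℝ (v' + (h.mass s v' - z • h.massDeriv s v) + d₄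
      - h.mollL (h.nonlin ν p b c) - (F + P • h.bumpAt s)) (v + z • b) = (0 : ℝ) := by
    rw [heq, inner_zero_left]
  rw [inner_sub_left, inner_sub_left, h.inner_mollL_nonlin ν p hbc hvb z] at htested
  simp only [inner_add_left, inner_sub_left, inner_add_right, inner_smul_left, inner_smul_right,
    RCLike.conj_to_real, map_add, map_smul] at htested ⊢
  linear_combination htested + hbending + z * hvelocity + z / 2 * hmass - z * hbending_slope

/-- The quantity controlled by the energy estimate, for a beam with displacement `a`, velocity `v`
and curvature `c`. -/
noncomputable def size (h : IsEvenBump κ) (a v c : LTwo) (s : ℝ) : ℝ :=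
  1 + ‖v‖ ^ 2 + inner ℝ (h.mass s v) v + ‖c‖ ^ 2 + ‖a‖ ^ 2

/-- The energy plus the multiple of `‖a‖²` that makes it coercive when `|z| ≤ L`. -/
noncomputable def penalizedEnergy (h : IsEvenBump κ) (L : ℝ) (a v b c : LTwo) (s z : ℝ) : ℝ :=
  1 + h.energy v b c s z + (couplingConst L + 1 / 4) * ‖a‖ ^ 2

theorem abs_inner_mass_le (h : IsEvenBump κ) (s : ℝ) {v b c : LTwo} (hbc : IsWeakDeriv 1 b c)
    {r : ℝ} (hr : 0 < r) : |inner ℝ (h.mass s v) b| ≤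
      r * inner ℝ (h.mass s v) v + 2 * (‖b‖ * ‖c‖) / (4 * r) := by
  refine (h.abs_mass_le s v b hr).trans ?_
  gcongr
  exact h.mass_self_le hbc.ae_sq_le

theorem abs_coupling_le (h : IsEvenBump κ) {a v b c : LTwo} {s z L : ℝ}
    (hab : IsWeakDeriv 1 a b) (hbc : IsWeakDeriv 1 b c) (hL : 1 ≤ L) (hz : |z| ≤ L) :
    |z * (inner ℝ v b + inner ℝ (h.mass s v) b)| ≤
      (‖v‖ ^ 2 + inner ℝ (h.mass s v) v + ‖c‖ ^ 2) / 4 + couplingConst L * ‖a‖ ^ 2 := by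
  have : 0 < L := one_pos.trans_le hL
  have hvelocity : L * |inner ℝ v b| ≤ ‖v‖ ^ 2 / 4 + L ^ 2 * ‖b‖ ^ 2 :=
    calc L * |inner ℝ v b| ≤ L * (‖v‖ * ‖b‖) := by gcongr; exact abs_real_inner_le_norm v b
      _ ≤ _ := by nlinarith [sq_nonneg (‖v‖ / 2 - L * ‖b‖)]
  have hmass : L * |inner ℝ (h.mass s v) b| ≤
      inner ℝ (h.mass s v) v / 4 + ‖c‖ ^ 2 / 8 + 8 * L ^ 4 * ‖b‖ ^ 2 :=
    calc L * |inner ℝ (h.mass s v) b|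
        ≤ L * (1 / (4 * L) * inner ℝ (h.mass s v) v
            + 2 * (‖b‖ * ‖c‖) / (4 * (1 / (4 * L)))) := by
          gcongr
          exact h.abs_inner_mass_le s hbc (by positivity)
      _ = inner ℝ (h.mass s v) v / 4 + 2 * L ^ 2 * (‖b‖ * ‖c‖) := by field_simp
      _ ≤ _ := by nlinarith [sq_nonneg (‖c‖ - 8 * L ^ 2 * ‖b‖)]
  have hslope : (L ^ 2 + 8 * L ^ 4) * ‖b‖ ^ 2 ≤ ‖c‖ ^ 2 / 8 + couplingConst L * ‖a‖ ^ 2 :=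
    calc (L ^ 2 + 8 * L ^ 4) * ‖b‖ ^ 2 ≤ (L ^ 2 + 8 * L ^ 4) * (‖a‖ * ‖c‖) := by
          gcongr
          exact hab.norm_sq_le hbc
      _ ≤ _ := by
          rw [couplingConst]
          generalize L ^ 2 + 8 * L ^ 4 = M
          nlinarith [sq_nonneg (‖c‖ - 4 * M * ‖a‖)]
  calc |z * (inner ℝ v b + inner ℝ (h.mass s v) b)|
      ≤ L * (|inner ℝ v b| + |inner ℝ (h.mass s v) b|) := by
        rw [abs_mul]
        gcongr
        exact abs_add_le _ _
    _ ≤ _ := by linarith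

theorem size_le_penalizedEnergy (h : IsEvenBump κ) {a v b c : LTwo} {s z L : ℝ}
    (hab : IsWeakDeriv 1 a b) (hbc : IsWeakDeriv 1 b c) (hL : 1 ≤ L) (hz : |z| ≤ L) :
    h.size a v c s ≤ 4 * h.penalizedEnergy L a v b c s z := by
  have hcoupling := neg_le_of_abs_le (h.abs_coupling_le (s := s) (v := v) hab hbc hL hz)
  rw [size, penalizedEnergy, energy]
  linarith [sq_nonneg ‖h.sqMoll b‖]

theorem mass_self_le_size (h : IsEvenBump κ) (a v c : LTwo) (s : ℝ) :
    inner ℝ (h.mass s v) v ≤ h.size a v c s := by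
  rw [size]
  linarith [sq_nonneg ‖v‖, sq_nonneg ‖a‖, sq_nonneg ‖c‖]

theorem norm_sq_add_one_le_size (h : IsEvenBump κ) {a b c : LTwo} (v : LTwo) (s : ℝ)
    (hab : IsWeakDeriv 1 a b) (hbc : IsWeakDeriv 1 b c) :
    ‖v‖ ^ 2 + 1 ≤ h.size a v c s ∧ ‖a‖ ^ 2 + 1 ≤ h.size a v c s ∧
      ‖b‖ ^ 2 + 1 ≤ h.size a v c s ∧ ‖c‖ ^ 2 + 1 ≤ h.size a v c s := by
  have hslope := hab.norm_sq_le hbc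
  have hmass := h.mass_nonneg s v
  rw [size]
  refine ⟨?_, ?_, ?_, ?_⟩ <;>
    linarith [two_mul_le_add_sq ‖a‖ ‖c‖, sq_nonneg ‖v‖, sq_nonneg ‖a‖, sq_nonneg ‖c‖]

theorem norm_le_size (h : IsEvenBump κ) {a b c : LTwo} (v : LTwo) (s : ℝ)
    (hab : IsWeakDeriv 1 a b) (hbc : IsWeakDeriv 1 b c) :
    ‖v‖ ≤ h.size a v c s ∧ ‖a‖ ≤ h.size a v c s ∧
      ‖b‖ ≤ h.size a v c s ∧ ‖c‖ ≤ h.size a v c s := by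
  have hle (r : ℝ) : r ≤ r ^ 2 + 1 := by linarith [sq_nonneg (r - 1), sub_sq r 1, sq_nonneg r]
  obtain ⟨hv, ha, hb, hc⟩ := h.norm_sq_add_one_le_size v s hab hbc
  exact ⟨(hle _).trans hv, (hle _).trans ha, (hle _).trans hb, (hle _).trans hc⟩

theorem norm_mul_norm_add_one_le_size (h : IsEvenBump κ) {a b c : LTwo} (v : LTwo) (s : ℝ)
    (hab : IsWeakDeriv 1 a b) (hbc : IsWeakDeriv 1 b c) :
    ‖v‖ * ‖b‖ + 1 ≤ h.size a v c s ∧ ‖c‖ * ‖v‖ + 1 ≤ h.size a v c s ∧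
      ‖b‖ * ‖c‖ + 1 ≤ h.size a v c s := by
  obtain ⟨hv, -, hb, hc⟩ := h.norm_sq_add_one_le_size v s hab hbc
  refine ⟨?_, ?_, ?_⟩ <;>
    linarith [two_mul_le_add_sq ‖v‖ ‖b‖, two_mul_le_add_sq ‖c‖ ‖v‖, two_mul_le_add_sq ‖b‖ ‖c‖]

end IsEvenBump

/-- `L` bounds all the data of the problem at a given time: the speed `z` and acceleration `z'` of
the moving mass, its load `P`, the force `F` in `L²` and the pressure `p` in `L^∞`. -/
structure IsBoundedLoad (L z z' P : ℝ) (F p : LTwo) : Prop where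
  one_le : 1 ≤ L
  speed : |z| ≤ L
  acceleration : |z'| ≤ L
  load : |P| ≤ L
  force : ‖F‖ ≤ L
  pressure : ∀ᵐ x : ℝ, |p x| ≤ L

theorem norm_add_smul_le {v b : LTwo} {z L : ℝ} (hz : |z| ≤ L) :
    ‖v + z • b‖ ≤ ‖v‖ + L * ‖b‖ :=
  calc ‖v + z • b‖ ≤ ‖v‖ + |z| * ‖b‖ := by
        rw [← Real.norm_eq_abs, ← norm_smul]
        exact norm_add_le _ _
    _ ≤ ‖v‖ + L * ‖b‖ := by gcongr

namespace IsBoundedLoad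

variable {κ : ℝ → ℝ} {L z z' P : ℝ} {a v b c F p : LTwo}

theorem nonneg (hd : IsBoundedLoad L z z' P F p) : 0 ≤ L := zero_le_one.trans hd.one_le

theorem abs_pressure_le (hd : IsBoundedLoad L z z' P F p) (h : IsEvenBump κ) (s : ℝ)
    (hab : IsWeakDeriv 1 a b) (hbc : IsWeakDeriv 1 b c) :
    |inner ℝ (mulL (h.mollB c) p) (h.mollL (v + z • b))| ≤ L * (1 + L) * h.size a v c s := by
  obtain ⟨-, hcv, hbc'⟩ := h.norm_mul_norm_add_one_le_size v s hab hbc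
  have hL := hd.nonneg
  calc |inner ℝ (mulL (h.mollB c) p) (h.mollL (v + z • b))|
      ≤ L * ‖c‖ * (‖v‖ + L * ‖b‖) :=
        (h.abs_inner_mulL_moll_le hd.pressure c _).trans (by
          gcongr
          exact norm_add_smul_le hd.speed)
    _ = L * (‖c‖ * ‖v‖ + L * (‖b‖ * ‖c‖)) := by ring
    _ ≤ L * (h.size a v c s + L * h.size a v c s) := by gcongr <;> linarith
    _ = L * (1 + L) * h.size a v c s := by ring

theorem abs_force_le (hd : IsBoundedLoad L z z' P F p) (h : IsEvenBump κ) (s : ℝ)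
    (hab : IsWeakDeriv 1 a b) (hbc : IsWeakDeriv 1 b c) :
    |inner ℝ F (v + z • b)| ≤ L * (1 + L) * h.size a v c s := by
  obtain ⟨hv, -, hb, -⟩ := h.norm_le_size v s hab hbc
  have hL := hd.nonneg
  calc |inner ℝ F (v + z • b)| ≤ ‖F‖ * ‖v + z • b‖ := abs_real_inner_le_norm _ _
    _ ≤ L * (‖v‖ + L * ‖b‖) := by
        gcongr
        exacts [hd.force, norm_add_smul_le hd.speed]
    _ ≤ L * (h.size a v c s + L * h.size a v c s) := by gcongr
    _ = L * (1 + L) * h.size a v c s := by ring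

theorem abs_load_le (hd : IsBoundedLoad L z z' P F p) (h : IsEvenBump κ) (s : ℝ)
    (hab : IsWeakDeriv 1 a b) (hbc : IsWeakDeriv 1 b c) :
    |P * inner ℝ (h.bumpAt s) (v + z • b)| ≤ L * (1 + L) * h.size a v c s := by
  obtain ⟨-, hone, -⟩ := h.norm_sq_add_one_le_size v s hab hbc
  obtain ⟨-, -, hbc'⟩ := h.norm_mul_norm_add_one_le_size v s hab hbc
  have hL := hd.nonneg
  have hvelocity : |inner ℝ (h.bumpAt s) v| ≤ h.size a v c s :=
    (h.abs_inner_bumpAt_le s v).trans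
      (by linarith [h.mass_self_le_size a v c s, sq_nonneg ‖a‖])
  have hslope : |inner ℝ (h.bumpAt s) b| ≤ h.size a v c s :=
    (h.abs_inner_bumpAt_le s b).trans (by linarith [h.mass_self_le (s := s) hbc.ae_sq_le])
  calc |P * inner ℝ (h.bumpAt s) (v + z • b)|
      = |P| * |inner ℝ (h.bumpAt s) v + z * inner ℝ (h.bumpAt s) b| := by
        rw [abs_mul, inner_add_right, inner_smul_right]
    _ ≤ L * (|inner ℝ (h.bumpAt s) v| + |z| * |inner ℝ (h.bumpAt s) b|) := by
        rw [← abs_mul z]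
        gcongr
        exacts [hd.load, abs_add_le _ _]
    _ ≤ L * (h.size a v c s + L * h.size a v c s) := by
        gcongr
        exact hd.speed
    _ = L * (1 + L) * h.size a v c s := by ring

theorem abs_acceleration_le (hd : IsBoundedLoad L z z' P F p) (h : IsEvenBump κ) (s : ℝ)
    (hab : IsWeakDeriv 1 a b) (hbc : IsWeakDeriv 1 b c) :
    |z' * (inner ℝ v b + inner ℝ (h.mass s v) b)| ≤ 3 * L * h.size a v c s := by
  obtain ⟨hvb, -, hbc'⟩ := h.norm_mul_norm_add_one_le_size v s hab hbc
  have hL := hd.nonneg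
  have hmass : |inner ℝ (h.mass s v) b| ≤ 1 / 2 * inner ℝ (h.mass s v) v + ‖b‖ * ‖c‖ :=
    (h.abs_inner_mass_le s hbc one_half_pos).trans_eq (by ring)
  calc |z' * (inner ℝ v b + inner ℝ (h.mass s v) b)|
      ≤ L * (‖v‖ * ‖b‖ + (1 / 2 * inner ℝ (h.mass s v) v + ‖b‖ * ‖c‖)) := by
        rw [abs_mul]
        gcongr
        exacts [hd.acceleration,
          (abs_add_le _ _).trans (add_le_add (abs_real_inner_le_norm v b) hmass)]
    _ ≤ L * (3 * h.size a v c s) := by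
        gcongr
        linarith [h.mass_self_le_size a v c s, h.mass_nonneg s v]
    _ = 3 * L * h.size a v c s := by ring

end IsBoundedLoad

/-- The rate at which data bounded by `L` can produce energy. -/
noncomputable def growthConst (ν L : ℝ) : ℝ := (|ν| + 2) * (L * (1 + L)) + 3 * L

theorem growthConst_nonneg (ν : ℝ) {L : ℝ} (hL : 0 ≤ L) : 0 ≤ growthConst ν L := by
  rw [growthConst]
  positivity

theorem IsBoundedLoad.energy_production_le {κ : ℝ → ℝ} {L z z' P : ℝ} {a v b c F p : LTwo}
    (hd : IsBoundedLoad L z z' P F p) (h : IsEvenBump κ) (ν s : ℝ)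
    (hab : IsWeakDeriv 1 a b) (hbc : IsWeakDeriv 1 b c) :
    -ν * inner ℝ (mulL (h.mollB c) p) (h.mollL (v + z • b)) + inner ℝ F (v + z • b)
        + P * inner ℝ (h.bumpAt s) (v + z • b)
        + z' * (inner ℝ v b + inner ℝ (h.mass s v) b) ≤
      growthConst ν L * h.size a v c s := by
  have hpressure : -ν * inner ℝ (mulL (h.mollB c) p) (h.mollL (v + z • b)) ≤
      |ν| * (L * (1 + L) * h.size a v c s) := by
    refine (le_abs_self _).trans ?_
    rw [abs_mul, abs_neg]
    gcongr
    exact hd.abs_pressure_le h s hab hbc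
  have hforce := (le_abs_self _).trans (hd.abs_force_le (v := v) h s hab hbc)
  have hload := (le_abs_self _).trans (hd.abs_load_le (v := v) h s hab hbc)
  have hacceleration := (le_abs_self _).trans (hd.abs_acceleration_le (v := v) h s hab hbc)
  rw [growthConst]
  linarith

namespace IsEvenBump

variable {κ : ℝ → ℝ}

theorem isWeakDeriv_mollL (h : IsEvenBump κ) {f g : LTwo} (hfg : IsWeakDeriv 1 f g) :
    IsWeakDeriv 1 (h.mollL f) (h.mollL g) :=
  hfg.convolve h.smooth.continuous h.compact h.even

theorem abs_conv_le_of_ae (h : IsEvenBump κ) {f : LTwo} {M : ℝ} (hf : ∀ᵐ x : ℝ, |f x| ≤ M)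
    (x : ℝ) : |conv f κ x| ≤ M := by
  have hintegrable : Integrable fun y => κ (x - y) :=
    (h.smooth.continuous.integrable_of_hasCompactSupport h.compact).comp_sub_left x
  calc |conv f κ x| ≤ ∫ y, M * κ (x - y) := by
        rw [conv_apply]
        refine norm_integral_le_of_norm_le (f := fun y => f y * κ (x - y)) (hintegrable.const_mul M)
          (hf.mono fun y hy => ?_)
        rw [norm_mul, Real.norm_of_nonneg (h.nonneg _)]
        exact mul_le_mul_of_nonneg_right hy (h.nonneg _)
    _ = M := by
        rw [integral_const_mul, integral_sub_left_eq_self κ volume x, h.integral_eq_one, mul_one]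

theorem mass_mollL_le (h : IsEvenBump κ) {f : LTwo} {M : ℝ} (hf : ∀ᵐ x : ℝ, |f x| ≤ M) (s : ℝ) :
    inner ℝ (h.mass s (h.mollL f)) (h.mollL f) ≤ M ^ 2 := by
  refine h.mass_self_le ?_
  filter_upwards [h.coeFn_mollL f] with x hx
  rw [hx, ← sq_abs]
  gcongr
  exact h.abs_conv_le_of_ae hf x

-- The bound on the right does not see the mollifier: this is where `u₁ ∈ L^∞` enters.
theorem penalizedEnergy_mollL_le (h : IsEvenBump κ) {a v b c : LTwo} {s z L M : ℝ}
    (hab : IsWeakDeriv 1 a b) (hbc : IsWeakDeriv 1 b c) (hL : 1 ≤ L) (hz : |z| ≤ L)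
    (hv : ∀ᵐ x : ℝ, |v x| ≤ M) :
    h.penalizedEnergy L (h.mollL a) (h.mollL v) (h.mollL b) (h.mollL c) s z ≤
      1 + (‖v‖ ^ 2 + M ^ 2 + ‖c‖ ^ 2) * (3 / 4) + 2 * (‖b‖ * ‖c‖) * ‖b‖ ^ 2 / 12
        + (2 * couplingConst L + 1 / 4) * ‖a‖ ^ 2 := by
  have hsq (f : LTwo) : ‖h.mollL f‖ ^ 2 ≤ ‖f‖ ^ 2 := by
    gcongr
    exact h.norm_mollL_le f
  have hcoupling := le_of_abs_le <| h.abs_coupling_le (s := s) (v := h.mollL v)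
    (h.isWeakDeriv_mollL hab) (h.isWeakDeriv_mollL hbc) hL hz
  have hquartic : ‖h.sqMoll (h.mollL b)‖ ^ 2 ≤ 2 * (‖b‖ * ‖c‖) * ‖b‖ ^ 2 :=
    (h.norm_sqMoll_sq_le (h.isWeakDeriv_mollL hbc)).trans (by
      gcongr <;> exact h.norm_mollL_le _)
  have hdisplacement := mul_le_mul_of_nonneg_left (hsq a) (couplingConst_nonneg L)
  rw [penalizedEnergy, energy]
  linarith [hsq v, hsq c, hsq a, h.mass_mollL_le hv s]

end IsEvenBump

namespace IsMollifiedSolution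

variable {T ν : ℝ} {ζ P θ : ℝ → ℝ} {f p : ℝ → SobolevH 2} {u₀ : SobolevH 2} {u₁ : LTwo} {ε : ℝ}
  {U : ℝ → SobolevH 4}

theorem equation_lTwo (hU : IsMollifiedSolution T ν ζ P θ f p u₀ u₁ ε U)
    (h : IsEvenBump (mollifier θ ε)) {t : ℝ} (ht : t ∈ Icc 0 T) :
    dt T 2 U t + (h.mass (ζ t) (dt T 2 U t)
        - derivWithin ζ (Icc 0 T) t • h.massDeriv (ζ t) (dt T 1 U t)) + dx 4 (U t)
      - h.mollL (h.nonlin ν (dx 0 (p t)) (dx 1 (U t)) (dx 2 (U t)))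
      - (dx 0 (f t) + P t • h.bumpAt (ζ t)) = 0 := by
  have hab : IsWeakDeriv 1 (dx 0 (U t)) (dx 1 (U t)) := isWeakDeriv_dx_succ 0 (U t)
  have hbc : IsWeakDeriv 1 (dx 1 (U t)) (dx 2 (U t)) := isWeakDeriv_dx_succ 1 (U t)
  set z := derivWithin ζ (Icc 0 T) t
  set N := h.nonlin ν (dx 0 (p t)) (dx 1 (U t)) (dx 2 (U t)) with hN
  set m := h.mass (ζ t) (dt T 2 U t) - z • h.massDeriv (ζ t) (dt T 1 U t) with hm
  set l := dx 0 (f t) + P t • h.bumpAt (ζ t) with hl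
  have hmass : ∀ᵐ x : ℝ, m x = mollifier θ ε (x - ζ t) * dt T 2 U t x
      - z * deriv (mollifier θ ε) (x - ζ t) * dt T 1 U t x := by
    filter_upwards [Lp.coeFn_sub (h.mass (ζ t) (dt T 2 U t)) (z • h.massDeriv (ζ t) (dt T 1 U t)),
      Lp.coeFn_smul z (h.massDeriv (ζ t) (dt T 1 U t)), h.coeFn_mass (ζ t) (dt T 2 U t),
      h.coeFn_massDeriv (ζ t) (dt T 1 U t)] with x hsub hsmul hmass hmassDeriv
    rw [hm, hsub, Pi.sub_apply, hsmul, Pi.smul_apply, hmass, hmassDeriv, smul_eq_mul, mul_assoc]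
  have hload : ∀ᵐ x : ℝ, l x = dx 0 (f t) x + mollifier θ ε (x - ζ t) * P t := by
    filter_upwards [Lp.coeFn_add (dx 0 (f t)) (P t • h.bumpAt (ζ t)),
      Lp.coeFn_smul (P t) (h.bumpAt (ζ t)), h.coeFn_bumpAt (ζ t)] with x hadd hsmul hbump
    rw [hl, hadd, Pi.add_apply, hsmul, Pi.smul_apply, hbump, smul_eq_mul, mul_comm]
  have hnonlin : ∀ᵐ x : ℝ, h.mollL N x = nonlinearTerm θ ε ν (dx 0 (p t)) (dx 0 (U t)) x := by
    filter_upwards [h.coeFn_mollL N] with x hx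
    rw [hx, hN, h.conv_nonlin ν (dx 0 (p t)) hab hbc]
    rfl
  apply Lp.ext
  filter_upwards [hU.equation t ht, hmass, hload, hnonlin,
    Lp.coeFn_sub (dt T 2 U t + m + dx 4 (U t) - h.mollL N) l,
    Lp.coeFn_sub (dt T 2 U t + m + dx 4 (U t)) (h.mollL N),
    Lp.coeFn_add (dt T 2 U t + m) (dx 4 (U t)), Lp.coeFn_add (dt T 2 U t) m,
    Lp.coeFn_zero ℝ 2 (volume : Measure ℝ)] with x heq hmass hload hnonlin h₁ h₂ h₃ h₄ h₀
  rw [h₁, Pi.sub_apply, h₂, Pi.sub_apply, h₃, Pi.add_apply, h₄, Pi.add_apply, hmass, hload, hnonlin,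
    h₀, Pi.zero_apply, ← heq]
  ring

theorem dx_zero_initial (hU : IsMollifiedSolution T ν ζ P θ f p u₀ u₁ ε U)
    (h : IsEvenBump (mollifier θ ε)) : dx 0 (U 0) = h.mollL (dx 0 u₀) := by
  apply Lp.ext
  filter_upwards [hU.init_pos, h.coeFn_mollL (dx 0 u₀)] with x hU hmoll
  rw [hU, hmoll]

theorem dx_one_initial (hU : IsMollifiedSolution T ν ζ P θ f p u₀ u₁ ε U)
    (h : IsEvenBump (mollifier θ ε)) : dx 1 (U 0) = h.mollL (dx 1 u₀) := by
  have hmoll := h.isWeakDeriv_mollL (isWeakDeriv_dx_succ 0 u₀)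
  exact (isWeakDeriv_dx_succ 0 (U 0)).unique ((hU.dx_zero_initial h).symm ▸ hmoll)

theorem dx_two_initial (hU : IsMollifiedSolution T ν ζ P θ f p u₀ u₁ ε U)
    (h : IsEvenBump (mollifier θ ε)) : dx 2 (U 0) = h.mollL (dx 2 u₀) := by
  have hmoll := h.isWeakDeriv_mollL (isWeakDeriv_dx_succ 1 u₀)
  exact (isWeakDeriv_dx_succ 1 (U 0)).unique ((hU.dx_one_initial h).symm ▸ hmoll)

theorem dt_one_initial (hU : IsMollifiedSolution T ν ζ P θ f p u₀ u₁ ε U)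
    (h : IsEvenBump (mollifier θ ε)) : dt T 1 U 0 = h.mollL u₁ := by
  apply Lp.ext
  filter_upwards [hU.init_vel, h.coeFn_mollL u₁] with x hU hmoll
  rw [hU, hmoll]

theorem exists_hasDerivWithinAt_penalizedEnergy (hT : 0 < T) (hζ : ContDiffOn ℝ 2 ζ (Icc 0 T))
    (hU : IsMollifiedSolution T ν ζ P θ f p u₀ u₁ ε U) (h : IsEvenBump (mollifier θ ε))
    {t : ℝ} (ht : t ∈ Icc 0 T) {L : ℝ}
    (hd : IsBoundedLoad L (derivWithin ζ (Icc 0 T) t)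
      (derivWithin (derivWithin ζ (Icc 0 T)) (Icc 0 T) t) (P t) (dx 0 (f t)) (dx 0 (p t))) :
    ∃ D, HasDerivWithinAt (fun t => h.penalizedEnergy L (dx 0 (U t)) (dt T 1 U t) (dx 1 (U t))
        (dx 2 (U t)) (ζ t) (derivWithin ζ (Icc 0 T) t)) D (Icc 0 T) t ∧
      D ≤ 4 * (growthConst ν L + (couplingConst L + 1 / 4)) *
        h.penalizedEnergy L (dx 0 (U t)) (dt T 1 U t) (dx 1 (U t)) (dx 2 (U t)) (ζ t)
          (derivWithin ζ (Icc 0 T) t) := by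
  set z := derivWithin ζ (Icc 0 T)
  set S := h.size (dx 0 (U t)) (dt T 1 U t) (dx 2 (U t)) (ζ t) with hS
  have hz : ContDiffOn ℝ 1 z (Icc 0 T) :=
    ((contDiffOn_succ_iff_derivWithin (n := 1) (uniqueDiffOn_Icc hT)).1 hζ).2.2
  have hab : IsWeakDeriv 1 (dx 0 (U t)) (dx 1 (U t)) := isWeakDeriv_dx_succ 0 (U t)
  have hbc : IsWeakDeriv 1 (dx 1 (U t)) (dx 2 (U t)) := isWeakDeriv_dx_succ 1 (U t)
  have hc₃ : IsWeakDeriv 1 (dx 2 (U t)) (dx 3 (U t)) := isWeakDeriv_dx_succ 2 (U t)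
  have h₃₄ : IsWeakDeriv 1 (dx 3 (U t)) (dx 4 (U t)) := isWeakDeriv_dx_succ 3 (U t)
  obtain ⟨V, hV⟩ := hU.regular.exists_hasDerivWithinAt_dx hT
  obtain ⟨hVt, hb, hc⟩ := hV t ht
  have hvb : IsWeakDeriv 1 (dt T 1 U t) (dx 1 (V t)) := hVt ▸ isWeakDeriv_dx_succ 0 (V t)
  have hvb' : IsWeakDeriv 1 (dx 1 (V t)) (dx 2 (V t)) := isWeakDeriv_dx_succ 1 (V t)
  have henergy := h.hasDerivWithinAt_energy (hU.regular.hasDerivWithinAt_dt_one hT ht) hb hc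
    (hζ.differentiableOn two_ne_zero t ht).hasDerivWithinAt
    (hz.differentiableOn one_ne_zero t ht).hasDerivWithinAt
  rw [h.energy_deriv_eq hbc hc₃ h₃₄ hvb hvb' (hU.equation_lTwo h ht)] at henergy
  refine ⟨_, (henergy.const_add 1).add
    ((hU.regular.hasDerivWithinAt_dx_zero ht).norm_sq.const_mul (couplingConst L + 1 / 4)), ?_⟩
  have hpenalty : 2 * inner ℝ (dx 0 (U t)) (dt T 1 U t) ≤ S := by
    have hCS := real_inner_le_norm (dx 0 (U t)) (dt T 1 U t)
    rw [hS, IsEvenBump.size]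
    linarith [two_mul_le_add_sq ‖dx 0 (U t)‖ ‖dt T 1 U t‖, sq_nonneg ‖dx 2 (U t)‖,
      h.mass_nonneg (ζ t) (dt T 1 U t)]
  have hcoupling := couplingConst_nonneg L
  calc _ ≤ growthConst ν L * S + (couplingConst L + 1 / 4) * S :=
        add_le_add (hd.energy_production_le h ν (ζ t) hab hbc) (by gcongr)
    _ = (growthConst ν L + (couplingConst L + 1 / 4)) * S := by ring
    _ ≤ (growthConst ν L + (couplingConst L + 1 / 4)) * (4 * _) := by
        have := growthConst_nonneg ν hd.nonneg
        gcongr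
        exact h.size_le_penalizedEnergy hab hbc hd.one_le hd.speed
    _ = _ := by ring

end IsMollifiedSolution

theorem le_mul_exp_of_hasDerivWithinAt_le {T C : ℝ} {y : ℝ → ℝ}
    (hy : ∀ t ∈ Icc 0 T, ∃ D, HasDerivWithinAt y D (Icc 0 T) t ∧ D ≤ C * y t) :
    ∀ t ∈ Icc 0 T, y t ≤ y 0 * Real.exp (C * t) := by
  choose! y' hy' hle using hy
  intro t ht
  have hgronwall := le_gronwallBound_of_liminf_deriv_right_le (δ := y 0) (K := C) (ε := 0)
    (fun s hs => (hy' s hs).continuousWithinAt)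
    (fun s hs r hr => (((hy' s (Ico_subset_Icc_self hs)).mono_of_mem_nhdsWithin
      (Icc_mem_nhdsGE_of_mem hs)).liminf_right_slope_le hr))
    le_rfl (fun s hs => (hle s (Ico_subset_Icc_self hs)).trans_eq (add_zero _).symm) t ht
  rwa [sub_zero, gronwallBound_ε0] at hgronwall

theorem exists_isBoundedLoad {T : ℝ} (hT : 0 < T) {ζ P : ℝ → ℝ} {f p : ℝ → SobolevH 2}
    (hζ : ContDiffOn ℝ 2 ζ (Icc 0 T)) (hP : Bornology.IsBounded (P '' Icc 0 T))
    (hf : Bornology.IsBounded (f '' Icc 0 T)) (hp : Bornology.IsBounded (p '' Icc 0 T)) :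
    ∃ L, ∀ t ∈ Icc 0 T, IsBoundedLoad L (derivWithin ζ (Icc 0 T) t)
      (derivWithin (derivWithin ζ (Icc 0 T)) (Icc 0 T) t) (P t) (dx 0 (f t)) (dx 0 (p t)) := by
  have hz : ContDiffOn ℝ 1 (derivWithin ζ (Icc 0 T)) (Icc 0 T) :=
    ((contDiffOn_succ_iff_derivWithin (n := 1) (uniqueDiffOn_Icc hT)).1 hζ).2.2
  have hz' : ContinuousOn (derivWithin (derivWithin ζ (Icc 0 T)) (Icc 0 T)) (Icc 0 T) :=
    hz.continuousOn_derivWithin (uniqueDiffOn_Icc hT) le_rfl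
  obtain ⟨A, hA⟩ := isCompact_Icc.exists_bound_of_continuousOn (hz.continuousOn.prodMk hz')
  obtain ⟨B, hB⟩ := hP.exists_norm_le
  obtain ⟨C, hC⟩ := hf.exists_norm_le
  obtain ⟨D, hD⟩ := hp.exists_norm_le
  refine ⟨1 + |A| + |B| + |C| + 2 * |D|, fun t ht => ?_⟩
  have hpt : ‖p t‖ ≤ |D| := (hD _ (mem_image_of_mem p ht)).trans (le_abs_self D)
  have hA' := (hA t ht).trans (le_abs_self A)
  have := abs_nonneg A
  have := abs_nonneg B
  have := abs_nonneg C
  have := abs_nonneg D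
  refine ⟨by linarith, ?_, ?_, ?_, ?_, ?_⟩
  · exact (norm_fst_le _).trans (hA'.trans (by linarith))
  · exact (norm_snd_le _).trans (hA'.trans (by linarith))
  · exact (hB _ (mem_image_of_mem P ht)).trans (by linarith [le_abs_self B])
  · exact (norm_dx_le 0 (f t)).trans
      ((hC _ (mem_image_of_mem f ht)).trans (by linarith [le_abs_self C]))
  · filter_upwards [(isWeakDeriv_dx_succ 0 (p t)).ae_sq_le] with x hx
    have hsq : dx 0 (p t) x ^ 2 ≤ (2 * |D|) ^ 2 :=
      calc dx 0 (p t) x ^ 2 ≤ 2 * (‖dx 0 (p t)‖ * ‖dx 1 (p t)‖) := hx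
        _ ≤ 2 * (|D| * |D|) := by gcongr <;> exact (norm_dx_le _ _).trans hpt
        _ ≤ (2 * |D|) ^ 2 := by nlinarith
    exact (abs_le_of_sq_le_sq hsq (by positivity)).trans (by linarith)

theorem exists_ae_abs_le {f : LTwo} (hf : MemLp f ⊤ volume) : ∃ M, ∀ᵐ x : ℝ, |f x| ≤ M := by
  refine ⟨(eLpNorm f ⊤ volume).toReal, ?_⟩
  filter_upwards [enorm_ae_le_eLpNormEssSup f volume] with x hx
  rw [← Real.norm_eq_abs, ← toReal_enorm]
  exact ENNReal.toReal_mono hf.eLpNorm_ne_top (by rwa [eLpNorm_exponent_top])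

theorem exists_uniform_bound {T ν : ℝ} (hT : 0 < T) {ζ P θ : ℝ → ℝ} {f p : ℝ → SobolevH 2}
    {u₀ : SobolevH 2} {u₁ : LTwo} (hζ : ContDiffOn ℝ 2 ζ (Icc 0 T))
    (hP : Bornology.IsBounded (P '' Icc 0 T)) (hf : Bornology.IsBounded (f '' Icc 0 T))
    (hp : Bornology.IsBounded (p '' Icc 0 T)) (hθ : IsEvenBump θ) (hu₁ : MemLp u₁ ⊤ volume) :
    ∃ C, ∀ ε, 0 < ε → ∀ U : ℝ → SobolevH 4, IsMollifiedSolution T ν ζ P θ f p u₀ u₁ ε U →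
      ∀ t ∈ Icc 0 T, ‖dt T 1 U t‖ ≤ C ∧ ‖dx 0 (U t)‖ ≤ C ∧ ‖dx 1 (U t)‖ ≤ C ∧
        ‖dx 2 (U t)‖ ≤ C := by
  obtain ⟨L, hL⟩ := exists_isBoundedLoad hT hζ hP hf hp
  obtain ⟨M, hM⟩ := exists_ae_abs_le hu₁
  have hL₀ := hL 0 (left_mem_Icc.2 hT.le)
  have hgrowth := growthConst_nonneg ν hL₀.nonneg
  have hcoupling := couplingConst_nonneg L
  set C := 4 * (growthConst ν L + (couplingConst L + 1 / 4))
  set E := 1 + (‖u₁‖ ^ 2 + M ^ 2 + ‖dx 2 u₀‖ ^ 2) * (3 / 4)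
    + 2 * (‖dx 1 u₀‖ * ‖dx 2 u₀‖) * ‖dx 1 u₀‖ ^ 2 / 12
    + (2 * couplingConst L + 1 / 4) * ‖dx 0 u₀‖ ^ 2
  refine ⟨4 * (E * Real.exp (C * T)), fun ε hε U hU t ht => ?_⟩
  have h := isEvenBump_mollifier hθ hε
  have hab : IsWeakDeriv 1 (dx 0 (U t)) (dx 1 (U t)) := isWeakDeriv_dx_succ 0 (U t)
  have hbc : IsWeakDeriv 1 (dx 1 (U t)) (dx 2 (U t)) := isWeakDeriv_dx_succ 1 (U t)
  set y : ℝ → ℝ := fun t => h.penalizedEnergy L (dx 0 (U t)) (dt T 1 U t) (dx 1 (U t))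
    (dx 2 (U t)) (ζ t) (derivWithin ζ (Icc 0 T) t)
  have hinitial : y 0 ≤ E := by
    simp only [y, hU.dx_zero_initial h, hU.dx_one_initial h, hU.dx_two_initial h,
      hU.dt_one_initial h]
    exact h.penalizedEnergy_mollL_le (isWeakDeriv_dx_succ 0 u₀) (isWeakDeriv_dx_succ 1 u₀)
      hL₀.one_le hL₀.speed hM
  have hsize : h.size (dx 0 (U t)) (dt T 1 U t) (dx 2 (U t)) (ζ t) ≤ 4 * (E * Real.exp (C * T)) :=
    calc h.size (dx 0 (U t)) (dt T 1 U t) (dx 2 (U t)) (ζ t) ≤ 4 * y t :=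
          h.size_le_penalizedEnergy hab hbc (hL t ht).one_le (hL t ht).speed
      _ ≤ 4 * (y 0 * Real.exp (C * t)) := by
          gcongr
          exact le_mul_exp_of_hasDerivWithinAt_le (fun s hs =>
            hU.exists_hasDerivWithinAt_penalizedEnergy hT hζ h hs (hL s hs)) t ht
      _ ≤ 4 * (E * Real.exp (C * T)) := by
          gcongr
          exact ht.2
  obtain ⟨hv, ha, hb, hc⟩ := h.norm_le_size (dt T 1 U t) (ζ t) hab hbc
  exact ⟨hv.trans hsize, ha.trans hsize, hb.trans hsize, hc.trans hsize⟩

section WeakConvergence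

theorem exists_tendsto_of_equicontinuous_of_dense {ι X α : Type*} [TopologicalSpace X]
    [UniformSpace α] [CompleteSpace α] {l : Filter ι} [l.NeBot] {F : ι → X → α}
    (hF : Equicontinuous F) {D : Set X} (hD : Dense D)
    (h : ∀ x ∈ D, ∃ a, Tendsto (fun i => F i x) l (𝓝 a)) (x : X) :
    ∃ a, Tendsto (fun i => F i x) l (𝓝 a) := by
  suffices hcauchy : Cauchy (map (fun i => F i x) l) from CompleteSpace.complete hcauchy
  refine cauchy_map_iff.2 ⟨inferInstance, fun U hU => ?_⟩
  obtain ⟨V, hV, hVsymm, hVU⟩ := comp_comp_symm_mem_uniformity_sets hU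
  obtain ⟨y, hy, hyD⟩ := mem_closure_iff_nhds.1 (hD x) _ (hF x V hV)
  obtain ⟨a, ha⟩ := h y hyD
  have hpairs : ∀ᶠ p in l ×ˢ l, (F p.1 y, F p.2 y) ∈ V :=
    (cauchy_map_iff.1 ha.cauchy_map).2 hV
  refine hpairs.mono fun p hp => ?_
  exact hVU ⟨F p.2 y, ⟨F p.1 y, hy p.1, hp⟩, SetRel.symm V (hy p.2)⟩

theorem tendstoUniformly_of_equicontinuous {ι X α : Type*} [TopologicalSpace X] [CompactSpace X]
    [UniformSpace α] {l : Filter ι} {F : ι → X → α} {f : X → α} (hF : Equicontinuous F)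
    (h : ∀ x, Tendsto (fun i => F i x) l (𝓝 (f x))) : TendstoUniformly F f l :=
  UniformFun.tendsto_iff_tendstoUniformly.1
    ((hF.tendsto_uniformFun_iff_pi l f).2 (tendsto_pi_nhds.2 h))

theorem exists_subseq_tendsto_of_bounded {ι : Type*} [Countable ι] {F : ℕ → ι → ℝ} {C : ι → ℝ}
    (hF : ∀ k i, |F k i| ≤ C i) :
    ∃ φ : ℕ → ℕ, StrictMono φ ∧ ∀ i, ∃ l, Tendsto (fun k => F (φ k) i) atTop (𝓝 l) := by
  have hc : IsCompact (Set.pi univ fun i => Icc (-C i) (C i)) :=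
    isCompact_univ_pi fun i => isCompact_Icc
  obtain ⟨a, -, φ, hφ, hlim⟩ := hc.tendsto_subseq (x := F) fun k i _ => abs_le.1 (hF k i)
  exact ⟨φ, hφ, fun i => ⟨a i, tendsto_pi_nhds.1 hlim i⟩⟩

variable {H : Type*} [NormedAddCommGroup H] [InnerProductSpace ℝ H]

/-- Weak convergence of a sequence in a Hilbert space, tested against the vectors of the space
rather than phrased in the weak topology. -/
def WeakTendsto (x : ℕ → H) (y : H) : Prop :=
  ∀ z, Tendsto (fun k => inner ℝ (x k) z) atTop (𝓝 (inner ℝ y z))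

theorem weakTendsto_const (y : H) : WeakTendsto (fun _ => y) y := fun _ => tendsto_const_nhds

namespace WeakTendsto

variable {x x' : ℕ → H} {y y' : H}

theorem comp (h : WeakTendsto x y) {φ : ℕ → ℕ} (hφ : StrictMono φ) : WeakTendsto (x ∘ φ) y :=
  fun z => (h z).comp hφ.tendsto_atTop

theorem sub (h : WeakTendsto x y) (h' : WeakTendsto x' y') :
    WeakTendsto (fun k => x k - x' k) (y - y') := fun z => by
  simpa only [inner_sub_left] using (h z).sub (h' z)

theorem norm_le (h : WeakTendsto x y) {C : ℝ} (hC : ∀ k, ‖x k‖ ≤ C) : ‖y‖ ≤ C := by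
  have hinner : inner ℝ y y ≤ C * ‖y‖ := le_of_tendsto (h y) (.of_forall fun k =>
    (real_inner_le_norm _ _).trans (by gcongr; exact hC k))
  rw [real_inner_self_eq_norm_mul_norm] at hinner
  rcases (norm_nonneg y).eq_or_lt with hy | hy
  · rw [← hy]
    exact (norm_nonneg _).trans (hC 0)
  · exact le_of_mul_le_mul_right hinner hy

end WeakTendsto

theorem equicontinuous_inner {x : ℕ → H} {C : ℝ} (hC : ∀ k, ‖x k‖ ≤ C) :
    Equicontinuous fun k z => (inner ℝ (x k) z : ℝ) := by
  refine (LipschitzWith.uniformEquicontinuous _ C.toNNReal fun k => ?_).equicontinuous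
  refine ((innerSL ℝ (x k)).lipschitz).weaken ?_
  rw [← norm_toNNReal, innerSL_apply_norm]
  exact Real.toNNReal_mono (hC k)

variable [CompleteSpace H] [TopologicalSpace.SeparableSpace H]

theorem exists_subseq_weakTendsto {x : ℕ → H} {C : ℝ} (hC : ∀ k, ‖x k‖ ≤ C) :
    ∃ φ : ℕ → ℕ, StrictMono φ ∧ ∃ y, WeakTendsto (x ∘ φ) y := by
  let D : ℕ → WeakDual ℝ H := fun k => StrongDual.toWeakDual (InnerProductSpace.toDual ℝ H (x k))
  have hmem : ∀ k, D k ∈ WeakDual.toStrongDual ⁻¹' Metric.closedBall (0 : StrongDual ℝ H) C :=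
    fun k => by simpa [D] using hC k
  obtain ⟨a, -, φ, hφ, hlim⟩ := WeakDual.isSeqCompact_closedBall ℝ H 0 C hmem
  refine ⟨φ, hφ, (InnerProductSpace.toDual ℝ H).symm (WeakDual.toStrongDual a), fun z => ?_⟩
  rw [InnerProductSpace.toDual_symm_apply]
  exact ((WeakDual.eval_continuous z).tendsto a).comp hlim

theorem exists_weakTendsto_of_dense {x : ℕ → H} {C : ℝ} (hC : ∀ k, ‖x k‖ ≤ C) {D : Set H}
    (hD : Dense D) (h : ∀ d ∈ D, ∃ l, Tendsto (fun k => inner ℝ (x k) d) atTop (𝓝 l)) :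
    ∃ y, WeakTendsto x y := by
  obtain ⟨φ, hφ, y, hy⟩ := exists_subseq_weakTendsto hC
  refine ⟨y, fun z => ?_⟩
  obtain ⟨l, hl⟩ := exists_tendsto_of_equicontinuous_of_dense (equicontinuous_inner hC) hD h z
  rwa [tendsto_nhds_unique (hy z) (hl.comp hφ.tendsto_atTop)]

theorem exists_subseq_weakTendsto_of_equicontinuous {X : Type*} [TopologicalSpace X]
    [TopologicalSpace.SeparableSpace X] {w : ℕ → X → H} {C : ℝ} (hw : Equicontinuous w)
    (hC : ∀ k x, ‖w k x‖ ≤ C) :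
    ∃ φ : ℕ → ℕ, StrictMono φ ∧ ∀ x, ∃ y, WeakTendsto (fun k => w (φ k) x) y := by
  obtain ⟨A, hAc, hA⟩ := TopologicalSpace.exists_countable_dense X
  obtain ⟨D, hDc, hD⟩ := TopologicalSpace.exists_countable_dense H
  have := hAc.to_subtype
  have := hDc.to_subtype
  obtain ⟨φ, hφ, hlim⟩ := exists_subseq_tendsto_of_bounded
    (F := fun k (i : A × D) => inner ℝ (w k i.1) (i.2 : H)) (C := fun i => C * ‖(i.2 : H)‖)
    (fun k i => (abs_real_inner_le_norm _ _).trans (by gcongr; exact hC k _))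
  refine ⟨φ, hφ, fun x => exists_weakTendsto_of_dense (fun k => hC (φ k) x) hD fun d hd => ?_⟩
  have hinner : UniformContinuous fun z : H => (inner ℝ z d : ℝ) :=
    (innerSLFlip ℝ d).uniformContinuous
  have hequi : Equicontinuous fun k x => (inner ℝ (w (φ k) x) d : ℝ) := fun x U hU =>
    (hw.comp φ) x _ (hinner hU)
  exact exists_tendsto_of_equicontinuous_of_dense hequi hA
    (fun a ha => hlim (⟨a, ha⟩, ⟨d, hd⟩)) x

end WeakConvergence

section WeakDerivativeLimits

theorem integral_mul_eq_inner (f : LTwo) {ψ : ℝ → ℝ} (hψ : MemLp ψ 2 volume) :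
    ∫ x, f x * ψ x = inner ℝ f (hψ.toLp ψ) := by
  rw [inner_eq_integral]
  exact integral_congr_ae (hψ.coeFn_toLp.mono fun x hx => by simp only [hx])

theorem memLp_iteratedDeriv {φ : ℝ → ℝ} (hφ : ContDiff ℝ ∞ φ) (hc : HasCompactSupport φ) (j : ℕ) :
    MemLp (iteratedDeriv j φ) 2 volume :=
  (hφ.continuous_iteratedDeriv j (by exact_mod_cast le_top)).memLp_of_hasCompactSupport
    (hasCompactSupport_iterated_deriv hc j)

theorem isWeakDeriv_iff_inner {j : ℕ} {f g : LTwo} :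
    IsWeakDeriv j f g ↔ ∀ (φ : ℝ → ℝ) (hφ : ContDiff ℝ ∞ φ) (hc : HasCompactSupport φ),
      inner ℝ g ((hφ.continuous.memLp_of_hasCompactSupport hc).toLp φ) =
        (-1) ^ j * inner ℝ f ((memLp_iteratedDeriv hφ hc j).toLp _) := by
  have hsign : (-1 : ℝ) ^ j * (-1) ^ j = 1 := by rw [← mul_pow, neg_one_mul, neg_neg, one_pow]
  simp only [IsWeakDeriv, ← integral_mul_eq_inner]
  refine forall₃_congr fun φ _ _ => ⟨fun h => ?_, fun h => ?_⟩
  · rw [h, ← mul_assoc, hsign, one_mul]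
  · rw [h, ← mul_assoc, hsign, one_mul]

theorem exists_isWeakDeriv_weakTendsto {j : ℕ} {x y : ℕ → LTwo} {x' : LTwo} {C : ℝ}
    (hxy : ∀ k, IsWeakDeriv j (x k) (y k)) (hC : ∀ k, ‖y k‖ ≤ C) (hx : WeakTendsto x x') :
    ∃ y', IsWeakDeriv j x' y' ∧ WeakTendsto y y' := by
  have hlim (φ : ℝ → ℝ) (hφ : ContDiff ℝ ∞ φ) (hc : HasCompactSupport φ) :
      Tendsto (fun k => inner ℝ (y k) ((hφ.continuous.memLp_of_hasCompactSupport hc).toLp φ))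
        atTop (𝓝 ((-1) ^ j * inner ℝ x' ((memLp_iteratedDeriv hφ hc j).toLp _))) := by
    simp only [fun k => isWeakDeriv_iff_inner.1 (hxy k) φ hφ hc]
    exact (hx _).const_mul _
  obtain ⟨y', hy'⟩ := exists_weakTendsto_of_dense hC
    (Lp.dense_hasCompactSupport_contDiff (F := ℝ) (μ := (volume : Measure ℝ)) (p := 2)
      ENNReal.ofNat_ne_top) (by
    rintro d ⟨φ, hdφ, hc, hφ⟩
    have hd : d = (hφ.continuous.memLp_of_hasCompactSupport hc).toLp φ :=
      Lp.ext (hdφ.trans (MemLp.coeFn_toLp _).symm)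
    exact hd ▸ ⟨_, hlim φ hφ hc⟩)
  exact ⟨y', isWeakDeriv_iff_inner.2 fun φ hφ hc => tendsto_nhds_unique (hy' _) (hlim φ hφ hc), hy'⟩

theorem isClosed_isWeakDeriv (j : ℕ) : IsClosed {q : LTwo × LTwo | IsWeakDeriv j q.1 q.2} := by
  simp only [isWeakDeriv_iff_inner, Set.ofPred_forall]
  refine isClosed_iInter fun φ => isClosed_iInter fun hφ => isClosed_iInter fun hc => ?_
  exact isClosed_eq (by fun_prop) (by fun_prop)

theorem IsWeakDeriv.sub {j : ℕ} {f g f' g' : LTwo} (h : IsWeakDeriv j f g)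
    (h' : IsWeakDeriv j f' g') : IsWeakDeriv j (f - f') (g - g') := by
  simpa only [neg_one_smul, ← sub_eq_add_neg] using h.add (h'.smul (-1))

end WeakDerivativeLimits

section LocalCompactness

theorem norm_mulL_le_of_ae_abs_le {χ : ℝ →ᵇ ℝ} (hχ : MemLp χ 2 volume) {f : LTwo} {M : ℝ}
    (hf : ∀ᵐ x, |f x| ≤ M) : ‖mulL χ f‖ ≤ M * ‖hχ.toLp χ‖ := by
  refine Lp.norm_le_mul_norm_of_ae_le_mul ?_
  filter_upwards [coeFn_mulL χ f, hχ.coeFn_toLp, hf] with x hmul hcoe hx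
  rw [hmul, hcoe, norm_mul, mul_comm]
  gcongr
  exact hx

theorem norm_mulL_sq (χ : ℝ →ᵇ ℝ) (f : LTwo) : ‖mulL χ f‖ ^ 2 = ∫ x, (χ x * f x) ^ 2 := by
  rw [← real_inner_self_eq_norm_sq, inner_eq_integral]
  exact integral_congr_ae ((coeFn_mulL χ f).mono fun x hx => by simp only [hx, sq])

theorem norm_mulL_convL (χ : ℝ →ᵇ ℝ) {κ : ℝ → ℝ} (hκ : Continuous κ)
    (hκc : HasCompactSupport κ) (f : LTwo) :
    ‖mulL χ (convL hκ hκc f)‖ = √(∫ x, (χ x * conv f κ x) ^ 2) := by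
  rw [← Real.sqrt_sq (norm_nonneg (mulL χ _)), norm_mulL_sq]
  refine congrArg Real.sqrt (integral_congr_ae ?_)
  filter_upwards [coeFn_convL hκ hκc f] with x hx
  rw [hx]

theorem tendsto_norm_mulL_convL_of_weakTendsto {f : ℕ → LTwo} {C : ℝ} (hf : ∀ k, ‖f k‖ ≤ C)
    (h0 : WeakTendsto f 0) {χ : ℝ →ᵇ ℝ} (hχ : HasCompactSupport χ) {κ : ℝ → ℝ}
    (hκ : Continuous κ) (hκc : HasCompactSupport κ) :
    Tendsto (fun k => ‖mulL χ (convL hκ hκc (f k))‖) atTop (𝓝 0) := by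
  have hbound (k x) : |conv (f k) κ x| ≤ (eLpNorm κ 2 volume).toReal * C :=
    (abs_conv_le hκ hκc (f k) x).trans
      (mul_le_mul_of_nonneg_left (hf k) ENNReal.toReal_nonneg)
  have hpointwise (x) : Tendsto (fun k => conv (f k) κ x) atTop (𝓝 0) := by
    simp only [conv_eq_inner hκ hκc]
    simpa only [inner_zero_left] using h0 (memLp_kernel hκ hκc x).toLp
  generalize (eLpNorm κ 2 volume).toReal * C = B at hbound
  have hdominating : Integrable fun x => (χ x * B) ^ 2 :=
    (MemLp.mul_const (χ.continuous.memLp_of_hasCompactSupport hχ) B).integrable_sq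
  have hsq : Tendsto (fun k => ∫ x, (χ x * conv (f k) κ x) ^ 2) atTop
      (𝓝 (∫ x, (χ x * 0) ^ 2)) := by
    refine tendsto_integral_of_dominated_convergence _ (fun k => ?_) hdominating
      (fun k => .of_forall fun x => ?_) (.of_forall fun x => ((hpointwise x).const_mul _).pow 2)
    · exact ((χ.continuous.mul (continuous_conv hκ hκc (f k))).pow 2).aestronglyMeasurable
    · rw [norm_pow, ← sq_abs (χ x * B), abs_mul, norm_mul, Real.norm_eq_abs]
      gcongr
      exact (hbound k x).trans (le_abs_self B)
  simpa only [norm_mulL_convL, mul_zero, ne_eq, OfNat.ofNat_ne_zero, not_false_eq_true, zero_pow,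
    integral_zero, Real.sqrt_zero] using hsq.sqrt

-- A kernel of radius `R` moves a function `f` by at most `√R * ‖f'‖`, uniformly in `x`, while
-- convolution with a fixed kernel turns weak convergence into bounded pointwise convergence.
theorem tendsto_norm_mulL_of_weakTendsto {f g : ℕ → LTwo} {C : ℝ}
    (hfg : ∀ k, IsWeakDeriv 1 (f k) (g k)) (hf : ∀ k, ‖f k‖ ≤ C) (hg : ∀ k, ‖g k‖ ≤ C)
    (h0 : WeakTendsto f 0) {χ : ℝ →ᵇ ℝ} (hχ : HasCompactSupport χ) :
    Tendsto (fun k => ‖mulL χ (f k)‖) atTop (𝓝 0) := by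
  have hC : 0 ≤ C := (norm_nonneg _).trans (hf 0)
  have hχ2 : MemLp χ 2 volume := χ.continuous.memLp_of_hasCompactSupport hχ
  set A := C * ‖hχ2.toLp χ‖
  have hA : 0 ≤ A := by positivity
  refine tendsto_order.2 ⟨fun a ha => .of_forall fun k => ha.trans_le (norm_nonneg _),
    fun η hη => ?_⟩
  set r := η / (2 * (A + 1)) with hr
  have hr0 : 0 < r := by positivity
  obtain ⟨κ, hκ, hκr⟩ := exists_evenBump_supported (R := r ^ 2) (by positivity)
  have herror (k) : ‖mulL χ (f k - hκ.mollL (f k))‖ ≤ η / 2 := by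
    have hclose : ∀ᵐ x, |(f k - hκ.mollL (f k) : LTwo) x| ≤ r * C := by
      filter_upwards [(hfg k).ae_abs_conv_sub_le hκ hκr, Lp.coeFn_sub (f k) (hκ.mollL (f k)),
        hκ.coeFn_mollL (f k)] with x hx hsub hmoll
      rw [hsub, Pi.sub_apply, hmoll, abs_sub_comm]
      refine hx.trans ?_
      rw [Real.sqrt_sq hr0.le]
      gcongr
      exact hg k
    calc ‖mulL χ (f k - hκ.mollL (f k))‖ ≤ r * C * ‖hχ2.toLp χ‖ :=
          norm_mulL_le_of_ae_abs_le hχ2 hclose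
      _ = r * A := mul_assoc _ _ _
      _ ≤ r * (A + 1) := by gcongr; linarith
      _ = η / 2 := by rw [hr]; field_simp
  filter_upwards [(tendsto_norm_mulL_convL_of_weakTendsto hf h0 hχ hκ.smooth.continuous
    hκ.compact).eventually_lt_const (half_pos hη)] with k hk
  calc ‖mulL χ (f k)‖ = ‖mulL χ (f k - hκ.mollL (f k)) + mulL χ (hκ.mollL (f k))‖ := by
        rw [← map_add, sub_add_cancel]
    _ ≤ ‖mulL χ (f k - hκ.mollL (f k))‖ + ‖mulL χ (hκ.mollL (f k))‖ := norm_add_le _ _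
    _ < η / 2 + η / 2 := add_lt_add_of_le_of_lt (herror k) hk
    _ = η := add_halves η

end LocalCompactness

section BoundedJets

/-- A function `f ∈ H²(ℝ)` with first and second weak derivatives `g` and `h`, all three bounded
by `C` in `L²(ℝ)`. It is the form in which the bounds on a solution at a fixed time are used. -/
structure IsBoundedJet (C : ℝ) (f g h : LTwo) : Prop where
  deriv_one : IsWeakDeriv 1 f g
  deriv_two : IsWeakDeriv 1 g h
  norm_zero : ‖f‖ ≤ C
  norm_one : ‖g‖ ≤ C
  norm_two : ‖h‖ ≤ C

namespace IsBoundedJet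

variable {C C' : ℝ} {f g h f' g' h' : LTwo}

theorem nonneg (hj : IsBoundedJet C f g h) : 0 ≤ C := (norm_nonneg _).trans hj.norm_zero

theorem sub (hj : IsBoundedJet C f g h) (hj' : IsBoundedJet C' f' g' h') :
    IsBoundedJet (C + C') (f - f') (g - g') (h - h') where
  deriv_one := hj.deriv_one.sub hj'.deriv_one
  deriv_two := hj.deriv_two.sub hj'.deriv_two
  norm_zero := (norm_sub_le _ _).trans (add_le_add hj.norm_zero hj'.norm_zero)
  norm_one := (norm_sub_le _ _).trans (add_le_add hj.norm_one hj'.norm_one)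
  norm_two := (norm_sub_le _ _).trans (add_le_add hj.norm_two hj'.norm_two)

theorem two_mul_norm_mul_norm_le (hj : IsBoundedJet C f g h) :
    2 * (‖g‖ * ‖h‖) ≤ (2 * C) ^ 2 := by
  have hC := hj.nonneg
  calc 2 * (‖g‖ * ‖h‖) ≤ 2 * (C * C) := by gcongr; exacts [hj.norm_one, hj.norm_two]
    _ ≤ (2 * C) ^ 2 := by nlinarith

theorem ae_abs_slope_le (hj : IsBoundedJet C f g h) : ∀ᵐ x, |g x| ≤ 2 * C :=
  hj.deriv_two.ae_sq_le.mono fun _ hx =>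
    abs_le_of_sq_le_sq (hx.trans hj.two_mul_norm_mul_norm_le) (by linarith [hj.nonneg])

theorem abs_conv_slope_le (hj : IsBoundedJet C f g h) {κ : ℝ → ℝ} (hκ : IsEvenBump κ) (x : ℝ) :
    |conv g κ x| ≤ 2 * C :=
  abs_le_of_sq_le_sq ((hj.deriv_two.sq_conv_le hκ x).trans hj.two_mul_norm_mul_norm_le)
    (by linarith [hj.nonneg])

end IsBoundedJet

theorem exists_smooth_cutoff {K : Set ℝ} (hK : IsCompact K) :
    ∃ χ χ' χ'' : ℝ →ᵇ ℝ, HasCompactSupport χ ∧ ContDiff ℝ ∞ χ ∧ ContDiff ℝ ∞ χ' ∧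
      (∀ x, HasDerivAt χ (χ' x) x) ∧ (∀ x, HasDerivAt χ' (χ'' x) x) ∧
      ∀ x ∈ K, χ x = 1 ∧ χ' x = 0 := by
  obtain ⟨r, hr0, hr⟩ := hK.isBounded.exists_pos_norm_lt
  let b : ContDiffBump (0 : ℝ) := ⟨r, r + 1, hr0, lt_add_one r⟩
  have hb : ContDiff ℝ ∞ b := b.contDiff
  have hb' := contDiff_deriv_top hb
  have hb'' := contDiff_deriv_top hb'
  have hc : HasCompactSupport b := b.hasCompactSupport
  have hasDerivAt {g : ℝ → ℝ} (hg : ContDiff ℝ ∞ g) (x : ℝ) : HasDerivAt g (deriv g x) x :=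
    (hg.differentiable (by norm_num) x).hasDerivAt
  have coe {g : ℝ → ℝ} (hg : Continuous g) (hgc : HasCompactSupport g) :
      ⇑(shiftB hg hgc 0) = g := by
    ext x
    rw [shiftB_apply, sub_zero]
  refine ⟨shiftB hb.continuous hc 0, shiftB hb'.continuous hc.deriv 0,
    shiftB hb''.continuous hc.deriv.deriv 0, ?_⟩
  simp only [coe]
  refine ⟨hc, hb, hb', hasDerivAt hb, hasDerivAt hb', fun x hx => ?_⟩
  have hone : b =ᶠ[𝓝 x] 1 := b.eventuallyEq_one_of_mem_ball (mem_ball_zero_iff.2 (hr x hx))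
  exact ⟨hone.eq_of_nhds, by rw [hone.deriv_eq]; exact deriv_const x 1⟩

theorem exists_localization {K : Set ℝ} (hK : IsCompact K) (C : ℝ) :
    ∃ χ : ℝ →ᵇ ℝ, HasCompactSupport χ ∧ ∃ A, 0 ≤ A ∧ ∀ f g h, IsBoundedJet C f g h →
      ∃ g' h', IsWeakDeriv 1 (mulL χ f) g' ∧ IsWeakDeriv 1 g' h' ∧ ‖h'‖ ≤ A ∧
        mulL χ f =ᵐ[volume.restrict K] f ∧ g' =ᵐ[volume.restrict K] g := by
  obtain ⟨χ, χ', χ'', hc, hs, hs', hd, hd', hχ⟩ := exists_smooth_cutoff hK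
  refine ⟨χ, hc, (‖χ''‖ + ‖χ'‖ + (‖χ'‖ + ‖χ‖)) * |C|, by positivity,
    fun f g h hj => ⟨mulL χ' f + mulL χ g, (mulL χ'' f + mulL χ' g) + (mulL χ' g + mulL χ h),
      hj.deriv_one.mul_smooth hs hd,
      (hj.deriv_one.mul_smooth hs' hd').add (hj.deriv_two.mul_smooth hs hd), ?_, ?_, ?_⟩⟩
  · have hmul (φ : ℝ →ᵇ ℝ) {v : LTwo} (hv : ‖v‖ ≤ C) : ‖mulL φ v‖ ≤ ‖φ‖ * |C| :=
      (norm_mulL_le φ v).trans (by gcongr; exact hv.trans (le_abs_self C))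
    calc _ ≤ (‖mulL χ'' f‖ + ‖mulL χ' g‖) + (‖mulL χ' g‖ + ‖mulL χ h‖) :=
          norm_add_le_of_le (norm_add_le _ _) (norm_add_le _ _)
      _ ≤ (‖χ''‖ * |C| + ‖χ'‖ * |C|) + (‖χ'‖ * |C| + ‖χ‖ * |C|) := by
          gcongr
          exacts [hmul _ hj.norm_zero, hmul _ hj.norm_one, hmul _ hj.norm_one, hmul _ hj.norm_two]
      _ = _ := by ring
  · filter_upwards [ae_restrict_of_ae (coeFn_mulL χ f), ae_restrict_mem hK.measurableSet]
      with x hx hxK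
    rw [hx, (hχ x hxK).1, one_mul]
  · filter_upwards [ae_restrict_of_ae (Lp.coeFn_add (mulL χ' f) (mulL χ g)),
      ae_restrict_of_ae (coeFn_mulL χ' f), ae_restrict_of_ae (coeFn_mulL χ g),
      ae_restrict_mem hK.measurableSet] with x hadd hχ'f hχg hxK
    rw [hadd, Pi.add_apply, hχ'f, hχg, (hχ x hxK).1, (hχ x hxK).2, one_mul, zero_mul, zero_add]

theorem IsBoundedJet.hsENormOn_lt_top {C : ℝ} {f g h : LTwo} (hj : IsBoundedJet C f g h) {s : ℝ}
    (h0 : 0 ≤ s) (h2 : s < 2) (K : Set ℝ) : hsENormOn s K f < ⊤ := by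
  obtain ⟨C, -, hC⟩ := exists_hsENorm_le h0 h2 one_pos
  exact ((iInf₂_le f EventuallyEq.rfl).trans (hC f g h hj.deriv_one hj.deriv_two)).trans_lt
    ENNReal.ofReal_lt_top

theorem exists_hsENormOn_le {s : ℝ} (h0 : 0 ≤ s) (h2 : s < 2) {K : Set ℝ} (hK : IsCompact K)
    (C : ℝ) {η : ℝ} (hη : 0 < η) :
    ∃ χ : ℝ →ᵇ ℝ, HasCompactSupport χ ∧ ∃ δ, 0 < δ ∧ ∀ f g h, IsBoundedJet C f g h →
      ‖mulL χ f‖ ≤ δ → hsENormOn s K f ≤ ENNReal.ofReal η := by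
  obtain ⟨χ, hc, A, hA, hloc⟩ := exists_localization hK C
  obtain ⟨B, hB, hs⟩ := exists_hsENorm_le h0 h2 (δ := η / (2 * (A + 1))) (by positivity)
  refine ⟨χ, hc, η / (2 * (B + 1)), by positivity, fun f g h hj hχ => ?_⟩
  obtain ⟨g', h', hfg', hgh', hh', hfK, -⟩ := hloc f g h hj
  refine ((iInf₂_le (mulL χ f) hfK).trans (hs _ g' h' hfg' hgh')).trans
    (ENNReal.ofReal_le_ofReal ?_)
  calc η / (2 * (A + 1)) * ‖h'‖ + B * ‖mulL χ f‖
      ≤ η / (2 * (A + 1)) * (A + 1) + (B + 1) * (η / (2 * (B + 1))) := by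
        gcongr <;> linarith
    _ = η := by field_simp; ring

theorem exists_ae_abs_slope_le {K : Set ℝ} (hK : IsCompact K) (C : ℝ) {η : ℝ} (hη : 0 < η) :
    ∃ χ : ℝ →ᵇ ℝ, HasCompactSupport χ ∧ ∃ δ, 0 < δ ∧ ∀ f g h, IsBoundedJet C f g h →
      ‖mulL χ f‖ ≤ δ → ∀ᵐ x ∂(volume.restrict K), |g x| ≤ η := by
  obtain ⟨χ, hc, A, hA, hloc⟩ := exists_localization hK C
  set ρ := η ^ 2 / (2 * (A + 1)) with hρ
  have hρ0 : 0 < ρ := by positivity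
  refine ⟨χ, hc, ρ ^ 2 / (A + 1), by positivity, fun f g h hj hχ => ?_⟩
  obtain ⟨g', h', hfg', hgh', hh', -, hgK⟩ := hloc f g h hj
  have hg' : ‖g'‖ ≤ ρ := by
    refine le_of_sq_le_sq ?_ hρ0.le
    calc ‖g'‖ ^ 2 ≤ ‖mulL χ f‖ * ‖h'‖ := hfg'.norm_sq_le hgh'
      _ ≤ ρ ^ 2 / (A + 1) * (A + 1) := by gcongr; linarith
      _ = ρ ^ 2 := by field_simp
  filter_upwards [hgK, ae_restrict_of_ae hgh'.ae_sq_le] with x hx hx'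
  rw [← hx]
  refine abs_le_of_sq_le_sq (hx'.trans ?_) hη.le
  calc 2 * (‖g'‖ * ‖h'‖) ≤ 2 * (ρ * (A + 1)) := by gcongr; linarith
    _ = η ^ 2 := by rw [hρ]; field_simp

end BoundedJets

section BoundedCurves

/-- The curve `w₀`, with first and second space derivatives `w₁` and `w₂`, is bounded in `H²(ℝ)`
and Lipschitz in `L²(ℝ)` on `[0,T]`, both with the constant `C`. Solutions satisfy this uniformly
in `ε`, and it passes to weak limits. -/
structure IsBoundedCurve (T : ℝ) (C : NNReal) (w₀ w₁ w₂ : ℝ → LTwo) : Prop where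
  bounded : ∀ t ∈ Icc 0 T, IsBoundedJet C (w₀ t) (w₁ t) (w₂ t)
  lipschitz : LipschitzOnWith C w₀ (Icc 0 T)

theorem tendsto_zero_of_eventually_le_ofReal {ι : Type*} {l : Filter ι} {F : ι → ℝ≥0∞}
    (h : ∀ η : ℝ, 0 < η → ∀ᶠ i in l, F i ≤ ENNReal.ofReal η) : Tendsto F l (𝓝 0) := by
  refine ENNReal.tendsto_nhds_zero.2 fun ε hε => ?_
  obtain ⟨η, hη0, hη⟩ := ENNReal.lt_iff_exists_real_btwn.1 hε |>.imp fun _ h => h.2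
  exact (h η (ENNReal.ofReal_pos.1 hη0)).mono fun i hi => hi.trans hη.le

theorem IsBoundedCurve.continuousInHs {T : ℝ} {C : NNReal} {w₀ w₁ w₂ : ℝ → LTwo}
    (hw : IsBoundedCurve T C w₀ w₁ w₂) {s : ℝ} (h0 : 0 ≤ s) (h2 : s < 2) {K : Set ℝ}
    (hK : IsCompact K) : ContinuousInHs T s K w₀ := by
  refine fun t ht => ⟨(hw.bounded t ht).hsENormOn_lt_top h0 h2 K,
    tendsto_zero_of_eventually_le_ofReal fun η hη => ?_⟩
  obtain ⟨χ, -, δ, hδ, hsmall⟩ := exists_hsENormOn_le h0 h2 hK (C + C) hη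
  have hlim : Tendsto (fun r => ‖mulL χ (w₀ r - w₀ t)‖) (𝓝[Icc 0 T] t) (𝓝 0) := by
    simpa only [ContinuousWithinAt, sub_self, map_zero, norm_zero] using
      ((mulL χ).continuous.comp_continuousOn'
        (hw.lipschitz.continuousOn.fun_sub (continuousOn_const (c := w₀ t)))).norm t ht
  filter_upwards [hlim.eventually_lt_const hδ, self_mem_nhdsWithin] with r hr hrT
  exact hsmall _ _ _ ((hw.bounded r hrT).sub (hw.bounded t ht)) hr.le

theorem linftyENorm_le {T η : ℝ} {K : Set ℝ} {w : ℝ → LTwo}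
    (h : ∀ t ∈ Icc 0 T, ∀ᵐ x ∂(volume.restrict K), |w t x| ≤ η) :
    linftyENorm T K w ≤ ENNReal.ofReal η := by
  refine iSup₂_le fun t ht => ?_
  rw [eLpNorm_exponent_top]
  exact eLpNormEssSup_le_of_ae_bound (h t ht)

theorem sqNormOn_le {T a b η : ℝ} {w : ℝ → ℝ → ℝ}
    (h : ∀ t ∈ Icc 0 T, ∀ᵐ x ∂(volume.restrict (Icc a b)), |w t x| ≤ η) :
    sqNormOn T a b w ≤ ENNReal.ofReal (η ^ 2 * (|b - a| * |T|)) := by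
  have hspace (t) (ht : t ∈ Icc 0 T) : ∫⁻ x in Icc a b, ‖w t x‖ₑ ^ 2
      ≤ ENNReal.ofReal (η ^ 2) * ENNReal.ofReal (b - a) := by
    calc ∫⁻ x in Icc a b, ‖w t x‖ₑ ^ 2 ≤ ∫⁻ _ in Icc a b, ENNReal.ofReal (η ^ 2) := by
          refine lintegral_mono_ae ((h t ht).mono fun x hx => ?_)
          rw [Real.enorm_eq_ofReal_abs, ← ENNReal.ofReal_pow (abs_nonneg _)]
          gcongr
      _ = _ := by rw [setLIntegral_const, Real.volume_Icc]
  calc sqNormOn T a b w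
      ≤ ∫⁻ _ in Icc 0 T, ENNReal.ofReal (η ^ 2) * ENNReal.ofReal (b - a) :=
        setLIntegral_mono measurable_const hspace
    _ = ENNReal.ofReal (η ^ 2) * (ENNReal.ofReal (b - a) * ENNReal.ofReal T) := by
        rw [setLIntegral_const, Real.volume_Icc, sub_zero, mul_assoc]
    _ ≤ ENNReal.ofReal (η ^ 2) * (ENNReal.ofReal |b - a| * ENNReal.ofReal |T|) := by
        gcongr <;> exact le_abs_self _
    _ = ENNReal.ofReal (η ^ 2 * (|b - a| * |T|)) := by
        rw [ENNReal.ofReal_mul (sq_nonneg η), ENNReal.ofReal_mul (abs_nonneg _)]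

theorem tendsto_sqNormOn {T a b : ℝ} {w : ℕ → ℝ → ℝ → ℝ}
    (h : ∀ η > 0, ∀ᶠ k in atTop, ∀ t ∈ Icc 0 T, ∀ᵐ x ∂(volume.restrict (Icc a b)),
      |w k t x| ≤ η) : Tendsto (fun k => sqNormOn T a b (w k)) atTop (𝓝 0) := by
  refine tendsto_zero_of_eventually_le_ofReal fun η hη => ?_
  set A := |b - a| * |T|
  have hη' : 0 < η / (A + 1) := by positivity
  refine (h √(η / (A + 1)) (Real.sqrt_pos.2 hη')).mono fun k hk => (sqNormOn_le hk).trans ?_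
  refine ENNReal.ofReal_le_ofReal ?_
  calc √(η / (A + 1)) ^ 2 * A ≤ η / (A + 1) * (A + 1) := by
        rw [Real.sq_sqrt hη'.le]
        gcongr
        exact (lt_add_one A).le
    _ = η := div_mul_cancel₀ η (by positivity)

end BoundedCurves

section Convergence

theorem mollifier_eq_zero {θ : ℝ → ℝ} {R ε : ℝ} (hR : ∀ x, R < |x| → θ x = 0) (hε : 0 < ε)
    {x : ℝ} (hx : R * ε < |x|) : mollifier θ ε x = 0 := by
  rw [mollifier, hR, mul_zero]
  rwa [abs_div, abs_of_pos hε, lt_div_iff₀ hε]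

theorem IsEvenBump.exists_support_subset {θ : ℝ → ℝ} (hθ : IsEvenBump θ) :
    ∃ R, ∀ x, R < |x| → θ x = 0 := by
  obtain ⟨R, -, hR⟩ := hθ.compact.isCompact.isBounded.exists_pos_norm_lt
  exact ⟨R, fun x hx => image_eq_zero_of_notMem_tsupport fun hmem => lt_asymm hx (hR x hmem)⟩

theorem abs_cube_sub_cube_le {x y M : ℝ} (hx : |x| ≤ M) (hy : |y| ≤ M) :
    |x ^ 3 - y ^ 3| ≤ 3 * M ^ 2 * |x - y| := by
  have hfactor : x ^ 3 - y ^ 3 = (x ^ 2 + x * y + y ^ 2) * (x - y) := by ring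
  have hM : 0 ≤ M := (abs_nonneg x).trans hx
  rw [hfactor, abs_mul]
  gcongr
  calc |x ^ 2 + x * y + y ^ 2| ≤ |x| ^ 2 + |x| * |y| + |y| ^ 2 := by
        rw [← abs_mul, ← abs_pow, ← abs_pow]
        exact abs_add_three _ _ _
    _ ≤ M ^ 2 + M * M + M ^ 2 := by gcongr
    _ = 3 * M ^ 2 := by ring

variable {T : ℝ} {C : NNReal} {w₀ w₁ w₂ : ℕ → ℝ → LTwo} {v₀ v₁ v₂ : ℝ → LTwo}
  (hw : ∀ k, IsBoundedCurve T C (w₀ k) (w₁ k) (w₂ k)) (hv : IsBoundedCurve T C v₀ v₁ v₂)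
  (h0 : ∀ t ∈ Icc 0 T, WeakTendsto (fun k => w₀ k t) (v₀ t))

include hw hv h0

theorem eventually_norm_mulL_sub_le {χ : ℝ →ᵇ ℝ} (hχ : HasCompactSupport χ) {δ : ℝ} (hδ : 0 < δ) :
    ∀ᶠ k in atTop, ∀ t ∈ Icc 0 T, ‖mulL χ (w₀ k t - v₀ t)‖ ≤ δ := by
  have hlip (k) : LipschitzOnWith (‖mulL χ‖₊ * (C + C)) (fun t => mulL χ (w₀ k t - v₀ t))
      (Icc 0 T) := (mulL χ).lipschitz.comp_lipschitzOnWith ((hw k).lipschitz.sub hv.lipschitz)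
  have hequi : Equicontinuous fun k (t : Icc 0 T) => mulL χ (w₀ k t - v₀ t) :=
    (LipschitzWith.uniformEquicontinuous _ _ fun k => (hlip k).to_restrict).equicontinuous
  have hpointwise (t : Icc 0 T) : Tendsto (fun k => mulL χ (w₀ k t - v₀ t)) atTop (𝓝 0) := by
    have hjet (k) := ((hw k).bounded t t.2).sub (hv.bounded t t.2)
    refine tendsto_zero_iff_norm_tendsto_zero.2 (tendsto_norm_mulL_of_weakTendsto
      (fun k => (hjet k).deriv_one) (fun k => (hjet k).norm_zero) (fun k => (hjet k).norm_one)
      ?_ hχ)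
    simpa only [sub_self] using (h0 t t.2).sub (weakTendsto_const (v₀ t))
  filter_upwards [Metric.tendstoUniformly_iff.1
    (tendstoUniformly_of_equicontinuous hequi hpointwise) δ hδ] with k hk t ht
  simpa only [dist_zero_left] using (hk ⟨t, ht⟩).le

theorem tendstoInCHs_of_weakTendsto {s : ℝ} (hs0 : 0 ≤ s) (hs2 : s < 2) {K : Set ℝ}
    (hK : IsCompact K) : TendstoInCHs T s K w₀ v₀ := by
  refine ⟨fun k => (hw k).continuousInHs hs0 hs2 hK, hv.continuousInHs hs0 hs2 hK,
    tendsto_zero_of_eventually_le_ofReal fun η hη => ?_⟩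
  obtain ⟨χ, hχ, δ, hδ, hsmall⟩ := exists_hsENormOn_le hs0 hs2 hK (C + C) hη
  filter_upwards [eventually_norm_mulL_sub_le hw hv h0 hχ hδ] with k hk
  exact iSup₂_le fun t ht =>
    hsmall _ _ _ (((hw k).bounded t ht).sub (hv.bounded t ht)) (hk t ht)

theorem eventually_ae_abs_slope_sub_le {K : Set ℝ} (hK : IsCompact K) {η : ℝ} (hη : 0 < η) :
    ∀ᶠ k in atTop, ∀ t ∈ Icc 0 T, ∀ᵐ x ∂(volume.restrict K), |(w₁ k t - v₁ t : LTwo) x| ≤ η := by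
  obtain ⟨χ, hχ, δ, hδ, hsmall⟩ := exists_ae_abs_slope_le hK (C + C) hη
  filter_upwards [eventually_norm_mulL_sub_le hw hv h0 hχ hδ] with k hk t ht
  exact hsmall _ _ _ (((hw k).bounded t ht).sub (hv.bounded t ht)) (hk t ht)

theorem tendstoInLinfty_of_weakTendsto {K : Set ℝ} (hK : IsCompact K) :
    TendstoInLinfty T K w₁ v₁ := by
  refine ⟨fun k => ?_, ?_, tendsto_zero_of_eventually_le_ofReal fun η hη => ?_⟩
  · exact (linftyENorm_le fun t ht => ae_restrict_of_ae
      ((hw k).bounded t ht).ae_abs_slope_le).trans_lt ENNReal.ofReal_lt_top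
  · exact (linftyENorm_le fun t ht => ae_restrict_of_ae
      (hv.bounded t ht).ae_abs_slope_le).trans_lt ENNReal.ofReal_lt_top
  · exact (eventually_ae_abs_slope_sub_le hw hv h0 hK hη).mono fun k hk => linftyENorm_le hk

variable {θ : ℝ → ℝ} (hθ : IsEvenBump θ) {ε : ℕ → ℝ} (hε : ∀ k, 0 < ε k)
  (hε0 : Tendsto ε atTop (𝓝 0))

include hθ hε hε0

theorem eventually_ae_abs_conv_slope_sub_le {K : Set ℝ} (hK : IsCompact K) {η : ℝ} (hη : 0 < η) :
    ∀ᶠ k in atTop, ∀ t ∈ Icc 0 T, ∀ᵐ x ∂(volume.restrict K),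
      |conv (w₁ k t) (mollifier θ (ε k)) x - v₁ t x| ≤ η := by
  obtain ⟨R, hR⟩ := hθ.exists_support_subset
  have hlim : Tendsto (fun k => √(R * ε k) * C) atTop (𝓝 0) := by
    simpa only [mul_zero, Real.sqrt_zero, zero_mul] using
      ((hε0.const_mul R).sqrt).mul_const (C : ℝ)
  filter_upwards [hlim.eventually_lt_const (half_pos hη),
    eventually_ae_abs_slope_sub_le hw hv h0 hK (half_pos hη)] with k hεk hk t ht
  have hjet := (hw k).bounded t ht
  filter_upwards [hk t ht, ae_restrict_of_ae (Lp.coeFn_sub (w₁ k t) (v₁ t)),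
    ae_restrict_of_ae (hjet.deriv_two.ae_abs_conv_sub_le (isEvenBump_mollifier hθ (hε k))
      fun x hx => mollifier_eq_zero hR (hε k) hx)] with x hx hsub hconv
  rw [hsub, Pi.sub_apply] at hx
  have hshift : |conv (w₁ k t) (mollifier θ (ε k)) x - w₁ k t x| ≤ η / 2 :=
    hconv.trans (le_trans (by gcongr; exact hjet.norm_two) hεk.le)
  linarith [abs_sub_le (conv (w₁ k t) (mollifier θ (ε k)) x) (w₁ k t x) (v₁ t x)]

theorem tendstoInLTwoOn_conv_slope (a b : ℝ) :
    TendstoInLTwoOn T a b (fun k t => conv (w₁ k t) (mollifier θ (ε k))) (fun t => v₁ t) := by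
  refine ⟨fun k => (sqNormOn_le (η := 2 * C) fun t ht => ?_).trans_lt ENNReal.ofReal_lt_top,
    (sqNormOn_le (η := 2 * C) fun t ht => ?_).trans_lt ENNReal.ofReal_lt_top,
    tendsto_sqNormOn fun η hη => ?_⟩
  · exact .of_forall
      (((hw k).bounded t ht).abs_conv_slope_le (isEvenBump_mollifier hθ (hε k)))
  · exact ae_restrict_of_ae (hv.bounded t ht).ae_abs_slope_le
  · exact eventually_ae_abs_conv_slope_sub_le hw hv h0 hθ hε hε0 isCompact_Icc hη

theorem tendstoInLTwoOn_conv_slope_cube (a b : ℝ) :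
    TendstoInLTwoOn T a b (fun k t x => conv (w₁ k t) (mollifier θ (ε k)) x ^ 3)
      (fun t x => v₁ t x ^ 3) := by
  have hconv (k) {t} (ht : t ∈ Icc 0 T) (x) :
      |conv (w₁ k t) (mollifier θ (ε k)) x| ≤ 2 * C :=
    ((hw k).bounded t ht).abs_conv_slope_le (isEvenBump_mollifier hθ (hε k)) x
  have hlimit {t} (ht : t ∈ Icc 0 T) : ∀ᵐ x ∂(volume.restrict (Icc a b)), |v₁ t x| ≤ 2 * C :=
    ae_restrict_of_ae (hv.bounded t ht).ae_abs_slope_le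
  have hcube {y : ℝ} (hy : |y| ≤ 2 * C) : |y ^ 3| ≤ (2 * C) ^ 3 := by
    rw [abs_pow]
    gcongr
  refine ⟨fun k => (sqNormOn_le (η := (2 * C) ^ 3) fun t ht => ?_).trans_lt ENNReal.ofReal_lt_top,
    (sqNormOn_le (η := (2 * C) ^ 3) fun t ht => ?_).trans_lt ENNReal.ofReal_lt_top,
    tendsto_sqNormOn fun η hη => ?_⟩
  · exact .of_forall fun x => hcube (hconv k ht x)
  · exact (hlimit ht).mono fun x => hcube
  · set A : ℝ := 3 * (2 * C) ^ 2
    have : 0 ≤ A := by positivity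
    filter_upwards [eventually_ae_abs_conv_slope_sub_le hw hv h0 hθ hε hε0 isCompact_Icc
      (show 0 < η / (A + 1) by positivity)] with k hk t ht
    filter_upwards [hk t ht, hlimit ht] with x hx hvx
    calc _ ≤ A * |conv (w₁ k t) (mollifier θ (ε k)) x - v₁ t x| :=
          abs_cube_sub_cube_le (hconv k ht x) hvx
      _ ≤ (A + 1) * (η / (A + 1)) := by gcongr; linarith
      _ = η := mul_div_cancel₀ η (by positivity)

end Convergence

section SobolevCurves

theorem isClosed_sobolevH (m : ℕ) :
    IsClosed (SobolevH m : Set (PiLp 2 (fun _ : Fin (m + 1) => LTwo))) := by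
  have hinter : (SobolevH m : Set (PiLp 2 (fun _ : Fin (m + 1) => LTwo))) =
      ⋂ j : Fin (m + 1), (fun F => (F 0, F j)) ⁻¹' {q : LTwo × LTwo | IsWeakDeriv j q.1 q.2} := by
    ext F
    simp only [mem_iInter, mem_preimage, mem_ofPred_eq]
    rfl
  rw [hinter]
  exact isClosed_iInter fun j => (isClosed_isWeakDeriv j).preimage (by fun_prop)

instance (m : ℕ) : CompleteSpace (SobolevH m) := (isClosed_sobolevH m).completeSpace_coe

instance (m : ℕ) : SecondCountableTopology (PiLp 2 (fun _ : Fin (m + 1) => LTwo)) :=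
  (PiLp.homeomorph 2 (fun _ : Fin (m + 1) => LTwo)).secondCountableTopology

theorem injective_dx_zero (m : ℕ) : Function.Injective (dx 0 : SobolevH m → LTwo) := by
  refine fun u v h => Subtype.ext (PiLp.ext fun j => (isWeakDeriv_dx j u).unique ?_)
  rw [h]
  exact isWeakDeriv_dx j v

-- `H^m(ℝ) → L²(ℝ)` is a continuous injection of Polish spaces, hence a measurable embedding
-- (Lusin–Souslin), so that continuity in `L²(ℝ)` suffices for measurability in `H^m(ℝ)`.
theorem memLp_of_continuousOn_dx_zero {T M : ℝ} {m : ℕ} {u : ℝ → SobolevH m}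
    (hc : ContinuousOn (fun t => dx 0 (u t)) (Icc 0 T)) (hM : ∀ t ∈ Icc 0 T, ‖u t‖ ≤ M) :
    MemLp u 2 (volume.restrict (Icc 0 T)) := by
  borelize LTwo
  borelize ↥(SobolevH m)
  have hemb : MeasurableEmbedding (dx 0 : SobolevH m → LTwo) :=
    (dxL 0).continuous.measurableEmbedding (injective_dx_zero m)
  have hmeas : AEMeasurable u (volume.restrict (Icc 0 T)) :=
    hemb.aemeasurable_comp_iff.1 (hc.aemeasurable measurableSet_Icc)
  exact .of_bound hmeas.aestronglyMeasurable M (ae_restrict_of_forall_mem measurableSet_Icc hM)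

theorem norm_le_of_isBoundedJet {u : SobolevH 2} {C : ℝ}
    (hu : IsBoundedJet C (dx 0 u) (dx 1 u) (dx 2 u)) : ‖u‖ ≤ 3 * C := by
  have hC := hu.nonneg
  have hsum : ‖u‖ ^ 2 = ‖dx 0 u‖ ^ 2 + ‖dx 1 u‖ ^ 2 + ‖dx 2 u‖ ^ 2 :=
    (PiLp.norm_sq_eq_of_L2 (fun _ : Fin 3 => LTwo) u).trans (Fin.sum_univ_three _)
  refine le_of_sq_le_sq ?_ (by positivity)
  calc ‖u‖ ^ 2 ≤ C ^ 2 + C ^ 2 + C ^ 2 := by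
        rw [hsum]
        gcongr
        exacts [hu.norm_zero, hu.norm_one, hu.norm_two]
    _ ≤ (3 * C) ^ 2 := by nlinarith

theorem exists_sobolevH_weakTendsto {f g h : ℕ → LTwo} {C : ℝ} {y : LTwo}
    (hj : ∀ k, IsBoundedJet C (f k) (g k) (h k)) (hy : WeakTendsto f y) :
    ∃ u : SobolevH 2, IsBoundedJet C (dx 0 u) (dx 1 u) (dx 2 u) ∧ WeakTendsto f (dx 0 u) ∧
      WeakTendsto h (dx 2 u) := by
  obtain ⟨y₁, hy₁, hg⟩ :=
    exists_isWeakDeriv_weakTendsto (fun k => (hj k).deriv_one) (fun k => (hj k).norm_one) hy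
  obtain ⟨y₂, hy₂, hh⟩ :=
    exists_isWeakDeriv_weakTendsto (fun k => (hj k).deriv_two) (fun k => (hj k).norm_two) hg
  have hjet : IsBoundedJet C y y₁ y₂ :=
    ⟨hy₁, hy₂, hy.norm_le fun k => (hj k).norm_zero, hg.norm_le fun k => (hj k).norm_one,
      hh.norm_le fun k => (hj k).norm_two⟩
  refine ⟨⟨WithLp.toLp 2 ![y, y₁, y₂], fun j => ?_⟩, hjet, hy, hh⟩
  fin_cases j
  exacts [isWeakDeriv_zero y, hy₁, hy₁.succ hy₂]

theorem exists_limit_curve {T : ℝ} {C : NNReal} {w₀ w₁ w₂ : ℕ → ℝ → LTwo}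
    (hw : ∀ k, IsBoundedCurve T C (w₀ k) (w₁ k) (w₂ k)) :
    ∃ φ : ℕ → ℕ, StrictMono φ ∧ ∃ u : ℝ → SobolevH 2,
      IsBoundedCurve T C (fun t => dx 0 (u t)) (fun t => dx 1 (u t)) (fun t => dx 2 (u t)) ∧
      MemLp u 2 (volume.restrict (Icc 0 T)) ∧
      ∀ t ∈ Icc 0 T, WeakTendsto (fun k => w₀ (φ k) t) (dx 0 (u t)) ∧
        WeakTendsto (fun k => w₂ (φ k) t) (dx 2 (u t)) := by
  have hequi : Equicontinuous fun k (t : Icc 0 T) => w₀ k t :=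
    (LipschitzWith.uniformEquicontinuous _ _ fun k => (hw k).lipschitz.to_restrict).equicontinuous
  obtain ⟨φ, hφ, hlim⟩ := exists_subseq_weakTendsto_of_equicontinuous hequi
    fun k t => ((hw k).bounded t t.2).norm_zero
  have hlimit : ∀ t ∈ Icc 0 T, ∃ u : SobolevH 2, IsBoundedJet C (dx 0 u) (dx 1 u) (dx 2 u) ∧
      WeakTendsto (fun k => w₀ (φ k) t) (dx 0 u) ∧ WeakTendsto (fun k => w₂ (φ k) t) (dx 2 u) :=
    fun t ht => (hlim ⟨t, ht⟩).elim fun y hy =>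
      exists_sobolevH_weakTendsto (fun k => (hw (φ k)).bounded t ht) hy
  choose! u hu using hlimit
  have hcurve : IsBoundedCurve T C (fun t => dx 0 (u t)) (fun t => dx 1 (u t))
      (fun t => dx 2 (u t)) :=
    { bounded := fun t ht => (hu t ht).1
      lipschitz := .of_dist_le_mul fun t ht s hs => by
        rw [dist_eq_norm]
        refine ((hu t ht).2.1.sub (hu s hs).2.1).norm_le fun k => ?_
        rw [← dist_eq_norm]
        exact (hw (φ k)).lipschitz.dist_le_mul t ht s hs }
  exact ⟨φ, hφ, u, hcurve, memLp_of_continuousOn_dx_zero hcurve.lipschitz.continuousOn fun t ht =>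
    norm_le_of_isBoundedJet (hcurve.bounded t ht), fun t ht => (hu t ht).2⟩

end SobolevCurves

section WeakConvergenceInTime

variable {T : ℝ}

theorem memLp_of_continuousOn {w : ℝ → LTwo} (hw : ContinuousOn w (Icc 0 T)) :
    MemLp w 2 (volume.restrict (Icc 0 T)) := by
  obtain ⟨C, hC⟩ := isCompact_Icc.exists_bound_of_continuousOn hw
  exact .of_bound (hw.aestronglyMeasurable measurableSet_Icc) C
    (ae_restrict_of_forall_mem measurableSet_Icc hC)

theorem norm_toLp_le {w : ℝ → LTwo} {C : ℝ} (hw : MemLp w 2 (volume.restrict (Icc 0 T)))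
    (hC : ∀ t ∈ Icc 0 T, ‖w t‖ ≤ C) :
    ‖hw.toLp w‖ ≤ (volume.restrict (Icc 0 T)).real univ ^ (2 : ℝ≥0∞).toReal⁻¹ * |C| := by
  refine Lp.norm_le_of_ae_bound (abs_nonneg C) ?_
  filter_upwards [hw.coeFn_toLp, ae_restrict_mem measurableSet_Icc] with t hcoe ht
  rw [hcoe]
  exact (hC t ht).trans (le_abs_self C)

theorem inner_toLp_eq_integral {w g : ℝ → LTwo} {z : Lp LTwo 2 (volume.restrict (Icc 0 T))}
    (hz : z =ᵐ[volume.restrict (Icc 0 T)] w) (hg : MemLp g 2 (volume.restrict (Icc 0 T))) :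
    inner ℝ z (hg.toLp g) = ∫ t in Icc 0 T, inner ℝ (w t) (g t) := by
  rw [L2.inner_def]
  refine integral_congr_ae ?_
  filter_upwards [hz, hg.coeFn_toLp] with t hzt hgt
  rw [hzt, hgt]

theorem exists_subseq_tendstoWeakly {C : ℝ} {w : ℕ → ℝ → LTwo}
    (hw : ∀ k, ContinuousOn (w k) (Icc 0 T)) (hC : ∀ k, ∀ t ∈ Icc 0 T, ‖w k t‖ ≤ C) :
    ∃ φ : ℕ → ℕ, StrictMono φ ∧ ∃ v, TendstoWeakly T (fun k => w (φ k)) v := by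
  have hLp (k) := memLp_of_continuousOn (hw k)
  obtain ⟨φ, hφ, v, hv⟩ := exists_subseq_weakTendsto fun k => norm_toLp_le (hLp k) (hC k)
  refine ⟨φ, hφ, v, fun k => hLp _, Lp.memLp v, fun g hg => ?_⟩
  rw [← inner_toLp_eq_integral EventuallyEq.rfl hg]
  exact (hv (hg.toLp g)).congr fun k => inner_toLp_eq_integral (hLp (φ k)).coeFn_toLp hg

theorem tendstoWeakly_of_weakTendsto {C : ℝ} {w : ℕ → ℝ → LTwo} {v : ℝ → LTwo}
    (hw : ∀ k, ContinuousOn (w k) (Icc 0 T)) (hC : ∀ k, ∀ t ∈ Icc 0 T, ‖w k t‖ ≤ C)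
    (hv : MemLp v 2 (volume.restrict (Icc 0 T)))
    (h : ∀ t ∈ Icc 0 T, WeakTendsto (fun k => w k t) (v t)) : TendstoWeakly T w v := by
  refine ⟨fun k => memLp_of_continuousOn (hw k), hv, fun g hg => ?_⟩
  refine tendsto_integral_of_dominated_convergence (fun t => C * ‖g t‖) (fun k => ?_)
    ((hg.integrable one_le_two).norm.const_mul C)
    (fun k => ae_restrict_of_forall_mem measurableSet_Icc fun t ht => ?_)
    (ae_restrict_of_forall_mem measurableSet_Icc fun t ht => h t ht (g t))
  · exact ((hw k).aestronglyMeasurable measurableSet_Icc).inner hg.1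
  · exact (norm_inner_le_norm _ _).trans (by gcongr; exact hC k t ht)

theorem integral_inner_deriv_smul (hT : 0 ≤ T) {w w' : ℝ → LTwo}
    (hw : ∀ t ∈ Icc 0 T, HasDerivWithinAt w (w' t) (Icc 0 T) t)
    (hc : ContinuousOn w' (Icc 0 T)) {φ : ℝ → ℝ} (hφ : ContDiff ℝ ∞ φ)
    (hsupp : tsupport φ ⊆ Ioo 0 T) (z : LTwo) :
    ∫ t in Icc 0 T, inner ℝ (w t) (deriv φ t • z)
      = -∫ t in Icc 0 T, inner ℝ (w' t) (φ t • z) := by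
  have hwc : ContinuousOn w (Icc 0 T) := HasDerivWithinAt.continuousOn hw
  have hφ' := (contDiff_deriv_top hφ).continuous
  have hcont : ContinuousOn (fun t => inner ℝ (w t) (deriv φ t • z)) (Icc 0 T) :=
    hwc.inner (hφ'.smul continuous_const).continuousOn
  have hcont' : ContinuousOn (fun t => inner ℝ (w' t) (φ t • z)) (Icc 0 T) :=
    hc.inner (hφ.continuous.smul continuous_const).continuousOn
  have hderiv (t) (ht : t ∈ Ioo 0 T) : HasDerivAt (fun t => inner ℝ (w t) (φ t • z))
      (inner ℝ (w t) (deriv φ t • z) + inner ℝ (w' t) (φ t • z)) t :=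
    ((hw t (Ioo_subset_Icc_self ht)).hasDerivAt (Icc_mem_nhds ht.1 ht.2)).inner ℝ
      ((hφ.differentiable (by norm_num) t).hasDerivAt.smul_const z)
  have hzero (t) (ht : t ∉ Ioo 0 T) : φ t = 0 :=
    image_eq_zero_of_notMem_tsupport fun h => ht (hsupp h)
  have hftc := intervalIntegral.integral_eq_sub_of_hasDerivAt_of_le hT
    (hwc.inner (hφ.continuous.smul continuous_const).continuousOn) hderiv
    ((hcont.add hcont').intervalIntegrable_of_Icc hT)
  rw [hzero 0 (by simp), hzero T (by simp), zero_smul, inner_zero_right,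
    inner_zero_right, sub_zero, intervalIntegral.integral_of_le hT,
    ← integral_Icc_eq_integral_Ioc, integral_add hcont.integrableOn_Icc
    hcont'.integrableOn_Icc] at hftc
  exact eq_neg_of_add_eq_zero_left hftc

theorem memLp_smul_const {ψ : ℝ → ℝ} (hψ : Continuous ψ) (z : LTwo) :
    MemLp (fun t => ψ t • z) 2 (volume.restrict (Icc 0 T)) :=
  memLp_of_continuousOn (hψ.smul continuous_const).continuousOn

theorem inner_integral_smul {ψ : ℝ → ℝ} (hψ : Continuous ψ) (hc : HasCompactSupport ψ)
    {w : ℝ → LTwo} (hw : MemLp w 2 (volume.restrict (Icc 0 T))) (z : LTwo) :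
    inner ℝ z (∫ t in Icc 0 T, ψ t • w t) = ∫ t in Icc 0 T, inner ℝ (w t) (ψ t • z) := by
  obtain ⟨B, hB⟩ := hψ.bounded_above_of_compact_support hc
  have hintegrable : Integrable (fun t => ψ t • w t) (volume.restrict (Icc 0 T)) :=
    (hw.integrable one_le_two).bdd_smul B hψ.aestronglyMeasurable (.of_forall hB)
  rw [← integral_inner hintegrable z]
  exact integral_congr_ae (.of_forall fun t => by
    simp only [inner_smul_right, real_inner_comm])

theorem isWeakTimeDeriv_of_tendstoWeakly (hT : 0 ≤ T) {w w' : ℕ → ℝ → LTwo}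
    {v v' : ℝ → LTwo}
    (hw : ∀ k, ∀ t ∈ Icc 0 T, HasDerivWithinAt (w k) (w' k t) (Icc 0 T) t)
    (hc : ∀ k, ContinuousOn (w' k) (Icc 0 T)) (h : TendstoWeakly T w v)
    (h' : TendstoWeakly T w' v') : IsWeakTimeDeriv T v v' := by
  intro φ hφ hφc hsupp
  have hφ' := (contDiff_deriv_top hφ).continuous
  refine ext_inner_left ℝ fun z => ?_
  rw [inner_neg_right, inner_integral_smul hφ' hφc.deriv h.2.1,
    inner_integral_smul hφ.continuous hφc h'.2.1]
  refine tendsto_nhds_unique (h.2.2 _ (memLp_smul_const hφ' z)) ?_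
  simp only [integral_inner_deriv_smul hT (hw _) (hc _) hφ hsupp z]
  exact (h'.2.2 _ (memLp_smul_const hφ.continuous z)).neg

end WeakConvergenceInTime

section Limits

theorem exists_isBoundedCurve {T ν : ℝ} (hT : 0 < T) {ζ P θ : ℝ → ℝ} {f p : ℝ → SobolevH 2}
    {u₀ : SobolevH 2} {u₁ : LTwo} (hζ : ContDiffOn ℝ 2 ζ (Icc 0 T))
    (hP : Bornology.IsBounded (P '' Icc 0 T)) (hf : Bornology.IsBounded (f '' Icc 0 T))
    (hp : Bornology.IsBounded (p '' Icc 0 T)) (hθ : IsEvenBump θ) (hu₁ : MemLp u₁ ⊤ volume) :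
    ∃ C : NNReal, ∀ ε, 0 < ε → ∀ U : ℝ → SobolevH 4,
      IsMollifiedSolution T ν ζ P θ f p u₀ u₁ ε U →
      IsBoundedCurve T C (fun t => dx 0 (U t)) (fun t => dx 1 (U t)) (fun t => dx 2 (U t)) ∧
        ∀ t ∈ Icc 0 T, ‖dt T 1 U t‖ ≤ C := by
  obtain ⟨C, hC⟩ := exists_uniform_bound hT hζ hP hf hp hθ hu₁
  have hle {y : ℝ} (hy : y ≤ C) : y ≤ C.toNNReal := hy.trans C.le_coe_toNNReal
  refine ⟨C.toNNReal, fun ε hε U hU =>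
    ⟨⟨fun t ht => ⟨isWeakDeriv_dx_succ 0 (U t), isWeakDeriv_dx_succ 1 (U t), ?_, ?_, ?_⟩,
      (convex_Icc 0 T).lipschitzOnWith_of_nnnorm_hasDerivWithin_le
        (fun t ht => hU.regular.hasDerivWithinAt_dx_zero ht) fun t ht => ?_⟩, fun t ht => ?_⟩⟩
  all_goals obtain ⟨hvel, hzero, hone, htwo⟩ := hC ε hε U hU t ht
  exacts [hle hzero, hle hone, hle htwo, hle hvel, hle hvel]

theorem exists_subseq_tendstoWeakly_limit {T : ℝ} (hT : 0 < T) {C : NNReal}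
    {U : ℕ → ℝ → SobolevH 4} (hU : ∀ k, MemEZero T (U k))
    (hw : ∀ k, IsBoundedCurve T C (fun t => dx 0 (U k t)) (fun t => dx 1 (U k t))
      (fun t => dx 2 (U k t))) (hC : ∀ k, ∀ t ∈ Icc 0 T, ‖dt T 1 (U k) t‖ ≤ C) :
    ∃ σ : ℕ → ℕ, StrictMono σ ∧ ∃ (u : ℝ → SobolevH 2) (ut : ℝ → LTwo),
      IsBoundedCurve T C (fun t => dx 0 (u t)) (fun t => dx 1 (u t)) (fun t => dx 2 (u t)) ∧
      MemLp u 2 (volume.restrict (Icc 0 T)) ∧ IsWeakTimeDeriv T (fun t => dx 0 (u t)) ut ∧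
      (∀ t ∈ Icc 0 T, WeakTendsto (fun k => dx 0 (U (σ k) t)) (dx 0 (u t))) ∧
      TendstoWeakly T (fun k t => dx 0 (U (σ k) t)) (fun t => dx 0 (u t)) ∧
      TendstoWeakly T (fun k t => dt T 1 (U (σ k)) t) ut ∧
      TendstoWeakly T (fun k t => dx 2 (U (σ k) t)) (fun t => dx 2 (u t)) := by
  obtain ⟨φ, hφ, u, hu, huL, hlim⟩ := exists_limit_curve hw
  have hvel (k) : ContinuousOn (dt T 1 (U k)) (Icc 0 T) :=
    ((hU k).contDiffOn_dt_one hT).continuousOn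
  obtain ⟨ψ, hψ, ut, hut⟩ :=
    exists_subseq_tendstoWeakly (fun k => hvel (φ k)) fun k => hC (φ k)
  have h0 (t) (ht : t ∈ Icc 0 T) : WeakTendsto (fun k => dx 0 (U (φ (ψ k)) t)) (dx 0 (u t)) :=
    (hlim t ht).1.comp hψ
  have hweak : TendstoWeakly T (fun k t => dx 0 (U (φ (ψ k)) t)) (fun t => dx 0 (u t)) :=
    tendstoWeakly_of_weakTendsto (fun k => (hw (φ (ψ k))).lipschitz.continuousOn)
      (fun k t ht => ((hw _).bounded t ht).norm_zero) ((dxL 0).comp_memLp' huL) h0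
  have hweak' : TendstoWeakly T (fun k t => dx 2 (U (φ (ψ k)) t)) (fun t => dx 2 (u t)) :=
    tendstoWeakly_of_weakTendsto
      (fun k => (dxL 2).continuous.comp_continuousOn (hU (φ (ψ k))).1)
      (fun k t ht => ((hw _).bounded t ht).norm_two) ((dxL 2).comp_memLp' huL)
      fun t ht => (hlim t ht).2.comp hψ
  exact ⟨φ ∘ ψ, hφ.comp hψ, u, ut, hu, huL, isWeakTimeDeriv_of_tendstoWeakly hT.le
    (fun k t ht => (hU _).hasDerivWithinAt_dx_zero ht) (fun k => hvel _) hweak hut,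
    h0, hweak, hut, hweak'⟩

end Limits

theorem corollary2_general (T ν : ℝ) (hT : 0 < T)
    (ζ P θ : ℝ → ℝ) (f p : ℝ → SobolevH 2) (u₀ : SobolevH 2) (u₁ : LTwo)
    (hζ : ContDiffOn ℝ 2 ζ (Icc 0 T)) (hP : Bornology.IsBounded (P '' Icc 0 T))
    (hf : Bornology.IsBounded (f '' Icc 0 T)) (hp : Bornology.IsBounded (p '' Icc 0 T))
    (hθ : IsEvenBump θ) (hu₁ : MemLp u₁ ⊤ volume)
    (uε : ℝ → ℝ → SobolevH 4)
    (huε : ∀ ε : ℝ, 0 < ε → IsMollifiedSolution T ν ζ P θ f p u₀ u₁ ε (uε ε))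
    (e : ℕ → ℝ) (he : ∀ n, 0 < e n) (he0 : Tendsto e atTop (𝓝 0)) :
    ∃ σ : ℕ → ℕ, StrictMono σ ∧
    ∃ (u : ℝ → SobolevH 2) (ut : ℝ → LTwo),
      MemLp u 2 (volume.restrict (Icc 0 T)) ∧
      IsWeakTimeDeriv T (fun t => dx 0 (u t)) ut ∧
      (TendstoWeakly T (fun k t => dx 0 (uε (e (σ k)) t)) (fun t => dx 0 (u t)) ∧
        TendstoWeakly T (fun k t => dt T 1 (uε (e (σ k))) t) ut ∧
        TendstoWeakly T (fun k t => dx 2 (uε (e (σ k)) t)) (fun t => dx 2 (u t))) ∧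
      (∀ α : ℝ, 0 < α → α ≤ 2 → ∀ K : Set ℝ, IsCompact K →
        TendstoInCHs T (2 - α) K (fun k t => dx 0 (uε (e (σ k)) t)) (fun t => dx 0 (u t))) ∧
      (∀ K : Set ℝ, IsCompact K →
        TendstoInLinfty T K (fun k t => dx 1 (uε (e (σ k)) t)) (fun t => dx 1 (u t))) ∧
      (∀ a b : ℝ, a < b →
        TendstoInLTwoOn T a b
          (fun k t => conv (dx 1 (uε (e (σ k)) t)) (mollifier θ (e (σ k))))
          (fun t => dx 1 (u t)) ∧
        TendstoInLTwoOn T a b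
          (fun k t x => conv (dx 1 (uε (e (σ k)) t)) (mollifier θ (e (σ k))) x ^ 3)
          (fun t x => dx 1 (u t) x ^ 3)) := by
  obtain ⟨C, hC⟩ := exists_isBoundedCurve hT hζ hP hf hp hθ hu₁
  have hbound (n) := hC (e n) (he n) (uε (e n)) (huε (e n) (he n))
  obtain ⟨σ, hσ, u, ut, hu, huL, hut, h0, hweak⟩ := exists_subseq_tendstoWeakly_limit hT
    (fun n => (huε (e n) (he n)).regular) (fun n => (hbound n).1) (fun n => (hbound n).2)
  have hw (k) := (hbound (σ k)).1
  have hε (k) : 0 < e (σ k) := he (σ k)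
  have hε0 : Tendsto (fun k => e (σ k)) atTop (𝓝 0) := he0.comp hσ.tendsto_atTop
  refine ⟨σ, hσ, u, ut, huL, hut, hweak, fun α hα hα2 K hK => ?_, fun K hK => ?_,
    fun a b _ => ⟨?_, ?_⟩⟩
  · exact tendstoInCHs_of_weakTendsto hw hu h0 (by linarith) (by linarith) hK
  · exact tendstoInLinfty_of_weakTendsto hw hu h0 hK
  · exact tendstoInLTwoOn_conv_slope hw hu h0 hθ hε hε0 a b
  · exact tendstoInLTwoOn_conv_slope_cube hw hu h0 hθ hε hε0 a b

theorem corollary2 (T ν : ℝ) (hT : 0 < T)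
    (ζ P θ : ℝ → ℝ) (f p : ℝ → SobolevH 2) (u₀ : SobolevH 2) (u₁ : LTwo)
    (hζ : ContDiffOn ℝ 2 ζ (Icc 0 T)) (hP : ContDiffOn ℝ 2 P (Icc 0 T))
    (hf : ContinuousOn f (Icc 0 T)) (hp : ContinuousOn p (Icc 0 T))
    (hθ : IsEvenBump θ) (hu₁ : MemLp u₁ ⊤ volume)
    -- the family of solutions of the mollified problems
    (uε : ℝ → ℝ → SobolevH 4)
    (huε : ∀ ε : ℝ, 0 < ε → IsMollifiedSolution T ν ζ P θ f p u₀ u₁ ε (uε ε))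
    -- any sequence of positive parameters that tends to zero
    (e : ℕ → ℝ) (he : ∀ n, 0 < e n) (he0 : Tendsto e atTop (𝓝 0)) :
    -- has a subsequence `ε k = e (σ k)` along which the solutions converge to some `u`
    ∃ σ : ℕ → ℕ, StrictMono σ ∧
    ∃ (u : ℝ → SobolevH 2) (ut : ℝ → LTwo),
      MemLp u 2 (volume.restrict (Icc 0 T)) ∧
      IsWeakTimeDeriv T (fun t => dx 0 (u t)) ut ∧
      -- (i)
      (TendstoWeakly T (fun k t => dx 0 (uε (e (σ k)) t)) (fun t => dx 0 (u t)) ∧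
        TendstoWeakly T (fun k t => dt T 1 (uε (e (σ k))) t) ut ∧
        TendstoWeakly T (fun k t => dx 2 (uε (e (σ k)) t)) (fun t => dx 2 (u t))) ∧
      -- (ii)
      (∀ α : ℝ, 0 < α → α ≤ 2 → ∀ K : Set ℝ, IsCompact K →
        TendstoInCHs T (2 - α) K (fun k t => dx 0 (uε (e (σ k)) t)) (fun t => dx 0 (u t))) ∧
      (∀ K : Set ℝ, IsCompact K →
        TendstoInLinfty T K (fun k t => dx 1 (uε (e (σ k)) t)) (fun t => dx 1 (u t))) ∧
      -- (iii)
      (∀ a b : ℝ, a < b →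
        TendstoInLTwoOn T a b
          (fun k t => conv (dx 1 (uε (e (σ k)) t)) (mollifier θ (e (σ k))))
          (fun t => dx 1 (u t)) ∧
        TendstoInLTwoOn T a b
          (fun k t x => conv (dx 1 (uε (e (σ k)) t)) (mollifier θ (e (σ k))) x ^ 3)
          (fun t x => dx 1 (u t) x ^ 3)) :=
  have hbounded {E : Type} [SeminormedAddCommGroup E] {g : ℝ → E}
      (hg : ContinuousOn g (Icc 0 T)) : Bornology.IsBounded (g '' Icc 0 T) :=
    (isCompact_Icc.image_of_continuousOn hg).isBounded
  corollary2_general T ν hT ζ P θ f p u₀ u₁ hζ (hbounded hP.continuousOn) (hbounded hf)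
    (hbounded hp) hθ hu₁ uε huε e he he0
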